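/- **Setting.** Let $\Omega\subset\mathbb R^3$ be a bounded open set and $\mathcal T_h$ a finite conforming partition of $\Omega$ into polyhedra $T$, which need not be convex. Thus each $T$ is a bounded open set equal to the interior of its closure, whose boundary is the union of finitely many flat polygonal faces, each with a constant outward unit normal $\mathbf n$ of $T$; different faces of one element lie in different planes; the elements are pairwise disjoint and their closures cover $\Omega$; each face either lies on $\partial\Omega$ or has its relative interior in $\Omega$ and is a common face of the two elements on its two sides. Let $N_T$ be the number of faces of $T$ and $h_T$ its diameter. On a face $e$ fix orthonormal tangent vectors $\mathbf t_1,\mathbf t_2$. Let $P_r$ denote polynomials of total degree at most $r$, $(\cdot,\cdot)_T$ the $L^2(T)$ and $\langle\cdot,\cdot\rangle_{\partial T}$ the $L^2(\partial T)$ inner product. Fix $k\ge 2$. $W_h$ is the space of pairs $\sigma=\{\sigma_0,\sigma_b\}$ with $\sigma_0|_T\in P_k(T)$ on each element and one $\sigma_b|_e\in P_k(e)$ on each face; $V_h$ is the space of triples $\mathbf v=\{\mathbf v_0,\mathbf v_b,\mathbf v_n\}$ with $\mathbf v_0|_T\in[P_k(T)]^3$ and, on each face, tangential fields $\mathbf v_b=v_1\mathbf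 t_1+v_2\mathbf t_2$, $\mathbf v_n=v_3\mathbf t_1+v_4\mathbf t_2$ with $v_1,v_2\in P_k(e)$, $v_3,v_4\in P_{k-1}(e)$. $W_h^0\subset W_h$ is given by $\sigma_b=0$ on $\partial\Omega$, and $V_h^0\subset V_h$ by $\mathbf v_b\times\mathbf n=0$, $\mathbf v_n\times\mathbf n=0$ on $\partial\Omega$. For integers $r_1(T),r_2(T)$, on each $T$ let $\nabla_w\sigma\in[P_{r_2(T)}(T)]^3$ and $(\nabla\times)^2_w\mathbf v\in[P_{r_1(T)}(T)]^3$ be the unique polynomial fields with $$(\nabla_w\sigma,\psi)_T=-(\sigma_0,\nabla\cdot\psi)_T+\langle\sigma_b,\psi\cdot\mathbf n\rangle_{\partial T}\quad\forall\psi\in[P_{r_2(T)}(T)]^3,$$ $$((\nabla\times)^2_w\mathbf v,\mathbf q)_T=(\mathbf v_0,(\nabla\times)^2\mathbf q)_T-\langle\mathbf v_b\times\mathbf n,\nabla\times\mathbf q\rangle_{\partial T}-\langle\mathbf v_n\times\mathbf n,\mathbf q\rangle_{\partial T}\quad\forall\mathbf q\in[P_{r_1(T)}(T)]^3 .$$ Put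 $a(\mathbf u,\mathbf v)=\sum_T((\nabla\times)_w^2\mathbf u,(\nabla\times)_w^2\mathbf v)_T$, $b(\mathbf u,q)=\sum_T(\mathbf u_0,\nabla_wq)_T$, $c(p,q)=\sum_Th_T^4(\nabla_wp,\nabla_wq)_T$. **Theorem.** Assume for every element $T$ that $r_2(T)\ge 2N_T+k-1$ and $r_1(T)\ge 2N_T+k-2$, where in the borderline case $r_1(T)=2N_T+k-2$ the element $T$ is required to have a face which is not cut by the planes of two further faces of $T$ (the face lies on one side of each of these two planes), the normals of the three faces being linearly independent; a convex face, for example, has this property. Then for every $\mathbf f\in H(\mathrm{div}^0;\Omega)=\{\mathbf f\in[L^2(\Omega)]^3:\nabla\cdot\mathbf f=0\}$ there is exactly one pair $(\mathbf u_h;p_h)\in V_h^0\times W_h^0$ with $$a(\mathbf u_h,\mathbf v_h)+b(\mathbf v_h,p_h)=(\mathbf f,\mathbf v_0)\quad\forall\mathbf v_h\in V_h^0,\qquad c(p_h,q_h)-b(\mathbf u_h,q_h)=0\quad\forall q_h\in W_h^0 .$$ In particular, for $\mathbf f=0$ the only solution is $\mathbf u_h=0$, $p_h=0$. -/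

import Mathlib

open MeasureTheory Set Filter Topology

open scoped ContDiff RealInnerProductSpace

namespace QuadCurlWG

noncomputable section

/-- Euclidean three-space. -/
abbrev E3 := EuclideanSpace ℝ (Fin 3)

/-- The Euclidean plane, used for coordinates on the faces. -/
abbrev E2 := EuclideanSpace ℝ (Fin 2)

/-- Real polynomials in three variables. -/
abbrev Poly3 := MvPolynomial (Fin 3) ℝ

/-- Real polynomials in two variables. -/
abbrev Poly2 := MvPolynomial (Fin 2) ℝ

/-- The cross product on Euclidean three-space. -/
def cross (a b : E3) : E3 := WithLp.toLp 2 (crossProduct a.ofLp b.ofLp)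

/-! ### Polynomials and polynomial vector fields -/

/-- The value of a scalar polynomial at a point of space. -/
def ev3 (p : Poly3) (x : E3) : ℝ := MvPolynomial.eval (fun a => x a) p

/-- The value of a scalar polynomial at a point of the coordinate plane. -/
def ev2 (p : Poly2) (x : E2) : ℝ := MvPolynomial.eval (fun a => x a) p

/-- The value of a polynomial vector field at a point of space. -/
def vev (q : Fin 3 → Poly3) (x : E3) : E3 := WithLp.toLp 2 fun a => ev3 (q a) x

/-- The divergence of a polynomial vector field. -/
def divP (q : Fin 3 → Poly3) : Poly3 := ∑ a, MvPolynomial.pderiv a (q a)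

/-- The curl of a polynomial vector field. -/
def curlP (q : Fin 3 → Poly3) : Fin 3 → Poly3 :=
  ![MvPolynomial.pderiv 1 (q 2) - MvPolynomial.pderiv 2 (q 1),
    MvPolynomial.pderiv 2 (q 0) - MvPolynomial.pderiv 0 (q 2),
    MvPolynomial.pderiv 0 (q 1) - MvPolynomial.pderiv 1 (q 0)]

/-- The space `[P_r]³` of polynomial vector fields of degree at most `r`. -/
abbrev PolyVec (r : ℕ) := Fin 3 → MvPolynomial.restrictTotalDegree (Fin 3) ℝ r

/-- The polynomial vector field underlying an element of `[P_r]³`. -/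
def PolyVec.toField {r : ℕ} (q : PolyVec r) : Fin 3 → Poly3 := fun a => (q a : Poly3)

/-- The `L²(T)` inner product of two scalar polynomials. -/
def innerS (T : Set E3) (p q : Poly3) : ℝ := ∫ x in T, ev3 p x * ev3 q x

/-- The `[L²(T)]³` inner product of two polynomial vector fields. -/
def innerV (T : Set E3) (p q : Fin 3 → Poly3) : ℝ := ∫ x in T, ⟪vev p x, vev q x⟫

/-! ### Faces -/

/-- A flat polygonal face in space. It is given by an isometric parametrization of its plane
(a base point and two orthonormal tangent vectors) and by the polygonal region that it occupies
in these coordinates. -/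
structure Face where
  base : E3
  tangent : Fin 2 → E3
  region : Set E2
  orthonormal : Orthonormal ℝ tangent
  isCompact_region : IsCompact region
  nonempty_region : region.Nonempty
  closure_interior : closure (interior region) = region
  /-- The boundary of the region lies in finitely many lines. -/
  polygonal : ∃ s : Finset (E2 × ℝ), (∀ l ∈ s, l.1 ≠ 0) ∧
    frontier region ⊆ {x | ∃ l ∈ s, ⟪l.1, x⟫ = l.2}

namespace Face

variable (F : Face)

/-- The point of the plane of `F` with given coordinates. -/
def point (x : E2) : E3 := F.base + x 0 • F.tangent 0 + x 1 • F.tangent 1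

/-- The face as a set of points in space. -/
def carrier : Set E3 := F.point '' F.region

/-- The relative interior of the face. -/
def relInterior : Set E3 := F.point '' interior F.region

/-- The plane that contains the face. -/
def plane : Set E3 := range F.point

/-- The surface integral over the face of a function of the face coordinates. -/
def integral (g : E2 → ℝ) : ℝ := ∫ x in F.region, g x

/-- The tangential vector field `w₁ t₁ + w₂ t₂` on the face, with polynomial coefficients. -/
def tanField (w : Fin 2 → Poly2) (x : E2) : E3 :=
  ev2 (w 0) x • F.tangent 0 + ev2 (w 1) x • F.tangent 1

end Face

/-! ### Meshes -/

/-- A finite partition of an open set `Ω` into polyhedra, which need not be convex. The elements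
are indexed by `ι` and the faces by `κ`. Each element is a bounded open set (its closure is the
closed polyhedron), and a face is shared by the elements on its two sides. -/
structure Mesh (Ω : Set E3) (ι κ : Type*) where
  body : ι → Set E3
  face : κ → Face
  /-- The faces of an element. -/
  faces : ι → Finset κ
  /-- `normal i F` is the outward unit normal of the element `i` on its face `F`. -/
  normal : ι → κ → E3
  isOpen_domain : IsOpen Ω
  isOpen_body : ∀ i, IsOpen (body i)
  nonempty_body : ∀ i, (body i).Nonempty
  isBounded_body : ∀ i, Bornology.IsBounded (body i)
  interior_closure_body : ∀ i, interior (closure (body i)) = body i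
  frontier_body : ∀ i, frontier (body i) = ⋃ F ∈ faces i, (face F).carrier
  /-- Different faces of one element lie in different planes. -/
  plane_ne : ∀ i, ∀ F ∈ faces i, ∀ G ∈ faces i, F ≠ G → (face F).plane ≠ (face G).plane
  norm_normal : ∀ i, ∀ F ∈ faces i, ‖normal i F‖ = 1
  normal_orthogonal : ∀ i, ∀ F ∈ faces i, ∀ a, ⟪normal i F, (face F).tangent a⟫ = 0
  normal_outward : ∀ i, ∀ F ∈ faces i, ∀ x ∈ (face F).relInterior,
    (∀ G ∈ faces i, G ≠ F → x ∉ (face G).carrier) →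
      ∀ᶠ s : ℝ in 𝓝[>] 0, x - s • normal i F ∈ body i ∧ x + s • normal i F ∉ body i
  body_subset : ∀ i, body i ⊆ Ω
  disjoint_body : ∀ i j, i ≠ j → Disjoint (body i) (body j)
  cover : Ω ⊆ ⋃ i, closure (body i)
  /-- Every face is a face of some element. -/
  exists_mem_faces : ∀ F, ∃ i, F ∈ faces i
  /-- Every face lies on the boundary of `Ω`, or else its relative interior is inside `Ω` and it is
  a face of the elements on both of its sides. -/
  boundary_or_interior : ∀ F, (face F).carrier ⊆ frontier Ω ∨
    ((face F).relInterior ⊆ Ω ∧ ∃ i j, i ≠ j ∧ F ∈ faces i ∧ F ∈ faces j)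

/-- Scalar weak functions `{σ₀, σ_b}` on a mesh with polynomial components: `σ₀` is given on every
element, and `σ_b` on every face, in the coordinates of that face. -/
abbrev ScalarWeak (ι κ : Type*) := (ι → Poly3) × (κ → Poly2)

/-- Vector weak functions `{v₀, v_b, v_n}` on a mesh with polynomial components: `v₀` is given on
every element, and `v_b`, `v_n` are tangential fields on every face, given by their coefficients
with respect to the two tangent vectors of that face. -/
abbrev VectorWeak (ι κ : Type*) :=
  (ι → Fin 3 → Poly3) × (κ → Fin 2 → Poly2) × (κ → Fin 2 → Poly2)

/-! ### Integrability and representation of functionals on `[P_r(T)]³` -/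

theorem continuous_ev3 (p : Poly3) : Continuous (ev3 p) := by
  unfold ev3
  exact (MvPolynomial.continuous_eval p).comp (by fun_prop)

theorem continuous_ev2 (p : Poly2) : Continuous (ev2 p) := by
  unfold ev2
  exact (MvPolynomial.continuous_eval p).comp (by fun_prop)

theorem continuous_vev (q : Fin 3 → Poly3) : Continuous (vev q) := by
  unfold vev
  exact (PiLp.continuous_toLp 2 _).comp (continuous_pi fun a => continuous_ev3 (q a))

theorem continuous_point (F : Face) : Continuous F.point := by
  unfold Face.point
  fun_prop

theorem continuous_cross {X : Type*} [TopologicalSpace X] {f g : X → E3} (hf : Continuous f)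
    (hg : Continuous g) : Continuous fun x => cross (f x) (g x) := by
  unfold cross
  refine (PiLp.continuous_toLp 2 _).comp (continuous_pi fun a => ?_)
  fin_cases a <;> simp [crossProduct] <;> fun_prop

theorem continuous_tanField (F : Face) (w : Fin 2 → Poly2) : Continuous (F.tanField w) := by
  unfold Face.tanField
  exact ((continuous_ev2 _).smul continuous_const).add ((continuous_ev2 _).smul continuous_const)

theorem integrableOn_bounded {T : Set E3} (hT : Bornology.IsBounded T) {g : E3 → ℝ}
    (hg : Continuous g) : IntegrableOn g T :=
  (hg.continuousOn.integrableOn_compact hT.isCompact_closure).mono_set subset_closure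

theorem integrableOn_region (F : Face) {g : E2 → ℝ} (hg : Continuous g) :
    IntegrableOn g F.region :=
  hg.continuousOn.integrableOn_compact F.isCompact_region

theorem ev3_add (p q : Poly3) (x : E3) : ev3 (p + q) x = ev3 p x + ev3 q x := by simp [ev3]

theorem ev3_smul (c : ℝ) (p : Poly3) (x : E3) : ev3 (c • p) x = c * ev3 p x := by
  simp [ev3, MvPolynomial.smul_eval]

theorem vev_add (p q : Fin 3 → Poly3) (x : E3) : vev (p + q) x = vev p x + vev q x := by
  ext a; simp [vev, ev3_add]

theorem vev_smul (c : ℝ) (p : Fin 3 → Poly3) (x : E3) : vev (c • p) x = c • vev p x := by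
  ext a; simp [vev, ev3_smul]

theorem divP_add (p q : Fin 3 → Poly3) : divP (p + q) = divP p + divP q := by
  simp [divP, Finset.sum_add_distrib]

theorem divP_smul (c : ℝ) (p : Fin 3 → Poly3) : divP (c • p) = c • divP p := by
  simp [divP, Finset.smul_sum]

theorem curlP_add (p q : Fin 3 → Poly3) : curlP (p + q) = curlP p + curlP q := by
  funext a; fin_cases a <;> simp [curlP] <;> ring

theorem curlP_smul (c : ℝ) (p : Fin 3 → Poly3) : curlP (c • p) = c • curlP p := by
  funext a; fin_cases a <;> simp [curlP, smul_sub]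

theorem innerS_add_right {T : Set E3} (hT : Bornology.IsBounded T) (p q r : Poly3) :
    innerS T p (q + r) = innerS T p q + innerS T p r := by
  have hI : ∀ s : Poly3, IntegrableOn (fun x => ev3 p x * ev3 s x) T := fun s =>
    integrableOn_bounded hT ((continuous_ev3 p).mul (continuous_ev3 s))
  unfold innerS
  rw [← integral_add (hI q) (hI r)]
  simp [ev3_add, mul_add]

theorem innerS_smul_right (T : Set E3) (c : ℝ) (p q : Poly3) :
    innerS T p (c • q) = c * innerS T p q := by
  unfold innerS
  rw [← integral_const_mul]
  simp [ev3_smul, mul_left_comm]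

theorem innerV_add_right {T : Set E3} (hT : Bornology.IsBounded T) (p q r : Fin 3 → Poly3) :
    innerV T p (q + r) = innerV T p q + innerV T p r := by
  unfold innerV
  rw [← integral_add (integrableOn_bounded hT ((continuous_vev _).inner (continuous_vev _)))
    (integrableOn_bounded hT ((continuous_vev _).inner (continuous_vev _)))]
  simp [vev_add, inner_add_right]

theorem innerV_smul_right (T : Set E3) (c : ℝ) (p q : Fin 3 → Poly3) :
    innerV T p (c • q) = c * innerV T p q := by
  unfold innerV
  rw [← integral_const_mul]
  simp [vev_smul, inner_smul_right]

theorem innerV_comm (T : Set E3) (p q : Fin 3 → Poly3) : innerV T p q = innerV T q p := by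
  unfold innerV
  simp only [real_inner_comm]

theorem innerV_self_eq_zero {T : Set E3} (hT : IsOpen T) (hne : T.Nonempty)
    (hb : Bornology.IsBounded T) {p : Fin 3 → Poly3} (h : innerV T p p = 0) : p = 0 := by
  have hc : Continuous fun x => ⟪vev p x, vev p x⟫ := (continuous_vev p).inner (continuous_vev p)
  have h0 : ∀ x ∈ T, vev p x = 0 := by
    unfold innerV at h
    rw [setIntegral_eq_zero_iff_of_nonneg_ae
      (Eventually.of_forall fun x => real_inner_self_nonneg)
      (integrableOn_bounded hb hc)] at h
    have := Measure.eqOn_open_of_ae_eq h hT hc.continuousOn continuousOn_const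
    intro x hx
    exact inner_self_eq_zero.1 (this hx)
  obtain ⟨x₀, hx₀⟩ := hne
  obtain ⟨ε, hε, hball⟩ : ∃ ε > 0, ∀ y : Fin 3 → ℝ, (∀ a, |y a - x₀ a| < ε) →
      (WithLp.toLp 2 y : E3) ∈ T := by
    have hopen : IsOpen ((fun y : Fin 3 → ℝ => (WithLp.toLp 2 y : E3)) ⁻¹' T) :=
      hT.preimage (PiLp.continuous_toLp 2 _)
    obtain ⟨ε, hε, hsub⟩ := Metric.isOpen_iff.1 hopen (x₀.ofLp) (by simpa using hx₀)
    refine ⟨ε, hε, fun y hy => hsub ?_⟩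
    rw [Metric.mem_ball, dist_pi_lt_iff hε]
    intro a
    simpa [Real.dist_eq] using hy a
  funext a
  refine MvPolynomial.funext_set (fun b => Ioo (x₀ b - ε) (x₀ b + ε))
    (fun b => Ioo_infinite (by linarith)) (fun y hy => ?_)
  have hy' : ∀ b, |y b - x₀ b| < ε := fun b => by
    have := hy b (mem_univ b)
    rw [abs_lt]
    constructor <;> linarith [this.1, this.2]
  have := congrArg (fun v : E3 => v a) (h0 _ (hball y hy'))
  simpa [vev, ev3] using this

/-- Every linear functional on `[P_r(T)]³` is represented by exactly one element of `[P_r(T)]³`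
with respect to the `L²(T)` inner product. -/
theorem existsUnique_represent {T : Set E3} (hT : IsOpen T) (hne : T.Nonempty)
    (hb : Bornology.IsBounded T) {r : ℕ} (L : PolyVec r →ₗ[ℝ] ℝ) :
    ∃! g : PolyVec r, ∀ q : PolyVec r, innerV T g.toField q.toField = L q := by
  let B : PolyVec r →ₗ[ℝ] Module.Dual ℝ (PolyVec r) :=
    LinearMap.mk₂ ℝ (fun p q => innerV T p.toField q.toField)
      (fun p p' q => by
        rw [innerV_comm, innerV_comm T p.toField, innerV_comm T p'.toField]
        exact innerV_add_right hb _ _ _)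
      (fun c p q => by
        rw [innerV_comm, innerV_comm T p.toField]
        exact innerV_smul_right T c _ _)
      (fun p q q' => innerV_add_right hb _ _ _)
      (fun c p q => innerV_smul_right T c _ _)
  have hinj : Function.Injective B := by
    rw [← LinearMap.ker_eq_bot, LinearMap.ker_eq_bot']
    intro p hp
    have h1 : innerV T p.toField p.toField = 0 := by
      exact LinearMap.congr_fun hp p
    have h2 := innerV_self_eq_zero hT hne hb h1
    funext a
    exact Subtype.ext (congrFun h2 a)
  have hsurj : Function.Surjective B :=
    (LinearMap.injective_iff_surjective_of_finrank_eq_finrank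
      (Subspace.dual_finrank_eq (K := ℝ) (V := PolyVec r)).symm).1 hinj
  obtain ⟨g, hg⟩ := hsurj L
  refine ⟨g, fun q => LinearMap.congr_fun hg q, fun g' hg' => hinj ?_⟩
  rw [hg]
  exact LinearMap.ext hg'

namespace Mesh

variable {Ω : Set E3} {ι κ : Type*} (M : Mesh Ω ι κ)

/-! ### Discrete weak differential operators -/

/-- The functional `ψ ↦ -(σ₀, ∇ · ψ)_T + ⟨σ_b, ψ · n⟩_∂T` on `[P_r(T)]³`. -/
def weakGradFunctional (i : ι) (r : ℕ) (σ : ScalarWeak ι κ) : PolyVec r →ₗ[ℝ] ℝ where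
  toFun ψ := -innerS (M.body i) (σ.1 i) (divP ψ.toField) +
    ∑ F ∈ M.faces i, (M.face F).integral fun x =>
      ev2 (σ.2 F) x * ⟪vev ψ.toField ((M.face F).point x), M.normal i F⟫
  map_add' p q := by
    have hf : (p + q).toField = p.toField + q.toField := rfl
    have hI : ∀ (ψ : PolyVec r) (F : κ), IntegrableOn (fun x =>
        ev2 (σ.2 F) x * ⟪vev ψ.toField ((M.face F).point x), M.normal i F⟫)
        (M.face F).region := fun ψ F =>
      integrableOn_region _ ((continuous_ev2 _).mul
        (((continuous_vev _).comp (continuous_point _)).inner continuous_const))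
    have hs : ∀ F, ((M.face F).integral fun x =>
        ev2 (σ.2 F) x * ⟪vev (p + q).toField ((M.face F).point x), M.normal i F⟫) =
        ((M.face F).integral fun x =>
          ev2 (σ.2 F) x * ⟪vev p.toField ((M.face F).point x), M.normal i F⟫) +
        (M.face F).integral fun x =>
          ev2 (σ.2 F) x * ⟪vev q.toField ((M.face F).point x), M.normal i F⟫ := fun F => by
      unfold Face.integral
      rw [← integral_add (hI p F) (hI q F)]
      simp [hf, vev_add, inner_add_left, mul_add]
    rw [Finset.sum_congr rfl fun F _ => hs F, Finset.sum_add_distrib, hf, divP_add,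
      innerS_add_right (M.isBounded_body i)]
    ring
  map_smul' c p := by
    have hf : (c • p).toField = c • p.toField := rfl
    have hs : ∀ F, ((M.face F).integral fun x =>
        ev2 (σ.2 F) x * ⟪vev (c • p).toField ((M.face F).point x), M.normal i F⟫) =
        c * (M.face F).integral fun x =>
          ev2 (σ.2 F) x * ⟪vev p.toField ((M.face F).point x), M.normal i F⟫ := fun F => by
      unfold Face.integral
      rw [← integral_const_mul]
      simp [hf, vev_smul, real_inner_smul_left, mul_left_comm]
    rw [Finset.sum_congr rfl fun F _ => hs F, ← Finset.mul_sum, hf, divP_smul, innerS_smul_right,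
      RingHom.id_apply, smul_eq_mul]
    ring

/-- The discrete weak gradient `∇_{w,r,T} σ` on an element: the unique element of `[P_r(T)]³` with
`(∇_{w,r,T} σ, ψ)_T = -(σ₀, ∇ · ψ)_T + ⟨σ_b, ψ · n⟩_∂T` for all `ψ` in `[P_r(T)]³`. -/
def weakGrad (i : ι) (r : ℕ) (σ : ScalarWeak ι κ) : PolyVec r :=
  (existsUnique_represent (M.isOpen_body i) (M.nonempty_body i) (M.isBounded_body i)
    (M.weakGradFunctional i r σ)).choose

theorem weakGrad_spec (i : ι) (r : ℕ) (σ : ScalarWeak ι κ) (ψ : PolyVec r) :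
    innerV (M.body i) (M.weakGrad i r σ).toField ψ.toField =
      -innerS (M.body i) (σ.1 i) (divP ψ.toField) +
        ∑ F ∈ M.faces i, (M.face F).integral fun x =>
          ev2 (σ.2 F) x * ⟪vev ψ.toField ((M.face F).point x), M.normal i F⟫ :=
  (existsUnique_represent (M.isOpen_body i) (M.nonempty_body i) (M.isBounded_body i)
    (M.weakGradFunctional i r σ)).choose_spec.1 ψ

/-- The functional
`q ↦ (v₀, (∇×)² q)_T - ⟨v_b × n, ∇ × q⟩_∂T - ⟨v_n × n, q⟩_∂T` on `[P_r(T)]³`. -/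
def weakCurlCurlFunctional (i : ι) (r : ℕ) (v : VectorWeak ι κ) : PolyVec r →ₗ[ℝ] ℝ where
  toFun q := innerV (M.body i) (v.1 i) (curlP (curlP q.toField)) -
    (∑ F ∈ M.faces i, (M.face F).integral fun x =>
      ⟪cross ((M.face F).tanField (v.2.1 F) x) (M.normal i F),
        vev (curlP q.toField) ((M.face F).point x)⟫) -
    ∑ F ∈ M.faces i, (M.face F).integral fun x =>
      ⟪cross ((M.face F).tanField (v.2.2 F) x) (M.normal i F),
        vev q.toField ((M.face F).point x)⟫
  map_add' p q := by
    have hf : (p + q).toField = p.toField + q.toField := rfl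
    have hI : ∀ (w : Fin 2 → Poly2) (f : Fin 3 → Poly3) (F : κ), IntegrableOn (fun x =>
        ⟪cross ((M.face F).tanField w x) (M.normal i F), vev f ((M.face F).point x)⟫)
        (M.face F).region := fun w f F =>
      integrableOn_region _ ((continuous_cross (continuous_tanField _ _) continuous_const).inner
        ((continuous_vev _).comp (continuous_point _)))
    have hs : ∀ (w : Fin 2 → Poly2) (f g : Fin 3 → Poly3) (F : κ),
        ((M.face F).integral fun x => ⟪cross ((M.face F).tanField w x) (M.normal i F),
          vev (f + g) ((M.face F).point x)⟫) =
        ((M.face F).integral fun x => ⟪cross ((M.face F).tanField w x) (M.normal i F),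
          vev f ((M.face F).point x)⟫) +
        (M.face F).integral fun x => ⟪cross ((M.face F).tanField w x) (M.normal i F),
          vev g ((M.face F).point x)⟫ := fun w f g F => by
      unfold Face.integral
      rw [← integral_add (hI w f F) (hI w g F)]
      simp [vev_add, inner_add_right]
    simp only [hf, curlP_add, hs, Finset.sum_add_distrib,
      innerV_add_right (M.isBounded_body i)]
    ring
  map_smul' c p := by
    have hf : (c • p).toField = c • p.toField := rfl
    have hs : ∀ (w : Fin 2 → Poly2) (f : Fin 3 → Poly3) (F : κ),
        ((M.face F).integral fun x => ⟪cross ((M.face F).tanField w x) (M.normal i F),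
          vev (c • f) ((M.face F).point x)⟫) =
        c * (M.face F).integral fun x => ⟪cross ((M.face F).tanField w x) (M.normal i F),
          vev f ((M.face F).point x)⟫ := fun w f F => by
      unfold Face.integral
      rw [← integral_const_mul]
      simp [vev_smul, inner_smul_right]
    simp only [hf, curlP_smul, hs, innerV_smul_right, ← Finset.mul_sum, RingHom.id_apply,
      smul_eq_mul]
    ring

/-- The discrete weak curl-curl `(∇×)²_{w,r,T} v` on an element: the unique element of `[P_r(T)]³`
with `((∇×)²_{w,r,T} v, q)_T = (v₀, (∇×)² q)_T - ⟨v_b × n, ∇ × q⟩_∂T - ⟨v_n × n, q⟩_∂T` for all `q`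
in `[P_r(T)]³`. -/
def weakCurlCurl (i : ι) (r : ℕ) (v : VectorWeak ι κ) : PolyVec r :=
  (existsUnique_represent (M.isOpen_body i) (M.nonempty_body i) (M.isBounded_body i)
    (M.weakCurlCurlFunctional i r v)).choose

theorem weakCurlCurl_spec (i : ι) (r : ℕ) (v : VectorWeak ι κ) (q : PolyVec r) :
    innerV (M.body i) (M.weakCurlCurl i r v).toField q.toField =
      innerV (M.body i) (v.1 i) (curlP (curlP q.toField)) -
        (∑ F ∈ M.faces i, (M.face F).integral fun x =>
          ⟪cross ((M.face F).tanField (v.2.1 F) x) (M.normal i F),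
            vev (curlP q.toField) ((M.face F).point x)⟫) -
        ∑ F ∈ M.faces i, (M.face F).integral fun x =>
          ⟪cross ((M.face F).tanField (v.2.2 F) x) (M.normal i F),
            vev q.toField ((M.face F).point x)⟫ :=
  (existsUnique_represent (M.isOpen_body i) (M.nonempty_body i) (M.isBounded_body i)
    (M.weakCurlCurlFunctional i r v)).choose_spec.1 q

/-! ### Weak finite element spaces -/

/-- The scalar weak finite element space `W_h` of order `k`. -/
def Wh (_M : Mesh Ω ι κ) (k : ℕ) : Set (ScalarWeak ι κ) :=
  {σ | (∀ i, (σ.1 i).totalDegree ≤ k) ∧ ∀ F, (σ.2 F).totalDegree ≤ k}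

/-- The subspace `W_h^0` of `W_h`: `σ_b = 0` on `∂Ω`. -/
def Wh0 (k : ℕ) : Set (ScalarWeak ι κ) :=
  {σ | σ ∈ M.Wh k ∧ ∀ F, (M.face F).carrier ⊆ frontier Ω →
    ∀ x ∈ (M.face F).region, ev2 (σ.2 F) x = 0}

/-- The vector weak finite element space `V_h` of order `k`. -/
def Vh (_M : Mesh Ω ι κ) (k : ℕ) : Set (VectorWeak ι κ) :=
  {v | (∀ i a, (v.1 i a).totalDegree ≤ k) ∧ (∀ F a, (v.2.1 F a).totalDegree ≤ k) ∧
    ∀ F a, (v.2.2 F a).totalDegree ≤ k - 1}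

/-- The subspace `V_h^0` of `V_h`: `v_b × n = 0` and `v_n × n = 0` on `∂Ω`. -/
def Vh0 (k : ℕ) : Set (VectorWeak ι κ) :=
  {v | v ∈ M.Vh k ∧ ∀ F, (M.face F).carrier ⊆ frontier Ω →
    ∀ i, F ∈ M.faces i → ∀ x ∈ (M.face F).region,
      cross ((M.face F).tanField (v.2.1 F) x) (M.normal i F) = 0 ∧
      cross ((M.face F).tanField (v.2.2 F) x) (M.normal i F) = 0}

/-! ### The scheme -/

/-- The meshsize `h_T` of an element. -/
def meshSize (i : ι) : ℝ := Metric.diam (M.body i)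

variable [Fintype ι]

/-- `a(u, v) = ∑_T ((∇×)²_w u, (∇×)²_w v)_T`. -/
def formA (r₁ : ι → ℕ) (u v : VectorWeak ι κ) : ℝ :=
  ∑ i, innerV (M.body i) (M.weakCurlCurl i (r₁ i) u).toField (M.weakCurlCurl i (r₁ i) v).toField

/-- `b(u, q) = ∑_T (u₀, ∇_w q)_T`. -/
def formB (r₂ : ι → ℕ) (u : VectorWeak ι κ) (q : ScalarWeak ι κ) : ℝ :=
  ∑ i, innerV (M.body i) (u.1 i) (M.weakGrad i (r₂ i) q).toField

/-- `c(p, q) = ∑_T h_T⁴ (∇_w p, ∇_w q)_T`. -/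
def formC (r₂ : ι → ℕ) (p q : ScalarWeak ι κ) : ℝ :=
  ∑ i, M.meshSize i ^ 4 *
    innerV (M.body i) (M.weakGrad i (r₂ i) p).toField (M.weakGrad i (r₂ i) q).toField

/-- `(f, v₀) = ∑_T (f, v₀)_T`. -/
def load (f : E3 → E3) (v : VectorWeak ι κ) : ℝ :=
  ∑ i, ∫ x in M.body i, ⟪f x, vev (v.1 i) x⟫

/-- `(u_h; p_h)` solves the stabilizer-free weak Galerkin scheme of order `k` with load `f`, where
`r₁` and `r₂` are the degrees of the weak curl-curl and of the weak gradient on the elements. -/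
def IsWGSolution (k : ℕ) (r₁ r₂ : ι → ℕ) (f : E3 → E3)
    (w : VectorWeak ι κ × ScalarWeak ι κ) : Prop :=
  (w.1 ∈ M.Vh0 k ∧ w.2 ∈ M.Wh0 k) ∧
    (∀ v ∈ M.Vh0 k, M.formA r₁ w.1 v + M.formB r₂ v w.2 = M.load f v) ∧
    ∀ q ∈ M.Wh0 k, M.formC r₂ w.2 q - M.formB r₂ w.1 q = 0

/-! ### Geometry of an element -/

/-- The plane of the face `G` does not cut through the face `F` of the element `i`: all of `F` lies
on one side of that plane. -/
def OneSided (i : ι) (F G : κ) : Prop :=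
  (∀ x ∈ (M.face F).carrier, ⟪x - (M.face G).base, M.normal i G⟫ ≤ 0) ∨
    ∀ x ∈ (M.face F).carrier, 0 ≤ ⟪x - (M.face G).base, M.normal i G⟫

/-- The element `i` has a face that is not cut by the planes of two further faces, the normals of
the three faces being linearly independent. -/
def HasUncutFace (i : ι) : Prop :=
  ∃ F ∈ M.faces i, ∃ G ∈ M.faces i, ∃ G' ∈ M.faces i,
    LinearIndependent ℝ ![M.normal i F, M.normal i G, M.normal i G'] ∧
      M.OneSided i F G ∧ M.OneSided i F G'

end Mesh

/-- The space `H(div⁰; Ω)`: square-integrable fields on `Ω` with vanishing weak divergence. -/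
def HDivZero (Ω : Set E3) : Set (E3 → E3) :=
  {f | MemLp f 2 (volume.restrict Ω) ∧
    ∀ φ : E3 → ℝ, ContDiff ℝ ∞ φ → HasCompactSupport φ → tsupport φ ⊆ Ω →
      ∫ x in Ω, ⟪f x, gradient φ x⟫ = 0}

end

end QuadCurlWG

/-! The scheme is a square linear system on a finite-dimensional space, so it suffices that the
homogeneous system has only the zero solution. Testing with `u` and `p` and adding cancels the
`b`-terms and leaves `a(u,u) + c(p,p) = 0`. Hence the weak curl-curl of `u` and the weak gradient of
`p` vanish on every element.

Local step. Integration by parts rewrites both weak operators as the classical operator plus face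
terms carrying jumps: `σ_b - σ₀` for the gradient, `α = (v₀ - v_b) × n` paired with `∇ × q` and `β =
(∇ × v₀ - v_n) × n` paired with `q` for the curl-curl. Test fields carry products of squares `λ_F²`
of the linear polynomials of the faces. Squares are non-negative even if the element is not convex,
and they have a double zero on the face, so they remove the traces of `q` and of `∇ × q` at once.
The full bubble gives `∇σ₀ = 0` and `(∇×)² v₀ = 0`. Omitting the factor of one face isolates its
jumps. To isolate `α` one factor `λ_F` is put back, and the degree becomes `1 + 2(N-1) + k = 2N + k
- 1`, one too many in the borderline case. There a face `F` not cut by the plane of `G` allows `λ_F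
λ_G` in place of a square for `G`, since `λ_G` has one sign on `F`; this gives one component of `α`,
two such planes give all of it, and the settled face drops out of the bubbles for the others
(`Annihilates.eq_zero`).

Global step. The recurring tool is `divP_eq_zero_of_normal_continuous`: non-negative divergences of
a piecewise polynomial field with matching normal components and zero normal component on the
boundary must vanish. Applied to `c² x` for the piecewise constant `p = c` it gives `p = 0`. Applied
to `v₀ × (∇ × v₀)`, whose divergence is `|∇ × v₀|²`, it gives `∇ × v₀ = 0`. With `p = 0` the second
equation becomes `b(u, q) = 0`, which makes `v₀` divergence-free with continuous normal component.
Now the traces of `v₀` agree across interior faces, and a curl-free, divergence-free polynomial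
field vanishing on a plane is zero, so neighbouring elements carry the same polynomial `∇φ`. Its
potential is constant on each boundary plane of such a class of elements. Not all these planes are
parallel, so they meet in pairs and the constants agree, to `c` say, and the field `(φ - c)∇φ` gives
`∇φ = 0`. Working with whole planes avoids any assumption on the topology of the domain.

The divergence theorem for non-convex elements is proved by ray crossings: almost everywhere the
indicator of an element is a signed sum of indicators of the prisms swept out by its faces in a
fixed direction (`ae_crossing_eq_zero`). -/

namespace QuadCurlWG

noncomputable section

/-! ### Coordinates adapted to a face -/

namespace Face

variable (F : Face)

/-- A unit normal vector of the plane of a face. -/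
structure IsUnitNormal (n : E3) : Prop where
  norm_eq : ‖n‖ = 1
  inner_tangent : ∀ a, ⟪n, F.tangent a⟫ = 0

theorem point_sub_base (y : E2) : F.point y - F.base = y 0 • F.tangent 0 + y 1 • F.tangent 1 := by
  rw [Face.point]; abel

theorem inner_tangent_tangent (a b : Fin 2) :
    ⟪F.tangent a, F.tangent b⟫ = if a = b then 1 else 0 :=
  orthonormal_iff_ite.1 F.orthonormal a b

theorem inner_point_sub_base_tangent (y : E2) (a : Fin 2) :
    ⟪F.point y - F.base, F.tangent a⟫ = y a := by
  rw [point_sub_base, inner_add_left, real_inner_smul_left, real_inner_smul_left,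
    inner_tangent_tangent, inner_tangent_tangent]
  fin_cases a <;> simp

variable {F} {n : E3} (hn : F.IsUnitNormal n)

include hn

theorem IsUnitNormal.inner_self : ⟪n, n⟫ = 1 := by
  rw [real_inner_self_eq_norm_sq, hn.norm_eq, one_pow]

theorem IsUnitNormal.ne_zero : n ≠ 0 := by
  rintro rfl
  simpa using hn.norm_eq

theorem IsUnitNormal.inner_tangent' (a : Fin 2) : ⟪F.tangent a, n⟫ = 0 := by
  rw [real_inner_comm, hn.inner_tangent]

theorem IsUnitNormal.orthonormal_frame :
    Orthonormal ℝ ![n, F.tangent 0, F.tangent 1] := by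
  rw [orthonormal_iff_ite]
  intro a b
  fin_cases a <;> fin_cases b <;>
    simp [hn.norm_eq, hn.inner_tangent, hn.inner_tangent', inner_tangent_tangent,
      F.orthonormal.1]

/-- The orthonormal basis formed by the normal and the tangent vectors of a face. -/
def IsUnitNormal.frame : OrthonormalBasis (Fin 3) ℝ E3 :=
  OrthonormalBasis.mk hn.orthonormal_frame
    (hn.orthonormal_frame.linearIndependent.span_eq_top_of_card_eq_finrank' (by simp)).ge

theorem IsUnitNormal.frame_apply (a : Fin 3) :
    hn.frame a = ![n, F.tangent 0, F.tangent 1] a := by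
  simp [IsUnitNormal.frame]

theorem IsUnitNormal.expand (x : E3) :
    x = ⟪x, n⟫ • n + ⟪x, F.tangent 0⟫ • F.tangent 0 + ⟪x, F.tangent 1⟫ • F.tangent 1 := by
  have := hn.frame.sum_repr x
  simp only [Fin.sum_univ_three, OrthonormalBasis.repr_apply_apply, hn.frame_apply] at this
  simp only [Matrix.cons_val_zero, Matrix.cons_val_one, Matrix.cons_val] at this
  simp only [real_inner_comm x] at this
  simpa [real_inner_comm] using this.symm

theorem IsUnitNormal.inner_point_sub_base (y : E2) : ⟪F.point y - F.base, n⟫ = 0 := by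
  rw [point_sub_base, inner_add_left, real_inner_smul_left, real_inner_smul_left,
    hn.inner_tangent', hn.inner_tangent']
  simp

theorem IsUnitNormal.exists_point_eq {x : E3} (hx : ⟪x - F.base, n⟫ = 0) :
    F.point !₂[⟪x - F.base, F.tangent 0⟫, ⟪x - F.base, F.tangent 1⟫] = x := by
  have := hn.expand (x - F.base)
  rw [hx, zero_smul, zero_add] at this
  rw [Face.point, add_assoc]
  simp only [Matrix.cons_val_zero, Matrix.cons_val_one]
  rw [← this]; abel

theorem IsUnitNormal.mem_plane_iff {x : E3} : x ∈ F.plane ↔ ⟪x - F.base, n⟫ = 0 := by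
  constructor
  · rintro ⟨y, rfl⟩
    exact hn.inner_point_sub_base y
  · intro hx
    exact ⟨_, hn.exists_point_eq hx⟩

/-- Coordinates of space relative to a face: the signed distance from the plane of the face and the
coordinates in that plane. -/
def IsUnitNormal.coordEquiv : ℝ × E2 ≃ᵐ E3 :=
  ((MeasurableEquiv.refl ℝ).prodCongr (MeasurableEquiv.toLp 2 (Fin 2 → ℝ)).symm).trans
    ((MeasurableEquiv.piFinSuccAbove (fun _ : Fin 3 => ℝ) 0).symm.trans
      ((MeasurableEquiv.toLp 2 (Fin 3 → ℝ)).trans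
        (hn.frame.repr.symm.toHomeomorph.toMeasurableEquiv.trans
          (Homeomorph.addLeft F.base).toMeasurableEquiv)))

theorem IsUnitNormal.coordEquiv_apply (z : ℝ × E2) :
    hn.coordEquiv z = F.point z.2 + z.1 • n := by
  have h : hn.coordEquiv z = F.base + hn.frame.repr.symm
      (WithLp.toLp 2 (Fin.insertNth 0 z.1 z.2.ofLp)) := rfl
  rw [h, ← hn.frame.sum_repr_symm]
  simp only [Fin.sum_univ_three, hn.frame_apply, Face.point]
  simp
  have h2 : (Fin.cons z.1 z.2.ofLp : Fin 3 → ℝ) 2 = z.2 1 := rfl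
  rw [h2]
  abel

theorem IsUnitNormal.measurePreserving_coordEquiv : MeasurePreserving hn.coordEquiv := by
  have h1 : MeasurePreserving ((MeasurableEquiv.refl ℝ).prodCongr
      (MeasurableEquiv.toLp 2 (Fin 2 → ℝ)).symm) :=
    (MeasurePreserving.id volume).prod (PiLp.volume_preserving_ofLp (Fin 2))
  have h2 := (volume_preserving_piFinSuccAbove (fun _ : Fin 3 => ℝ) 0).symm
  have h3 : MeasurePreserving (MeasurableEquiv.toLp 2 (Fin 3 → ℝ)) :=
    PiLp.volume_preserving_toLp (Fin 3)
  have h4 : MeasurePreserving hn.frame.repr.symm.toHomeomorph.toMeasurableEquiv :=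
    hn.frame.measurePreserving_repr_symm
  have h5 : MeasurePreserving (Homeomorph.addLeft F.base).toMeasurableEquiv :=
    measurePreserving_add_left volume F.base
  exact h5.comp (h4.comp (h3.comp (h2.comp h1)))

/-! ### Oblique prisms over a face and integration along their rays -/

omit hn in
/-- The unbounded prism that is swept out by a face in the direction `d`. -/
def prism (F : Face) (d : E3) : Set E3 := {x | ∃ s > (0 : ℝ), x - s • d ∈ F.carrier}

/-- The affine map that fixes the plane of the face and maps its normal to `d`. -/
def IsUnitNormal.shear (_ : F.IsUnitNormal n) (d x : E3) : E3 := x + ⟪x - F.base, n⟫ • (d - n)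

theorem IsUnitNormal.shear_point (d : E3) (y : E2) (s : ℝ) :
    hn.shear d (F.point y + s • n) = F.point y + s • d := by
  have : ⟪F.point y + s • n - F.base, n⟫ = s := by
    rw [add_sub_right_comm, inner_add_left, hn.inner_point_sub_base, real_inner_smul_left,
      hn.inner_self, zero_add, mul_one]
  rw [shear, this, smul_sub]
  abel

theorem IsUnitNormal.prism_eq (d : E3) :
    F.prism d = hn.shear d '' (hn.coordEquiv '' (Ioi 0 ×ˢ F.region)) := by
  ext x
  simp only [prism, carrier, mem_ofPred_eq, mem_image, mem_prod, mem_Ioi, Prod.exists,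
    hn.coordEquiv_apply]
  constructor
  · rintro ⟨s, hs, y, hy, hxy⟩
    refine ⟨_, ⟨s, y, ⟨hs, hy⟩, rfl⟩, ?_⟩
    rw [hn.shear_point, hxy]
    abel
  · rintro ⟨_, ⟨s, y, ⟨hs, hy⟩, rfl⟩, rfl⟩
    refine ⟨s, hs, y, hy, ?_⟩
    rw [hn.shear_point]
    abel

theorem IsUnitNormal.inner_shear (d x : E3) :
    ⟪hn.shear d x - F.base, n⟫ = ⟪x - F.base, n⟫ * ⟪d, n⟫ := by
  have := hn.inner_self
  rw [shear, add_sub_right_comm, inner_add_left, real_inner_smul_left, inner_sub_left d, this]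
  ring

theorem IsUnitNormal.shear_injective {d : E3} (hd : ⟪d, n⟫ ≠ 0) :
    Function.Injective (hn.shear d) := by
  intro x y hxy
  have h := hn.inner_shear d x
  rw [hxy, hn.inner_shear] at h
  have h' := mul_right_cancel₀ hd h
  rw [shear, shear, h'] at hxy
  exact add_right_cancel hxy

theorem IsUnitNormal.hasFDerivAt_shear (d x : E3) :
    HasFDerivAt (hn.shear d)
      (ContinuousLinearMap.id ℝ E3 + (innerSL ℝ n).smulRight (d - n)) x := by
  have h : hn.shear d = fun x => x + (innerSL ℝ n (x - F.base)) • (d - n) := by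
    funext x
    rw [shear, innerSL_apply_apply, real_inner_comm]
  rw [h]
  exact (hasFDerivAt_id x).add
    ((((innerSL ℝ n).hasFDerivAt (x := x - F.base)).comp x
      ((hasFDerivAt_id x).sub_const F.base)).smul_const (d - n))

/-- The derivative of the shear is a transvection, identity plus rank one, so its determinant is `1
+ ⟪n, d - n⟫`. -/
theorem IsUnitNormal.det_shear (d : E3) :
    (ContinuousLinearMap.id ℝ E3 + (innerSL ℝ n).smulRight (d - n)).det = ⟪d, n⟫ := by
  have h : ((ContinuousLinearMap.id ℝ E3 + (innerSL ℝ n).smulRight (d - n) : E3 →L[ℝ] E3) :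
      E3 →ₗ[ℝ] E3) = LinearMap.transvection (innerSL ℝ n : E3 →ₗ[ℝ] ℝ) (d - n) := by
    ext x : 1
    simp [LinearMap.transvection.apply]
  rw [ContinuousLinearMap.det, h, LinearMap.transvection.det]
  simp [inner_sub_right, hn.norm_eq, real_inner_comm]

theorem IsUnitNormal.measurableSet_prism {d : E3} (hd : ⟪d, n⟫ ≠ 0) :
    MeasurableSet (F.prism d) := by
  rw [hn.prism_eq]
  refine MeasurableSet.image_of_continuousOn_injOn ?_
    (fun x _ => (hn.hasFDerivAt_shear d x).continuousAt.continuousWithinAt)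
    (hn.shear_injective hd).injOn
  exact (hn.coordEquiv.measurableEmbedding.measurableSet_image).2
    (measurableSet_Ioi.prod F.isCompact_region.measurableSet)

/-- The adapted coordinates preserve volume, the shear turns normal rays into rays along `d` at the
price of the Jacobian `|⟪d, n⟫|`, and Fubini separates the foot point from the position on the ray.
-/
theorem IsUnitNormal.setIntegral_prism {d : E3} (hd : ⟪d, n⟫ ≠ 0) {f : E3 → ℝ}
    (hf : Integrable f) :
    ∫ x in F.prism d, f x =
      |⟪d, n⟫| * F.integral fun y => ∫ s in Ioi (0 : ℝ), f (F.point y + s • d) := by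
  have hS : MeasurableSet (Ioi (0 : ℝ) ×ˢ F.region) :=
    measurableSet_Ioi.prod F.isCompact_region.measurableSet
  have hS' : MeasurableSet (hn.coordEquiv '' (Ioi (0 : ℝ) ×ˢ F.region)) :=
    (hn.coordEquiv.measurableEmbedding.measurableSet_image).2 hS
  have hder := fun x (_ : x ∈ hn.coordEquiv '' (Ioi (0 : ℝ) ×ˢ F.region)) =>
    (hn.hasFDerivAt_shear d x).hasFDerivWithinAt
      (s := hn.coordEquiv '' (Ioi (0 : ℝ) ×ˢ F.region))
  have hint := (integrableOn_image_iff_integrableOn_abs_det_fderiv_smul volume hS' hder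
    (hn.shear_injective hd).injOn f).1 hf.integrableOn
  simp only [hn.det_shear, smul_eq_mul] at hint
  rw [hn.prism_eq, integral_image_eq_integral_abs_det_fderiv_smul volume hS' hder
    (hn.shear_injective hd).injOn]
  simp only [hn.det_shear, smul_eq_mul]
  rw [integral_const_mul, ← hn.measurePreserving_coordEquiv.map_eq,
    hn.coordEquiv.measurableEmbedding.setIntegral_map,
    preimage_image_eq _ hn.coordEquiv.injective]
  simp only [hn.coordEquiv_apply, hn.shear_point]
  rw [← hn.measurePreserving_coordEquiv.integrableOn_comp_preimage
    hn.coordEquiv.measurableEmbedding, preimage_image_eq _ hn.coordEquiv.injective] at hint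
  have hint' : IntegrableOn (fun z : ℝ × E2 => f (F.point z.2 + z.1 • d))
      (Ioi (0 : ℝ) ×ˢ F.region) := by
    have := hint.const_mul (|⟪d, n⟫|⁻¹)
    refine this.congr (Eventually.of_forall fun z => ?_)
    simp only [Function.comp, hn.coordEquiv_apply, hn.shear_point]
    rw [inv_mul_cancel_left₀ (abs_ne_zero.2 hd)]
  congr 1
  rw [Face.integral, Measure.volume_eq_prod, ← setIntegral_prod_swap, setIntegral_prod]
  · rfl
  · exact hint'.swap

end Face

/-! ### Ray crossings -/

/-- The exceptional set is a plane or, for `v = 0`, empty. Every degenerate position of a ray with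
respect to the faces is caught by finitely many sets of this form. -/
theorem ae_inner_add_ne_zero (v : E3) (c : ℝ) (h : v ≠ 0 ∨ c ≠ 0) :
    ∀ᵐ x : E3, ⟪x, v⟫ + c ≠ 0 := by
  by_cases hv : v = 0
  · subst hv
    simpa using h
  have hvv : ⟪v, v⟫ ≠ 0 := inner_self_ne_zero.2 hv
  have hne : (ℝ ∙ v)ᗮ ≠ ⊤ := by
    intro htop
    have : v ∈ (ℝ ∙ v)ᗮ := htop ▸ Submodule.mem_top
    exact hvv (Submodule.mem_orthogonal_singleton_iff_inner_left.1 this)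
  have h0 := Measure.addHaar_submodule (volume : Measure E3) _ hne
  have h1 := measure_preimage_add_right (volume : Measure E3) ((c / ⟪v, v⟫) • v)
    ((ℝ ∙ v)ᗮ : Set E3)
  rw [h0] at h1
  rw [ae_iff]
  refine measure_mono_null (fun x hx => ?_) h1
  have hx' : ⟪x, v⟫ + c = 0 := by simpa using hx
  change _ ∈ (ℝ ∙ v)ᗮ
  rw [Submodule.mem_orthogonal_singleton_iff_inner_left, inner_add_left, real_inner_smul_left,
    div_mul_cancel₀ _ hvv, hx']

/-- A function on the line that is constant near every point, apart from that point, is constant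
up to isolated exceptional values. -/
theorem exists_forall_eventually_nhdsNE_eq {h : ℝ → ℝ}
    (hh : ∀ t, ∃ c, ∀ᶠ s in 𝓝[≠] t, h s = c) : ∃ c, ∀ t, ∀ᶠ s in 𝓝[≠] t, h s = c := by
  choose c hc using hh
  -- For `s` close to `t` and different from it, `h` equals `c t` in a whole neighbourhood of `s`,
  -- and equals `c s` in a punctured one; the two overlap.
  have hloc : IsLocallyConstant c := by
    rw [IsLocallyConstant.iff_eventually_eq]
    intro t
    have h1 : ∀ᶠ s in 𝓝[≠] t, c s = c t := by
      have h2 := eventually_eventually_nhdsWithin.2 (hc t)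
      filter_upwards [h2, self_mem_nhdsWithin] with s hs hst
      have h3 : ∀ᶠ r in 𝓝[≠] s, h r = c t := by
        have : 𝓝[≠] s ≤ 𝓝[≠] t ⊔ 𝓝 s := le_sup_of_le_right nhdsWithin_le_nhds
        have h4 : 𝓝[{t}ᶜ] s = 𝓝 s := isOpen_compl_singleton.nhdsWithin_eq hst
        rw [h4] at hs
        exact hs.filter_mono nhdsWithin_le_nhds
      obtain ⟨r, hr1, hr2⟩ := (h3.and (hc s)).exists
      exact hr2.symm.trans hr1
    rw [eventually_nhdsWithin_iff] at h1
    filter_upwards [h1] with s hs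
    by_cases hst : s = t
    · rw [hst]
    · exact hs hst
  refine ⟨c 0, fun t => ?_⟩
  rw [← hloc.apply_eq_of_preconnectedSpace t 0]
  exact hc t

namespace Mesh

variable {Ω : Set E3} {ι κ : Type*} (M : Mesh Ω ι κ) {i : ι} {F G : κ}

theorem isUnitNormal (hF : F ∈ M.faces i) : (M.face F).IsUnitNormal (M.normal i F) :=
  ⟨M.norm_normal i F hF, M.normal_orthogonal i F hF⟩

theorem isCompact_carrier (F : Face) : IsCompact F.carrier :=
  F.isCompact_region.image (continuous_point F)

theorem carrier_subset_frontier (hF : F ∈ M.faces i) :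
    (M.face F).carrier ⊆ frontier (M.body i) := by
  rw [M.frontier_body i]
  exact subset_biUnion_of_mem (u := fun F => (M.face F).carrier) hF

theorem isClosed_other_carriers (i : ι) (F : κ) :
    IsClosed (⋃ G ∈ {G | G ∈ M.faces i ∧ G ≠ F}, (M.face G).carrier) := by
  refine Set.Finite.isClosed_biUnion ?_ fun G _ => (isCompact_carrier _).isClosed
  exact (M.faces i).finite_toSet.subset fun G hG => hG.1

/-- Near a relative interior point of a face that lies on no other face, the element is on the
inner side of the face. -/
theorem eventually_side (hF : F ∈ M.faces i) {x : E3} (hx : x ∈ (M.face F).relInterior)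
    (hG : ∀ G ∈ M.faces i, G ≠ F → x ∉ (M.face G).carrier) :
    ∀ᶠ z in 𝓝 x, (⟪z - x, M.normal i F⟫ < 0 → z ∈ M.body i) ∧
      (0 < ⟪z - x, M.normal i F⟫ → z ∉ M.body i) := by
  have hn := M.isUnitNormal hF
  have hxp : ⟪x - (M.face F).base, M.normal i F⟫ = 0 := by
    obtain ⟨y, _, rfl⟩ := hx
    exact hn.inner_point_sub_base y
  have hopen : ∀ᶠ z in 𝓝 x, z ∉ ⋃ G ∈ {G | G ∈ M.faces i ∧ G ≠ F}, (M.face G).carrier := by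
    refine (M.isClosed_other_carriers i F).isOpen_compl.eventually_mem ?_
    simpa using fun G h1 h2 => hG G h1 h2
  obtain ⟨ε, hε, hball⟩ := Metric.eventually_nhds_iff_ball.1 hopen
  have hfr : ∀ z ∈ Metric.ball x ε, z ∈ frontier (M.body i) → ⟪z - x, M.normal i F⟫ = 0 := by
    intro z hz hzf
    rw [M.frontier_body i, mem_iUnion₂] at hzf
    obtain ⟨G, hGi, hzG⟩ := hzf
    have hGF : G = F := by
      by_contra hne
      exact hball z hz (mem_iUnion₂.2 ⟨G, ⟨hGi, hne⟩, hzG⟩)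
    subst hGF
    obtain ⟨y, _, rfl⟩ := hzG
    have := hn.inner_point_sub_base y
    rw [← sub_add_sub_cancel _ x, inner_add_left, hxp, add_zero] at this
    exact this
  have hout := M.normal_outward i F hF x hx hG
  have hsmall : ∀ᶠ s : ℝ in 𝓝[>] 0, s < ε ∧ 0 < s :=
    (eventually_nhdsWithin_of_eventually_nhds (eventually_lt_nhds hε)).and
      eventually_mem_nhdsWithin
  -- The outward condition only speaks of the normal line. It provides one point of the element
  -- below the plane and one outside above it. Each open half-ball is connected and misses the
  -- frontier, so one point decides the whole half.
  obtain ⟨s, ⟨hs1, hs2⟩, hsε, hs0⟩ := (hout.and hsmall).exists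
  have hnn := hn.inner_self
  have hmem : ∀ r : ℝ, |r| < ε → x + r • M.normal i F ∈ Metric.ball x ε := by
    intro r hr
    rw [Metric.mem_ball, dist_eq_norm, add_sub_cancel_left, norm_smul, hn.norm_eq, mul_one]
    exact hr
  have hconv : ∀ z, ⟪z - x, M.normal i F⟫ = ⟪z, M.normal i F⟫ - ⟪x, M.normal i F⟫ :=
    fun z => inner_sub_left _ _ _
  have hlin : IsLinearMap ℝ fun z : E3 => ⟪z, M.normal i F⟫ :=
    ⟨fun a b => inner_add_left _ _ _, fun c a => real_inner_smul_left _ _ _⟩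
  have hlow : Metric.ball x ε ∩ {z | ⟪z - x, M.normal i F⟫ < 0} ⊆ M.body i := by
    refine IsPreconnected.subset_of_closure_inter_subset ?_ (M.isOpen_body i) ?_ ?_
    · refine ((convex_ball x ε).inter ?_).isPreconnected
      simp only [hconv, sub_neg]
      exact convex_halfSpace_lt hlin _
    · refine ⟨x - s • M.normal i F, ⟨?_, ?_⟩, hs1⟩
      · have := hmem (-s) (by rwa [abs_neg, abs_of_pos hs0])
        rwa [neg_smul, ← sub_eq_add_neg] at this
      · simp only [mem_ofPred_eq]
        rw [sub_sub_cancel_left, inner_neg_left, real_inner_smul_left, hnn]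
        linarith
    · rintro z ⟨hzc, hzb, hz⟩
      by_contra hzT
      have := hfr z hzb (by rw [(M.isOpen_body i).frontier_eq]; exact ⟨hzc, hzT⟩)
      exact absurd this (ne_of_lt hz)
  have hup : Metric.ball x ε ∩ {z | 0 < ⟪z - x, M.normal i F⟫} ⊆ (closure (M.body i))ᶜ := by
    have hsub := IsPreconnected.subset_left_of_subset_union
      (s := Metric.ball x ε ∩ {z | 0 < ⟪z - x, M.normal i F⟫})
      isClosed_closure.isOpen_compl (M.isOpen_body i)
      (disjoint_compl_left.mono_right subset_closure) ?_ ?_ ?_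
    · exact hsub
    · rintro z ⟨hzb, hz⟩
      by_cases hzT : z ∈ M.body i
      · exact Or.inr hzT
      · refine Or.inl fun hzc => ?_
        have := hfr z hzb (by rw [(M.isOpen_body i).frontier_eq]; exact ⟨hzc, hzT⟩)
        exact absurd this (ne_of_gt hz)
    · refine ⟨x + s • M.normal i F, ⟨hmem s (by rwa [abs_of_pos hs0]), ?_⟩, ?_⟩
      · simp only [mem_ofPred_eq]
        rw [add_sub_cancel_left, real_inner_smul_left, hnn]
        linarith
      · intro hzc
        have := hfr _ (hmem s (by rwa [abs_of_pos hs0]))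
          (by rw [(M.isOpen_body i).frontier_eq]; exact ⟨hzc, hs2⟩)
        rw [add_sub_cancel_left, real_inner_smul_left, hnn] at this
        linarith
    · refine ((convex_ball x ε).inter ?_).isPreconnected
      simp only [hconv, sub_pos]
      exact convex_halfSpace_gt hlin _
  filter_upwards [Metric.ball_mem_nhds x hε] with z hz
  exact ⟨fun h => hlow ⟨hz, h⟩, fun h hb => hup ⟨hz, h⟩ (subset_closure hb)⟩

/-- The indicator of an element plus the signed number of its faces behind a point, as seen in the
direction `-d`. -/
def crossing (i : ι) (d x : E3) : ℝ :=
  (M.body i).indicator 1 x +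
    ∑ F ∈ M.faces i, Real.sign ⟪d, M.normal i F⟫ * ((M.face F).prism d).indicator 1 x

theorem add_smul_mem_prism {F : Face} {d x : E3} {t : ℝ} :
    x + t • d ∈ F.prism d ↔ ∃ r < t, x + r • d ∈ F.carrier := by
  constructor
  · rintro ⟨s, hs, h⟩
    refine ⟨t - s, by linarith, ?_⟩
    rwa [sub_smul, ← add_sub_assoc]
  · rintro ⟨r, hr, h⟩
    refine ⟨t - r, by simpa using hr, ?_⟩
    rwa [sub_smul, add_sub_assoc, sub_sub_cancel]

/-- The line through `x` in the direction `d` meets the faces of an element transversally, in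
relative interior points that lie on one face only. -/
def Transversal (i : ι) (d x : E3) : Prop :=
  ∀ F ∈ M.faces i, ∀ t : ℝ, x + t • d ∈ (M.face F).carrier →
    x + t • d ∈ (M.face F).relInterior ∧ ⟪d, M.normal i F⟫ ≠ 0 ∧
      ∀ G ∈ M.faces i, G ≠ F → x + t • d ∉ (M.face G).carrier

variable {M} {d x : E3}

theorem Transversal.eq_of_mem (h : M.Transversal i d x) (hF : F ∈ M.faces i) {s t : ℝ}
    (hs : x + s • d ∈ (M.face F).carrier) (ht : x + t • d ∈ (M.face F).carrier) : s = t := by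
  have hd := (h F hF s hs).2.1
  have hn := M.isUnitNormal hF
  obtain ⟨y, _, hy⟩ := hs
  obtain ⟨z, _, hz⟩ := ht
  have h1 := hn.inner_point_sub_base y
  have h2 := hn.inner_point_sub_base z
  rw [hy] at h1
  rw [hz] at h2
  simp only [inner_sub_left, inner_add_left, real_inner_smul_left] at h1 h2
  have h3 : (s - t) * ⟪d, M.normal i F⟫ = 0 := by linarith
  rcases mul_eq_zero.1 h3 with h4 | h4
  · linarith
  · exact absurd h4 hd

/-- A transversal line meets a face at most once, say at `r`. Along the line the prism is then the
half-line `t > r`, so its indicator can change only at `r`. -/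
theorem Transversal.eventually_prism_eq (h : M.Transversal i d x) (hF : F ∈ M.faces i) {t : ℝ}
    (ht : x + t • d ∉ (M.face F).carrier) :
    ∀ᶠ s in 𝓝 t, ((M.face F).prism d).indicator (1 : E3 → ℝ) (x + s • d) =
      ((M.face F).prism d).indicator 1 (x + t • d) := by
  classical
  by_cases hr : ∃ r : ℝ, x + r • d ∈ (M.face F).carrier
  · obtain ⟨r, hr⟩ := hr
    have key : ∀ s : ℝ, x + s • d ∈ (M.face F).prism d ↔ r < s := by
      intro s
      rw [add_smul_mem_prism]
      constructor
      · rintro ⟨r', hr's, hr'⟩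
        rwa [h.eq_of_mem hF hr hr']
      · intro hrs
        exact ⟨r, hrs, hr⟩
    have hrt : r ≠ t := by
      rintro rfl
      exact ht hr
    simp only [indicator_apply, key]
    rcases lt_or_gt_of_ne hrt with h1 | h1
    · filter_upwards [eventually_gt_nhds h1] with s hs
      simp [hs, h1]
    · filter_upwards [eventually_lt_nhds h1] with s hs
      simp [hs.not_gt, h1.not_gt]
  · refine Eventually.of_forall fun s => ?_
    have key : ∀ s : ℝ, x + s • d ∉ (M.face F).prism d := by
      intro s hs
      obtain ⟨r, _, hr'⟩ := add_smul_mem_prism.1 hs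
      exact hr ⟨r, hr'⟩
    simp [key]

theorem tendsto_line (x d : E3) (t : ℝ) : Tendsto (fun s : ℝ => x + s • d) (𝓝 t) (𝓝 (x + t • d)) :=
  (show Continuous fun s : ℝ => x + s • d by fun_prop).tendsto t

theorem eventually_indicator_body_eq {z : E3} (hz : z ∉ frontier (M.body i)) :
    ∀ᶠ w in 𝓝 z, (M.body i).indicator (1 : E3 → ℝ) w = (M.body i).indicator 1 z := by
  by_cases hzT : z ∈ M.body i
  · filter_upwards [(M.isOpen_body i).mem_nhds hzT] with w hw
    simp [hw, hzT]
  · have : z ∈ (closure (M.body i))ᶜ := fun hzc => hz (by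
      rw [(M.isOpen_body i).frontier_eq]; exact ⟨hzc, hzT⟩)
    filter_upwards [isClosed_closure.isOpen_compl.mem_nhds this] with w hw
    have hw' : w ∉ M.body i := fun h => hw (subset_closure h)
    simp [hw', hzT]

theorem Transversal.eventually_crossing_eq (h : M.Transversal i d x) {t : ℝ}
    (ht : x + t • d ∉ frontier (M.body i)) :
    ∀ᶠ s in 𝓝 t, M.crossing i d (x + s • d) = M.crossing i d (x + t • d) := by
  have h1 := (tendsto_line x d t).eventually (eventually_indicator_body_eq ht)
  have h2 : ∀ᶠ s in 𝓝 t, ∀ F ∈ M.faces i,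
      ((M.face F).prism d).indicator (1 : E3 → ℝ) (x + s • d) =
        ((M.face F).prism d).indicator 1 (x + t • d) := by
    rw [Finset.eventually_all]
    intro F hF
    exact h.eventually_prism_eq hF fun hc => ht (M.carrier_subset_frontier hF hc)
  filter_upwards [h1, h2] with s hs1 hs2
  rw [crossing, crossing, hs1]
  congr 1
  exact Finset.sum_congr rfl fun F hF => by rw [hs2 F hF]

/-- Where the line passes through a face, the indicator of the element falls by the sign of `⟪d,
n⟫`, while the term of that face rises by the same amount. At the hit itself the value may differ,
so the statement is about a punctured neighbourhood. -/
theorem Transversal.exists_eventually_crossing_eq (h : M.Transversal i d x) (t : ℝ) :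
    ∃ c, ∀ᶠ s in 𝓝[≠] t, M.crossing i d (x + s • d) = c := by
  classical
  by_cases ht : x + t • d ∈ frontier (M.body i)
  · have ht' := ht
    rw [M.frontier_body i, mem_iUnion₂] at ht'
    obtain ⟨F, hF, htF⟩ := ht'
    obtain ⟨hrel, hdn, hother⟩ := h F hF t htF
    have h1 := (tendsto_line x d t).eventually (M.eventually_side hF hrel hother)
    have h2 : ∀ᶠ s in 𝓝 t, ∀ G ∈ (M.faces i).erase F,
        ((M.face G).prism d).indicator (1 : E3 → ℝ) (x + s • d) =
          ((M.face G).prism d).indicator 1 (x + t • d) := by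
      rw [Finset.eventually_all]
      intro G hG
      have hG' := Finset.mem_erase.1 hG
      exact h.eventually_prism_eq hG'.2 (hother G hG'.2 hG'.1)
    have key : ∀ s : ℝ, x + s • d ∈ (M.face F).prism d ↔ t < s := by
      intro s
      rw [add_smul_mem_prism]
      constructor
      · rintro ⟨r', hr's, hr'⟩
        rwa [h.eq_of_mem hF htF hr']
      · intro hrs
        exact ⟨t, hrs, htF⟩
    refine ⟨(if 0 < ⟪d, M.normal i F⟫ then 1 else 0) + ∑ G ∈ (M.faces i).erase F,
      Real.sign ⟪d, M.normal i G⟫ * ((M.face G).prism d).indicator 1 (x + t • d), ?_⟩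
    filter_upwards [nhdsWithin_le_nhds h1, nhdsWithin_le_nhds h2, self_mem_nhdsWithin]
      with s hs1 hs2 hst
    rw [crossing, ← Finset.add_sum_erase _ _ hF, ← add_assoc]
    congr 1
    · have hin : ⟪x + s • d - (x + t • d), M.normal i F⟫ = (s - t) * ⟪d, M.normal i F⟫ := by
        rw [add_sub_add_left_eq_sub, ← sub_smul, real_inner_smul_left]
      rw [hin] at hs1
      simp only [indicator_apply, key, Pi.one_apply]
      rcases lt_or_gt_of_ne hdn with hd | hd
      · rw [Real.sign_of_neg hd, if_neg hd.not_gt]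
        rcases lt_or_gt_of_ne (show s ≠ t from hst) with hs | hs
        · have := hs1.2 (mul_pos_of_neg_of_neg (by linarith) hd)
          simp [this, hs.not_gt]
        · have := hs1.1 (mul_neg_of_pos_of_neg (by linarith) hd)
          simp [this, hs]
      · rw [Real.sign_of_pos hd, if_pos hd]
        rcases lt_or_gt_of_ne (show s ≠ t from hst) with hs | hs
        · have := hs1.1 (mul_neg_of_neg_of_pos (by linarith) hd)
          simp [this, hs.not_gt]
        · have := hs1.2 (mul_pos (by linarith) hd)
          simp [this, hs]
    · exact Finset.sum_congr rfl fun G hG => by rw [hs2 G hG]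
  · exact ⟨_, nhdsWithin_le_nhds (h.eventually_crossing_eq ht)⟩

theorem eventually_atBot_notMem {S : Set E3} (hS : Bornology.IsBounded S) (hd : d ≠ 0) (x : E3) :
    ∃ t₀ : ℝ, ∀ t < t₀, x + t • d ∉ S := by
  obtain ⟨R, hR⟩ := hS.exists_norm_le
  have hd' : 0 < ‖d‖ := norm_pos_iff.2 hd
  refine ⟨-((‖x‖ + |R|) / ‖d‖), fun t ht hmem => ?_⟩
  have h1 := hR _ hmem
  have h2 : ‖t • d‖ ≤ ‖x + t • d‖ + ‖x‖ := by
    have := norm_sub_le (x + t • d) x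
    rwa [add_sub_cancel_left] at this
  have h3 : (‖x‖ + |R|) / ‖d‖ < |t| := by
    have : 0 ≤ (‖x‖ + |R|) / ‖d‖ := by positivity
    have ht0 : t < 0 := by linarith
    rw [abs_of_neg ht0]
    linarith
  rw [div_lt_iff₀ hd'] at h3
  rw [norm_smul, Real.norm_eq_abs] at h2
  have := le_abs_self R
  linarith

/-- Far back along the line the point has left the bounded element and no face lies behind it, so
the constant is zero. Away from the frontier the value at `x` is not an exceptional one. -/
theorem Transversal.crossing_eq_zero (h : M.Transversal i d x) (hd : d ≠ 0)
    (hx : x ∉ frontier (M.body i)) : M.crossing i d x = 0 := by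
  obtain ⟨c, hc⟩ := exists_forall_eventually_nhdsNE_eq
    (h := fun t => M.crossing i d (x + t • d)) h.exists_eventually_crossing_eq
  have hbdd : Bornology.IsBounded (closure (M.body i)) := (M.isBounded_body i).closure
  obtain ⟨t₀, ht₀⟩ := eventually_atBot_notMem hbdd hd x
  have hzero : ∀ t < t₀, M.crossing i d (x + t • d) = 0 := by
    intro t ht
    have h1 : x + t • d ∉ M.body i := fun hm => ht₀ t ht (subset_closure hm)
    have h2 : ∀ F ∈ M.faces i, x + t • d ∉ (M.face F).prism d := by
      intro F hF hm
      obtain ⟨r, hr, hr'⟩ := add_smul_mem_prism.1 hm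
      exact ht₀ r (hr.trans ht)
        (frontier_subset_closure (M.carrier_subset_frontier hF hr'))
    rw [crossing, indicator_of_notMem h1, zero_add]
    exact Finset.sum_eq_zero fun F hF => by rw [indicator_of_notMem (h2 F hF), mul_zero]
  have hc0 : c = 0 := by
    have h1 := hc (t₀ - 1)
    have h2 : ∀ᶠ s in 𝓝[≠] (t₀ - 1), s < t₀ :=
      nhdsWithin_le_nhds (eventually_lt_nhds (by linarith))
    obtain ⟨s, hs1, hs2⟩ := (h1.and h2).exists
    rw [← hs1, hzero s hs2]
  have h1 := hc 0
  have h2 := h.eventually_crossing_eq (t := 0) (by simpa using hx)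
  obtain ⟨s, hs1, hs2⟩ := (h1.and (nhdsWithin_le_nhds h2)).exists
  rw [hs1, hc0] at hs2
  simpa using hs2.symm

theorem eq_plane_of_eq_smul {F G : Face} {n m : E3} (hn : F.IsUnitNormal n) (hm : G.IsUnitNormal m)
    {c : ℝ} (h : m = c • n) (hb : c * ⟪F.base, n⟫ = ⟪G.base, m⟫) : F.plane = G.plane := by
  ext z
  have hc : c ≠ 0 := by
    rintro rfl
    exact hm.ne_zero (by simpa using h)
  rw [hn.mem_plane_iff, hm.mem_plane_iff, inner_sub_left, inner_sub_left, ← hb, h,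
    real_inner_smul_right, ← mul_sub]
  simp [hc]

variable (M) in
-- Three families of planes have to be avoided: the planes of the faces (this also disposes of faces
-- parallel to `d`), the planes through the boundary lines of a face in the direction `d`, and the
-- sets of lines along `d` that meet two face planes in the same point.
theorem ae_transversal (i : ι) (d : E3) :
    ∀ᵐ x : E3, M.Transversal i d x ∧ x ∉ frontier (M.body i) := by
  have h1 : ∀ᵐ x : E3, ∀ F ∈ M.faces i,
      ⟪x, M.normal i F⟫ + -⟪(M.face F).base, M.normal i F⟫ ≠ 0 := by
    rw [Finset.eventually_all]
    intro F hF
    exact ae_inner_add_ne_zero _ _ (Or.inl (M.isUnitNormal hF).ne_zero)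
  have h2 : ∀ᵐ x : E3, ∀ F ∈ M.faces i, ⟪d, M.normal i F⟫ ≠ 0 → ∀ t : ℝ,
      x + t • d ∈ (M.face F).carrier → x + t • d ∈ (M.face F).relInterior := by
    rw [Finset.eventually_all]
    intro F hF
    by_cases hd : ⟪d, M.normal i F⟫ = 0
    · simp [hd]
    have hn := M.isUnitNormal hF
    obtain ⟨S, hS, hfr⟩ := (M.face F).polygonal
    -- The vector `v l` is orthogonal to `d` and has tangential components `l`. So `⟪·, v l⟫` is
    -- constant along the line, and a hit on the boundary line with normal `l` becomes a condition
    -- on `x` alone.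
    let v : E2 → E3 := fun l => ∑ a, l a • ((M.face F).tangent a -
      (⟪d, (M.face F).tangent a⟫ / ⟪d, M.normal i F⟫) • M.normal i F)
    have hv : ∀ l a, ⟪v l, (M.face F).tangent a⟫ = l a := by
      intro l a
      simp only [v, Fin.sum_univ_two, inner_add_left, real_inner_smul_left, inner_sub_left,
        hn.inner_tangent, Face.inner_tangent_tangent]
      fin_cases a <;> simp
    have hvne : ∀ l, l ≠ 0 → v l ≠ 0 := by
      intro l hl hv0
      apply hl
      ext a
      rw [← hv l a, hv0]
      simp
    have hae : ∀ᵐ x : E3, ∀ l ∈ S,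
        ⟪x, v l.1⟫ + (-⟪(M.face F).base, v l.1⟫ - l.2) ≠ 0 := by
      rw [Finset.eventually_all]
      intro l hl
      exact ae_inner_add_ne_zero _ _ (Or.inl (hvne _ (hS l hl)))
    filter_upwards [hae] with x hx _ t ht
    obtain ⟨y, hy, hyx⟩ := ht
    refine ⟨y, ?_, hyx⟩
    by_contra hyi
    have hyf : y ∈ frontier (M.face F).region := by
      rw [(M.face F).isCompact_region.isClosed.frontier_eq]
      exact ⟨hy, hyi⟩
    obtain ⟨l, hl, hly⟩ := hfr hyf
    apply hx l hl
    have hdv : ⟪d, v l.1⟫ = 0 := by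
      simp only [v, Fin.sum_univ_two, inner_add_right, real_inner_smul_right, inner_sub_right]
      field_simp
      ring
    have hxv : ⟪x, v l.1⟫ = ⟪(M.face F).point y, v l.1⟫ := by
      rw [hyx, inner_add_left, real_inner_smul_left, hdv, mul_zero, add_zero]
    have hpv : ⟪(M.face F).point y - (M.face F).base, v l.1⟫ = l.2 := by
      rw [Face.point_sub_base, inner_add_left, real_inner_smul_left, real_inner_smul_left,
        real_inner_comm, hv, real_inner_comm, hv, ← hly]
      simp [PiLp.inner_apply, Fin.sum_univ_two]
    rw [inner_sub_left] at hpv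
    rw [hxv]
    linarith
  have h3 : ∀ᵐ x : E3, ∀ F ∈ M.faces i, ∀ G ∈ M.faces i, ⟪d, M.normal i F⟫ ≠ 0 → G ≠ F →
      ∀ t : ℝ, x + t • d ∈ (M.face F).carrier → x + t • d ∉ (M.face G).carrier := by
    rw [Finset.eventually_all]
    intro F hF
    rw [Finset.eventually_all]
    intro G hG
    by_cases hd : ⟪d, M.normal i F⟫ = 0
    · simp [hd]
    by_cases hGF : G = F
    · simp [hGF]
    have hn := M.isUnitNormal hF
    have hm := M.isUnitNormal hG
    -- This `c` makes the normal of `G` minus `c` times the normal of `F` orthogonal to `d`, which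
    -- eliminates the parameter of the line. If the resulting affine condition were trivial, the two
    -- planes would coincide.
    set c := ⟪d, M.normal i G⟫ / ⟪d, M.normal i F⟫ with hc
    have hne : M.normal i G - c • M.normal i F ≠ 0 ∨
        c * ⟪(M.face F).base, M.normal i F⟫ - ⟪(M.face G).base, M.normal i G⟫ ≠ 0 := by
      by_contra! hcon
      exact M.plane_ne i F hF G hG (Ne.symm hGF)
        (eq_plane_of_eq_smul hn hm (sub_eq_zero.1 hcon.1) (sub_eq_zero.1 hcon.2))
    filter_upwards [ae_inner_add_ne_zero _ _ hne] with x hx _ _ t htF htG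
    apply hx
    obtain ⟨y, _, hy⟩ := htF
    obtain ⟨z, _, hz⟩ := htG
    have e1 := hn.inner_point_sub_base y
    have e2 := hm.inner_point_sub_base z
    rw [hy] at e1
    rw [hz] at e2
    simp only [inner_sub_left, inner_add_left, real_inner_smul_left] at e1 e2
    rw [inner_sub_right, real_inner_smul_right]
    have e3 : c * ⟪d, M.normal i F⟫ = ⟪d, M.normal i G⟫ := div_mul_cancel₀ _ hd
    linear_combination e2 - c * e1 + t * e3
  filter_upwards [h1, h2, h3] with x hx1 hx2 hx3
  have hdn : ∀ F ∈ M.faces i, ∀ t : ℝ, x + t • d ∈ (M.face F).carrier →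
      ⟪d, M.normal i F⟫ ≠ 0 := by
    intro F hF t ht hd
    apply hx1 F hF
    obtain ⟨y, _, hy⟩ := ht
    have e1 := (M.isUnitNormal hF).inner_point_sub_base y
    rw [hy] at e1
    simp only [inner_sub_left, inner_add_left, real_inner_smul_left, hd] at e1
    linarith
  refine ⟨fun F hF t ht => ?_, ?_⟩
  · have hd := hdn F hF t ht
    exact ⟨hx2 F hF hd t ht, hd, fun G hG hGF => hx3 F hF G hG hd hGF t ht⟩
  · rw [M.frontier_body i, mem_iUnion₂]
    rintro ⟨F, hF, y, _, hy⟩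
    apply hx1 F hF
    have e1 := (M.isUnitNormal hF).inner_point_sub_base y
    rw [hy, inner_sub_left] at e1
    linarith

variable (M) in
theorem ae_crossing_eq_zero (i : ι) (hd : d ≠ 0) : ∀ᵐ x : E3, M.crossing i d x = 0 := by
  filter_upwards [M.ae_transversal i d] with x hx
  exact hx.1.crossing_eq_zero hd hx.2

end Mesh

/-! ### The divergence theorem on an element -/

theorem real_sign_mul_abs (r : ℝ) : Real.sign r * |r| = r := by
  rcases lt_trichotomy r 0 with h | h | h
  · rw [Real.sign_of_neg h, abs_of_neg h]; ring
  · simp [h]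
  · rw [Real.sign_of_pos h, abs_of_pos h, one_mul]

theorem integral_Ioi_fderiv_line {g : E3 → ℝ} (hg : ContDiff ℝ 1 g) (hc : HasCompactSupport g)
    {d : E3} (hd : d ≠ 0) (x : E3) :
    ∫ s in Ioi (0 : ℝ), fderiv ℝ g (x + s • d) d = -g x := by
  have hline : ContDiff ℝ 1 fun s : ℝ => x + s • d := by fun_prop
  have hcomp : ContDiff ℝ 1 fun s : ℝ => g (x + s • d) := hg.comp hline
  have hsupp : HasCompactSupport fun s : ℝ => g (x + s • d) := by
    refine hc.comp_isClosedEmbedding (g := fun s : ℝ => x + s • d) ?_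
    exact (Homeomorph.addLeft x).isClosedEmbedding.comp (isClosedEmbedding_smul_left hd)
  have hder : ∀ s : ℝ, deriv (fun s : ℝ => g (x + s • d)) s = fderiv ℝ g (x + s • d) d := by
    intro s
    have h1 : HasDerivAt (fun s : ℝ => x + s • d) d s := by
      simpa using ((hasDerivAt_id s).smul_const d).const_add x
    exact ((hg.differentiable one_ne_zero _).hasFDerivAt.comp_hasDerivAt s h1).deriv
  have := hsupp.integral_Ioi_deriv_eq hcomp 0
  simpa only [hder, zero_smul, add_zero] using this

namespace Mesh

variable {Ω : Set E3} {ι κ : Type*} (M : Mesh Ω ι κ)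

/-- Almost everywhere the indicator of the element is minus the signed sum of prism indicators. Over
a prism the directional derivative integrates along the rays to `-|⟪d, n⟫|` times the integral of
`g` over the face, and sign times absolute value restores `⟪d, n⟫`. A face parallel to `d` has sign
zero, so nothing is needed about its degenerate prism. -/
theorem setIntegral_body_fderiv (i : ι) {g : E3 → ℝ} (hg : ContDiff ℝ 1 g)
    (hc : HasCompactSupport g) {d : E3} (hd : d ≠ 0) :
    ∫ x in M.body i, fderiv ℝ g x d =
      ∑ F ∈ M.faces i, ⟪d, M.normal i F⟫ *
        (M.face F).integral fun y => g ((M.face F).point y) := by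
  have hcont : Continuous fun x => fderiv ℝ g x d :=
    (hg.continuous_fderiv one_ne_zero).clm_apply continuous_const
  have hint : Integrable fun x => fderiv ℝ g x d :=
    hcont.integrable_of_hasCompactSupport (hc.fderiv_apply (𝕜 := ℝ) d)
  have hprism : ∀ F ∈ M.faces i, Integrable fun x => Real.sign ⟪d, M.normal i F⟫ *
      (((M.face F).prism d).indicator 1 x * fderiv ℝ g x d) := by
    intro F hF
    by_cases hdn : ⟪d, M.normal i F⟫ = 0
    · simp [hdn]
    refine Integrable.const_mul ?_ _
    have := hint.indicator ((M.isUnitNormal hF).measurableSet_prism hdn)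
    refine this.congr (Eventually.of_forall fun x => ?_)
    by_cases hx : x ∈ (M.face F).prism d <;> simp [hx]
  have hval : ∀ F ∈ M.faces i, ∫ x, Real.sign ⟪d, M.normal i F⟫ *
      (((M.face F).prism d).indicator 1 x * fderiv ℝ g x d) =
      -(⟪d, M.normal i F⟫ * (M.face F).integral fun y => g ((M.face F).point y)) := by
    intro F hF
    by_cases hdn : ⟪d, M.normal i F⟫ = 0
    · simp [hdn]
    have hn := M.isUnitNormal hF
    rw [integral_const_mul]
    have h1 : ∫ x, ((M.face F).prism d).indicator 1 x * fderiv ℝ g x d =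
        ∫ x in (M.face F).prism d, fderiv ℝ g x d := by
      rw [← integral_indicator (hn.measurableSet_prism hdn)]
      refine integral_congr_ae (Eventually.of_forall fun x => ?_)
      by_cases hx : x ∈ (M.face F).prism d <;> simp [hx]
    rw [h1, hn.setIntegral_prism hdn hint]
    simp only [integral_Ioi_fderiv_line hg hc hd]
    rw [← mul_assoc, real_sign_mul_abs, Face.integral, integral_neg, Face.integral, mul_neg]
  have hae : ∀ᵐ x : E3, (M.body i).indicator (fun x => fderiv ℝ g x d) x =
      -∑ F ∈ M.faces i, Real.sign ⟪d, M.normal i F⟫ *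
        (((M.face F).prism d).indicator 1 x * fderiv ℝ g x d) := by
    filter_upwards [M.ae_crossing_eq_zero i hd] with x hx
    rw [crossing] at hx
    have h2 : (M.body i).indicator (fun x => fderiv ℝ g x d) x =
        (M.body i).indicator 1 x * fderiv ℝ g x d := by
      by_cases hx : x ∈ M.body i <;> simp [hx]
    rw [h2, eq_neg_of_add_eq_zero_left hx, neg_mul, Finset.sum_mul]
    simp only [mul_assoc]
  rw [← integral_indicator (M.isOpen_body i).measurableSet, integral_congr_ae hae,
    integral_neg, integral_finsetSum _ hprism, Finset.sum_congr rfl hval,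
    Finset.sum_neg_distrib, neg_neg]

end Mesh

/-! ### Polynomials as differentiable functions, and their divergence theorem -/

theorem hasFDerivAt_ev3 (p : Poly3) (x : E3) :
    HasFDerivAt (ev3 p) (∑ a, ev3 (MvPolynomial.pderiv a p) x •
      (EuclideanSpace.proj a : E3 →L[ℝ] ℝ)) x := by
  induction p using MvPolynomial.induction_on with
  | C c =>
    have h : ev3 (MvPolynomial.C c) = fun _ => c := by funext x; simp [ev3]
    rw [h]
    convert hasFDerivAt_const c x using 1
    simp [ev3]
  | add p q hp hq =>
    have h : ev3 (p + q) = fun x => ev3 p x + ev3 q x := by funext x; simp [ev3]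
    rw [h]
    refine (hp.add hq).congr_fderiv ?_
    rw [← Finset.sum_add_distrib]
    refine Finset.sum_congr rfl fun a _ => ?_
    rw [map_add, ev3_add, add_smul]
  | mul_X p b hp =>
    have h : ev3 (p * MvPolynomial.X b) = fun x => ev3 p x * x b := by funext x; simp [ev3]
    rw [h]
    refine (hp.mul (EuclideanSpace.proj b : E3 →L[ℝ] ℝ).hasFDerivAt).congr_fderiv ?_
    have hX : ∀ a, ev3 (MvPolynomial.pderiv a (p * MvPolynomial.X b)) x =
        ev3 (MvPolynomial.pderiv a p) x * x b + if a = b then ev3 p x else 0 := by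
      intro a
      rw [MvPolynomial.pderiv_mul, ev3_add]
      by_cases hab : a = b
      · subst hab
        simp [ev3]
      · rw [MvPolynomial.pderiv_X_of_ne (Ne.symm hab)]
        simp [ev3, hab]
    simp only [hX, add_smul, Finset.sum_add_distrib, ite_smul, zero_smul, Finset.sum_ite_eq',
      Finset.mem_univ, if_true, Finset.smul_sum, smul_smul]
    rw [add_comm]
    simp [mul_comm]

theorem contDiff_ev3 (p : Poly3) : ContDiff ℝ 1 (ev3 p) := by
  unfold ev3
  induction p using MvPolynomial.induction_on with
  | C c => simpa using contDiff_const
  | add p q hp hq => simpa using hp.add hq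
  | mul_X p b hp =>
    simp only [map_mul, MvPolynomial.eval_X]
    exact hp.mul (by fun_prop)

/-- Integration along infinite rays needs compact support, while only values and derivatives of the
polynomial near the element matter. -/
theorem exists_cutoff {S : Set E3} (hS : Bornology.IsBounded S) (p : Poly3) :
    ∃ g : E3 → ℝ, ContDiff ℝ 1 g ∧ HasCompactSupport g ∧ ∀ x ∈ S, g =ᶠ[𝓝 x] ev3 p := by
  obtain ⟨R, hR0, hR⟩ := hS.subset_ball_lt 0 0
  let b : ContDiffBump (0 : E3) := ⟨R, R + 1, hR0, by linarith⟩
  refine ⟨fun x => b x * ev3 p x, b.contDiff.mul (contDiff_ev3 p), b.hasCompactSupport.mul_right,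
    fun x hx => ?_⟩
  filter_upwards [Metric.isOpen_ball.mem_nhds (hR hx)] with y hy
  rw [b.one_of_mem_closedBall (Metric.ball_subset_closedBall hy), one_mul]

namespace Mesh

variable {Ω : Set E3} {ι κ : Type*} (M : Mesh Ω ι κ)

theorem setIntegral_body_pderiv (i : ι) (p : Poly3) (a : Fin 3) :
    ∫ x in M.body i, ev3 (MvPolynomial.pderiv a p) x =
      ∑ F ∈ M.faces i, M.normal i F a *
        (M.face F).integral fun y => ev3 p ((M.face F).point y) := by
  obtain ⟨g, hg, hc, hgp⟩ := exists_cutoff (M.isBounded_body i).closure p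
  have hd : (EuclideanSpace.single a 1 : E3) ≠ 0 := by simp
  have := M.setIntegral_body_fderiv i hg hc hd
  have h1 : ∫ x in M.body i, fderiv ℝ g x (EuclideanSpace.single a 1) =
      ∫ x in M.body i, ev3 (MvPolynomial.pderiv a p) x := by
    refine setIntegral_congr_fun (M.isOpen_body i).measurableSet fun x hx => ?_
    rw [(hgp x (subset_closure hx)).fderiv_eq, (hasFDerivAt_ev3 p x).fderiv]
    simp [PiLp.single_apply]
  rw [← h1, this]
  refine Finset.sum_congr rfl fun F hF => ?_
  congr 1
  · simp [EuclideanSpace.inner_single_left]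
  · refine setIntegral_congr_fun (M.face F).isCompact_region.measurableSet fun y hy => ?_
    exact (hgp _ (frontier_subset_closure
      (M.carrier_subset_frontier hF ⟨y, hy, rfl⟩))).eq_of_nhds

/-- The divergence theorem for polynomial vector fields on an element of the mesh. -/
theorem setIntegral_body_divP (i : ι) (q : Fin 3 → Poly3) :
    ∫ x in M.body i, ev3 (divP q) x =
      ∑ F ∈ M.faces i, (M.face F).integral fun y =>
        ⟪vev q ((M.face F).point y), M.normal i F⟫ := by
  have h1 : ∀ x, ev3 (divP q) x = ∑ a, ev3 (MvPolynomial.pderiv a (q a)) x := by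
    intro x
    simp [divP, ev3]
  simp only [h1]
  rw [integral_finsetSum _ fun a _ =>
    integrableOn_bounded (M.isBounded_body i) (continuous_ev3 _)]
  simp only [M.setIntegral_body_pderiv]
  rw [Finset.sum_comm]
  refine Finset.sum_congr rfl fun F _ => ?_
  have h2 : ∀ y, ⟪vev q ((M.face F).point y), M.normal i F⟫ =
      ∑ a, M.normal i F a * ev3 (q a) ((M.face F).point y) := by
    intro y
    simp [PiLp.inner_apply, vev]
  simp only [h2]
  unfold Face.integral
  rw [integral_finsetSum]
  · simp only [integral_const_mul]
  · intro a _
    exact (integrableOn_region _ ((continuous_ev3 _).comp (continuous_point _))).const_mul _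

end Mesh

/-! ### Polynomials -/

section Polynomials

open MvPolynomial

theorem eq_zero_of_eval_eq_zero_on_open {n : ℕ} {U : Set (EuclideanSpace ℝ (Fin n))}
    (hU : IsOpen U) (hne : U.Nonempty) {p : MvPolynomial (Fin n) ℝ}
    (h : ∀ x ∈ U, eval (fun a => x a) p = 0) : p = 0 := by
  obtain ⟨x₀, hx₀⟩ := hne
  have hopen : IsOpen ((fun y : Fin n → ℝ => (WithLp.toLp 2 y : EuclideanSpace ℝ (Fin n))) ⁻¹' U) :=
    hU.preimage (PiLp.continuous_toLp 2 _)
  obtain ⟨ε, hε, hsub⟩ := Metric.isOpen_iff.1 hopen (x₀.ofLp) (by simpa using hx₀)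
  refine MvPolynomial.funext_set (fun b => Ioo (x₀ b - ε) (x₀ b + ε))
    (fun b => Ioo_infinite (by linarith)) (fun y hy => ?_)
  have hy' : (WithLp.toLp 2 y : EuclideanSpace ℝ (Fin n)) ∈ U := by
    refine hsub ?_
    rw [Metric.mem_ball, dist_pi_lt_iff hε]
    intro b
    have := hy b (mem_univ b)
    rw [Real.dist_eq, abs_lt]
    constructor <;> linarith [this.1, this.2]
  simpa using h _ hy'

theorem continuous_eval_euclidean {n : ℕ} (p : MvPolynomial (Fin n) ℝ) :
    Continuous fun x : EuclideanSpace ℝ (Fin n) => eval (fun a => x a) p :=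
  (MvPolynomial.continuous_eval p).comp (by fun_prop)

theorem eq_zero_of_setIntegral_eq_zero {n : ℕ} {U R : Set (EuclideanSpace ℝ (Fin n))}
    (hU : IsOpen U) (hne : U.Nonempty) (hUR : U ⊆ R) (hR : MeasurableSet R)
    (hb : Bornology.IsBounded R) {p : MvPolynomial (Fin n) ℝ}
    (hp : ∀ x ∈ R, 0 ≤ eval (fun a => x a) p) (h : ∫ x in R, eval (fun a => x a) p = 0) :
    p = 0 := by
  have hc := continuous_eval_euclidean p
  refine eq_zero_of_eval_eq_zero_on_open hU hne ?_
  have hint : IntegrableOn (fun x : EuclideanSpace ℝ (Fin n) => eval (fun a => x a) p) R :=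
    (hc.continuousOn.integrableOn_compact hb.isCompact_closure).mono_set subset_closure
  rw [setIntegral_eq_zero_iff_of_nonneg_ae (ae_restrict_of_forall_mem hR hp) hint] at h
  have h' := ae_restrict_of_ae_restrict_of_subset hUR h
  have := Measure.eqOn_open_of_ae_eq h' hU hc.continuousOn continuousOn_const
  exact fun x hx => this hx

theorem eq_zero_of_sum_sq_eq_zero {n m : ℕ} {q : Fin m → MvPolynomial (Fin n) ℝ}
    (h : ∑ a, q a ^ 2 = 0) : q = 0 := by
  funext a
  refine MvPolynomial.funext fun x => ?_
  have := congrArg (eval x) h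
  simp only [map_sum, map_pow, map_zero] at this
  rw [Finset.sum_eq_zero_iff_of_nonneg fun a _ => sq_nonneg _] at this
  simpa using this a (Finset.mem_univ a)

theorem totalDegree_aeval_le {σ τ : Type*} {f : σ → MvPolynomial τ ℝ}
    (hf : ∀ s, (f s).totalDegree ≤ 1) (p : MvPolynomial σ ℝ) :
    (aeval f p).totalDegree ≤ p.totalDegree := by
  rw [aeval_def, eval₂_eq]
  refine totalDegree_finsetSum_le fun d hd => ?_
  refine (totalDegree_mul _ _).trans ?_
  rw [algebraMap_eq, totalDegree_C, zero_add]
  refine (totalDegree_finsetProd _ _).trans (le_trans ?_ (le_totalDegree hd))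
  rw [Finsupp.sum]
  refine Finset.sum_le_sum fun s _ => (totalDegree_pow _ _).trans ?_
  simpa using Nat.mul_le_mul_left (d s) (hf s)

theorem totalDegree_pderiv_le {σ : Type*} (a : σ) (p : MvPolynomial σ ℝ) :
    (pderiv a p).totalDegree ≤ p.totalDegree - 1 := by
  classical
  rw [totalDegree]
  refine Finset.sup_le fun m hm => ?_
  rw [mem_support_iff, coeff_pderiv] at hm
  have := le_totalDegree (mem_support_iff.2 (left_ne_zero_of_mul hm))
  rw [Finsupp.sum_add_index' (by simp) (by simp), Finsupp.sum_single_index (by simp)] at this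
  omega

theorem exists_eq_C_of_pderiv_eq_zero {σ : Type*} {p : MvPolynomial σ ℝ}
    (h : ∀ a, pderiv a p = 0) : ∃ c, p = C c := by
  classical
  refine ⟨coeff 0 p, ?_⟩
  ext m
  rw [coeff_C]
  split_ifs with hm
  · rw [hm]
  · obtain ⟨a, ha⟩ : ∃ a, m a ≠ 0 := by
      by_contra! hcon
      exact hm (Finsupp.ext fun a => by simp [hcon a])
    have h1 := coeff_pderiv (i := a) p (m - Finsupp.single a 1)
    have h2 : m - Finsupp.single a 1 + Finsupp.single a 1 = m := by
      ext b
      by_cases hb : a = b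
      · subst hb
        simp only [Finsupp.add_apply, Finsupp.tsub_apply, Finsupp.single_eq_same]
        omega
      · simp [Finsupp.single_eq_of_ne (Ne.symm hb)]
    rw [h a, coeff_zero, h2] at h1
    rcases mul_eq_zero.1 h1.symm with h3 | h3
    · exact h3
    · exfalso
      have : (0 : ℝ) ≤ (((m - Finsupp.single a 1 : σ →₀ ℕ) a : ℕ) : ℝ) := Nat.cast_nonneg _
      linarith

end Polynomials

/-! ### Pointwise vector calculus of polynomial fields -/

/-- The gradient of a polynomial. -/
def gradP (p : Poly3) : Fin 3 → Poly3 := fun a => MvPolynomial.pderiv a p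

/-- The polynomial `x ↦ ⟪x - b, v⟫`. -/
def linP (b v : E3) : Poly3 :=
  ∑ a, MvPolynomial.C (v a) * (MvPolynomial.X a - MvPolynomial.C (b a))

theorem ev3_mul (p q : Poly3) (x : E3) : ev3 (p * q) x = ev3 p x * ev3 q x := by simp [ev3]

theorem ev3_sub (p q : Poly3) (x : E3) : ev3 (p - q) x = ev3 p x - ev3 q x := by simp [ev3]

theorem ev3_pow (p : Poly3) (m : ℕ) (x : E3) : ev3 (p ^ m) x = ev3 p x ^ m := by simp [ev3]

theorem ev3_C (c : ℝ) (x : E3) : ev3 (MvPolynomial.C c) x = c := by simp [ev3]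

theorem ev3_prod {κ : Type*} (S : Finset κ) (p : κ → Poly3) (x : E3) :
    ev3 (∏ F ∈ S, p F) x = ∏ F ∈ S, ev3 (p F) x := by simp [ev3]

theorem ev3_sum {κ : Type*} (S : Finset κ) (p : κ → Poly3) (x : E3) :
    ev3 (∑ F ∈ S, p F) x = ∑ F ∈ S, ev3 (p F) x := by simp [ev3]

theorem ev2_mul (p q : Poly2) (x : E2) : ev2 (p * q) x = ev2 p x * ev2 q x := by simp [ev2]

theorem ev2_add (p q : Poly2) (x : E2) : ev2 (p + q) x = ev2 p x + ev2 q x := by simp [ev2]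

theorem ev2_sub (p q : Poly2) (x : E2) : ev2 (p - q) x = ev2 p x - ev2 q x := by simp [ev2]

theorem ev2_C (c : ℝ) (x : E2) : ev2 (MvPolynomial.C c) x = c := by simp [ev2]

theorem ev2_sum {κ : Type*} (S : Finset κ) (p : κ → Poly2) (x : E2) :
    ev2 (∑ F ∈ S, p F) x = ∑ F ∈ S, ev2 (p F) x := by simp [ev2]

theorem vev_apply (q : Fin 3 → Poly3) (x : E3) (a : Fin 3) : vev q x a = ev3 (q a) x := rfl

theorem vev_sub (p q : Fin 3 → Poly3) (x : E3) : vev (p - q) x = vev p x - vev q x := by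
  ext a; simp [vev, ev3_sub]

theorem vev_zero (x : E3) : vev 0 x = 0 := by
  ext a; simp [vev, ev3]

theorem inner_eq_sum (u v : E3) : ⟪u, v⟫ = u 0 * v 0 + u 1 * v 1 + u 2 * v 2 := by
  simp [PiLp.inner_apply, Fin.sum_univ_three, mul_comm]

theorem inner_vev (p q : Fin 3 → Poly3) (x : E3) :
    ⟪vev p x, vev q x⟫ = ev3 (∑ a, p a * q a) x := by
  rw [inner_eq_sum, Fin.sum_univ_three, ev3_add, ev3_add, ev3_mul, ev3_mul, ev3_mul]
  rfl

theorem ev3_linP (b v x : E3) : ev3 (linP b v) x = ⟪x - b, v⟫ := by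
  rw [linP, ev3_sum, inner_eq_sum, Fin.sum_univ_three]
  simp [ev3, mul_comm]

theorem pderiv_linP (b v : E3) (a : Fin 3) :
    MvPolynomial.pderiv a (linP b v) = MvPolynomial.C (v a) := by
  rw [linP, map_sum, Finset.sum_eq_single a]
  · rw [MvPolynomial.pderiv_C_mul]
    simp
  · intro c _ hc
    rw [MvPolynomial.pderiv_C_mul]
    simp [MvPolynomial.pderiv_X_of_ne hc]
  · simp

theorem totalDegree_linP_le (b v : E3) : (linP b v).totalDegree ≤ 1 := by
  refine MvPolynomial.totalDegree_finsetSum_le fun a _ => ?_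
  refine (MvPolynomial.totalDegree_mul _ _).trans ?_
  rw [MvPolynomial.totalDegree_C, zero_add]
  exact (MvPolynomial.totalDegree_sub_C_le _ _).trans (by simp)

theorem vev_gradP_mul (p q : Poly3) (x : E3) :
    vev (gradP (p * q)) x = ev3 q x • vev (gradP p) x + ev3 p x • vev (gradP q) x := by
  ext a
  simp only [vev, gradP, MvPolynomial.pderiv_mul, ev3_add, ev3_mul, PiLp.add_apply,
    PiLp.smul_apply, smul_eq_mul]
  ring

theorem vev_gradP_linP (b v x : E3) : vev (gradP (linP b v)) x = v := by
  ext a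
  simp [vev, gradP, pderiv_linP, ev3_C]

theorem ev3_eq_zero_of_sq_dvd {l m : Poly3} (h : l ^ 2 ∣ m) {x : E3} (hx : ev3 l x = 0) :
    ev3 m x = 0 := by
  obtain ⟨w, rfl⟩ := h
  rw [ev3_mul, ev3_pow, hx]
  ring

/-- The double zero is the second reason for squares in the bubbles: it removes the trace of the
curl of a test field together with the trace of the field. -/
theorem vev_gradP_eq_zero_of_sq_dvd {l m : Poly3} (h : l ^ 2 ∣ m) {x : E3} (hx : ev3 l x = 0) :
    vev (gradP m) x = 0 := by
  obtain ⟨w, rfl⟩ := h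
  rw [sq, mul_assoc, vev_gradP_mul, ev3_mul, hx]
  simp

theorem cross_apply_zero (a b : E3) : cross a b 0 = a 1 * b 2 - a 2 * b 1 := by
  simp [cross, crossProduct]

theorem cross_apply_one (a b : E3) : cross a b 1 = a 2 * b 0 - a 0 * b 2 := by
  simp [cross, crossProduct]

theorem cross_apply_two (a b : E3) : cross a b 2 = a 0 * b 1 - a 1 * b 0 := by
  simp [cross, crossProduct]

theorem ext_three {a b : E3} (h0 : a 0 = b 0) (h1 : a 1 = b 1) (h2 : a 2 = b 2) : a = b := by
  ext c
  fin_cases c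
  exacts [h0, h1, h2]

theorem cross_sub_left (a b c : E3) : cross (a - b) c = cross a c - cross b c := by
  apply ext_three <;> simp [cross_apply_zero, cross_apply_one, cross_apply_two] <;> ring

theorem cross_smul_left (r : ℝ) (a b : E3) : cross (r • a) b = r • cross a b := by
  apply ext_three <;> simp [cross_apply_zero, cross_apply_one, cross_apply_two] <;> ring

theorem cross_smul_right (r : ℝ) (a b : E3) : cross a (r • b) = r • cross a b := by
  apply ext_three <;> simp [cross_apply_zero, cross_apply_one, cross_apply_two] <;> ring

theorem cross_neg_right (a b : E3) : cross a (-b) = -cross a b := by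
  apply ext_three <;> simp [cross_apply_zero, cross_apply_one, cross_apply_two] <;> ring

theorem cross_zero_left (a : E3) : cross 0 a = 0 := by
  apply ext_three <;> simp [cross_apply_zero, cross_apply_one, cross_apply_two]

theorem cross_self_eq_zero (a : E3) : cross a a = 0 := by
  apply ext_three <;> simp [cross_apply_zero, cross_apply_one, cross_apply_two] <;> ring

theorem inner_cross_left (a b c : E3) : ⟪cross a b, c⟫ = -⟪cross a c, b⟫ := by
  simp only [inner_eq_sum, cross_apply_zero, cross_apply_one, cross_apply_two]
  ring

theorem inner_cross_swap (a b c : E3) : ⟪cross a b, c⟫ = ⟪a, cross b c⟫ := by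
  simp only [inner_eq_sum, cross_apply_zero, cross_apply_one, cross_apply_two]
  ring

theorem inner_cross_self (a b : E3) : ⟪cross a b, b⟫ = 0 := by
  simp only [inner_eq_sum, cross_apply_zero, cross_apply_one, cross_apply_two]
  ring

theorem cross_cross_normal (a n : E3) :
    cross n (cross a n) = ⟪n, n⟫ • a - ⟪a, n⟫ • n := by
  rw [inner_eq_sum, inner_eq_sum]
  apply ext_three <;>
    simp [cross_apply_zero, cross_apply_one, cross_apply_two] <;> ring

theorem vev_crossProduct (p q : Fin 3 → Poly3) (x : E3) :
    vev (crossProduct p q) x = cross (vev p x) (vev q x) := by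
  apply ext_three
  · rw [cross_apply_zero]; simp [vev, crossProduct, ev3]
  · rw [cross_apply_one]; simp [vev, crossProduct, ev3]
  · rw [cross_apply_two]; simp [vev, crossProduct, ev3]

theorem vev_curlP_mul (m : Poly3) (w : Fin 3 → Poly3) (x : E3) :
    vev (curlP fun a => m * w a) x =
      cross (vev (gradP m) x) (vev w x) + ev3 m x • vev (curlP w) x := by
  apply ext_three
  · simp [cross_apply_zero, vev, curlP, gradP, ev3]; ring
  · simp [cross_apply_one, vev, curlP, gradP, ev3]; ring
  · simp [cross_apply_two, vev, curlP, gradP, ev3]; ring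

theorem vev_mul (m : Poly3) (w : Fin 3 → Poly3) (x : E3) :
    vev (fun a => m * w a) x = ev3 m x • vev w x := by
  ext a
  simp [vev, ev3_mul]

theorem divP_crossProduct (p q : Fin 3 → Poly3) :
    divP (crossProduct p q) = ∑ a, curlP p a * q a - ∑ a, p a * curlP q a := by
  simp [divP, curlP, Fin.sum_univ_three, crossProduct]
  ring

theorem divP_mul (p : Poly3) (q : Fin 3 → Poly3) :
    divP (fun a => p * q a) = ∑ a, gradP p a * q a + p * divP q := by
  simp only [divP, gradP, MvPolynomial.pderiv_mul, Finset.sum_add_distrib, Finset.mul_sum]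

theorem totalDegree_curlP_le {q : Fin 3 → Poly3} {r : ℕ} (hq : ∀ a, (q a).totalDegree ≤ r)
    (a : Fin 3) : (curlP q a).totalDegree ≤ r - 1 := by
  have h : ∀ b c, (MvPolynomial.pderiv b (q c)).totalDegree ≤ r - 1 := fun b c =>
    (totalDegree_pderiv_le b (q c)).trans (Nat.sub_le_sub_right (hq c) 1)
  fin_cases a <;>
    exact (MvPolynomial.totalDegree_sub _ _).trans (max_le (h _ _) (h _ _))

/-- The polynomial vector field of degree at most `r` with the given components. -/
def PolyVec.ofField {r : ℕ} (q : Fin 3 → Poly3) (hq : ∀ a, (q a).totalDegree ≤ r) : PolyVec r :=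
  fun a => ⟨q a, (MvPolynomial.mem_restrictTotalDegree _ _ _).2 (hq a)⟩

theorem PolyVec.toField_ofField {r : ℕ} (q : Fin 3 → Poly3) (hq : ∀ a, (q a).totalDegree ≤ r) :
    (PolyVec.ofField q hq).toField = q := rfl

/-! ### Restriction of polynomials to a face and extension from a face -/

namespace Face

variable (F : Face)

/-- The restriction of a polynomial to the plane of a face, in the coordinates of the face. -/
def restr : Poly3 →ₐ[ℝ] Poly2 :=
  MvPolynomial.aeval fun a => MvPolynomial.C (F.base a) +
    MvPolynomial.C (F.tangent 0 a) * MvPolynomial.X 0 +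
    MvPolynomial.C (F.tangent 1 a) * MvPolynomial.X 1

/-- The extension of a polynomial on the plane of a face that is constant in the direction of
the normal. -/
def lift : Poly2 →ₐ[ℝ] Poly3 := MvPolynomial.aeval fun b => linP F.base (F.tangent b)

theorem ev2_restr (p : Poly3) (y : E2) : ev2 (F.restr p) y = ev3 p (F.point y) := by
  induction p using MvPolynomial.induction_on with
  | C c => simp [restr, ev2, ev3]
  | add p q hp hq => rw [map_add, ev2_add, hp, hq, ev3_add]
  | mul_X p a hp =>
    rw [map_mul, ev2_mul, hp, ev3_mul]
    congr 1
    simp [restr, ev2, ev3, Face.point]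
    ring

theorem ev3_lift_point (p : Poly2) (y : E2) : ev3 (F.lift p) (F.point y) = ev2 p y := by
  induction p using MvPolynomial.induction_on with
  | C c => simp [lift, ev2, ev3]
  | add p q hp hq => rw [map_add, ev3_add, hp, hq, ev2_add]
  | mul_X p a hp =>
    rw [map_mul, ev3_mul, hp, ev2_mul]
    congr 1
    simp only [lift, MvPolynomial.aeval_X, ev3_linP, F.inner_point_sub_base_tangent]
    simp [ev2]

theorem totalDegree_restr_le (p : Poly3) : (F.restr p).totalDegree ≤ p.totalDegree := by
  refine totalDegree_aeval_le (fun a => ?_) p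
  have h : ∀ (c : ℝ) (b : Fin 2),
      (MvPolynomial.C c * MvPolynomial.X b : Poly2).totalDegree ≤ 1 := fun c b =>
    (MvPolynomial.totalDegree_mul _ _).trans (by simp)
  exact (MvPolynomial.totalDegree_add _ _).trans (max_le ((MvPolynomial.totalDegree_add _ _).trans
    (max_le (by simp) (h _ _))) (h _ _))

theorem totalDegree_lift_le (p : Poly2) : (F.lift p).totalDegree ≤ p.totalDegree :=
  totalDegree_aeval_le (fun _ => totalDegree_linP_le _ _) p

theorem interior_region_nonempty : (interior F.region).Nonempty := by
  rw [← closure_nonempty_iff, F.closure_interior]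
  exact F.nonempty_region

theorem eq_zero_of_ev2_eq_zero {p : Poly2} (h : ∀ y ∈ F.region, ev2 p y = 0) : p = 0 :=
  eq_zero_of_eval_eq_zero_on_open isOpen_interior F.interior_region_nonempty
    fun y hy => h y (interior_subset hy)

theorem eq_zero_of_integral_eq_zero {p : Poly2} (hp : ∀ y ∈ F.region, 0 ≤ ev2 p y)
    (h : F.integral (ev2 p) = 0) : p = 0 :=
  eq_zero_of_setIntegral_eq_zero isOpen_interior F.interior_region_nonempty interior_subset
    F.isCompact_region.measurableSet F.isCompact_region.isBounded hp h

theorem integral_congr {g h : E2 → ℝ} (hgh : ∀ y ∈ F.region, g y = h y) :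
    F.integral g = F.integral h :=
  setIntegral_congr_fun F.isCompact_region.measurableSet hgh

theorem integral_eq_zero {g : E2 → ℝ} (h : ∀ y ∈ F.region, g y = 0) : F.integral g = 0 :=
  setIntegral_eq_zero_of_forall_eq_zero h

/-- A weighted sum of squares of polynomials on a face has integral zero only if the polynomials
vanish. -/
theorem eq_zero_of_integral_weight {m : ℕ} {w : Poly2} (hw : w ≠ 0)
    (hw0 : ∀ y ∈ F.region, 0 ≤ ev2 w y) {q : Fin m → Poly2}
    (h : (F.integral fun y => ev2 w y * ∑ a, ev2 (q a) y ^ 2) = 0) : q = 0 := by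
  have he : ∀ y, ev2 (w * ∑ a, q a ^ 2) y = ev2 w y * ∑ a, ev2 (q a) y ^ 2 := by
    intro y
    simp [ev2]
  have h0 : w * ∑ a, q a ^ 2 = 0 := by
    refine F.eq_zero_of_integral_eq_zero (fun y hy => ?_) ?_
    · rw [he]
      exact mul_nonneg (hw0 y hy) (Finset.sum_nonneg fun a _ => sq_nonneg _)
    · rw [← h]
      exact F.integral_congr fun y _ => he y
  exact eq_zero_of_sum_sq_eq_zero ((mul_eq_zero.1 h0).resolve_left hw)

/-- If the linear polynomial of `G` vanished on the plane of `F`, then `m` would be orthogonal to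
both tangent vectors, hence a multiple of `n`, and the planes would coincide. -/
theorem restr_linP_ne_zero {F G : Face} {n m : E3} (hn : F.IsUnitNormal n) (hm : G.IsUnitNormal m)
    (h : F.plane ≠ G.plane) : F.restr (linP G.base m) ≠ 0 := by
  intro h0
  have h1 : ∀ y, ⟪F.point y - G.base, m⟫ = 0 := by
    intro y
    rw [← ev3_linP, ← F.ev2_restr, h0]
    simp [ev2]
  have hb : ⟪F.base - G.base, m⟫ = 0 := by
    have := h1 0
    simpa [Face.point] using this
  have ht : ∀ a, ⟪m, F.tangent a⟫ = 0 := by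
    intro a
    have h2 := h1 (EuclideanSpace.single a 1)
    have h3 : F.point (EuclideanSpace.single a 1) = F.base + F.tangent a := by
      fin_cases a <;> simp [Face.point]
    rw [h3, add_sub_right_comm, inner_add_left, hb, zero_add] at h2
    rw [real_inner_comm, h2]
  have hmn := hn.expand m
  rw [ht, ht, zero_smul, zero_smul, add_zero, add_zero] at hmn
  refine h (Mesh.eq_plane_of_eq_smul hn hm hmn ?_)
  have : ⟪F.base, m⟫ = ⟪m, n⟫ * ⟪F.base, n⟫ := by
    conv_lhs => rw [hmn]
    rw [real_inner_smul_right]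
  rw [inner_sub_left] at hb
  linarith

end Face

/-! ### Polynomial vector fields on a face -/

/-- The value of a vector field with polynomial components on the coordinate plane. -/
def evv2 (w : Fin 3 → Poly2) (y : E2) : E3 := WithLp.toLp 2 fun a => ev2 (w a) y

theorem evv2_sub (w z : Fin 3 → Poly2) (y : E2) : evv2 (w - z) y = evv2 w y - evv2 z y := by
  ext a; simp [evv2, ev2_sub]

theorem evv2_zero (y : E2) : evv2 0 y = 0 := by
  ext a; simp [evv2, ev2]

theorem inner_evv2_self (w : Fin 3 → Poly2) (y : E2) :
    ⟪evv2 w y, evv2 w y⟫ = ∑ a, ev2 (w a) y ^ 2 := by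
  rw [inner_eq_sum, Fin.sum_univ_three]
  simp only [evv2, sq]

theorem inner_evv2_left (w : Fin 3 → Poly2) (v : E3) (y : E2) :
    ⟪evv2 w y, v⟫ = ev2 (∑ a, w a * MvPolynomial.C (v a)) y := by
  rw [inner_eq_sum, Fin.sum_univ_three]
  simp [evv2, ev2]

theorem evv2_injective {w z : Fin 3 → Poly2} (h : ∀ y, evv2 w y = evv2 z y) : w = z := by
  funext a
  refine MvPolynomial.funext fun y => ?_
  have := congrArg (fun v : E3 => v a) (h (WithLp.toLp 2 y))
  simpa [evv2, ev2] using this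

/-- The cross product of a polynomial vector field with a constant vector. -/
def crossP2 (w : Fin 3 → Poly2) (n : E3) : Fin 3 → Poly2 :=
  crossProduct w fun a => MvPolynomial.C (n a)

theorem evv2_crossP2 (w : Fin 3 → Poly2) (n : E3) (y : E2) :
    evv2 (crossP2 w n) y = cross (evv2 w y) n := by
  apply ext_three
  · rw [cross_apply_zero]; simp [evv2, crossP2, crossProduct, ev2]
  · rw [cross_apply_one]; simp [evv2, crossP2, crossProduct, ev2]
  · rw [cross_apply_two]; simp [evv2, crossP2, crossProduct, ev2]

theorem totalDegree_mul_C_le {σ : Type*} (p : MvPolynomial σ ℝ) (c : ℝ) :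
    (p * MvPolynomial.C c).totalDegree ≤ p.totalDegree :=
  (MvPolynomial.totalDegree_mul _ _).trans (by simp)

theorem totalDegree_crossP2_le {w : Fin 3 → Poly2} {r : ℕ} (hw : ∀ a, (w a).totalDegree ≤ r)
    (n : E3) (a : Fin 3) : (crossP2 w n a).totalDegree ≤ r := by
  have h : ∀ b c, (w b * MvPolynomial.C (n c)).totalDegree ≤ r := fun b c =>
    (totalDegree_mul_C_le _ _).trans (hw b)
  fin_cases a <;>
    exact (MvPolynomial.totalDegree_sub _ _).trans (max_le (h _ _) (h _ _))

namespace Face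

variable (F : Face)

/-- The trace of a polynomial vector field on a face. -/
def traceP (u : Fin 3 → Poly3) : Fin 3 → Poly2 := fun a => F.restr (u a)

/-- The components of a tangential polynomial field. -/
def tanP (w : Fin 2 → Poly2) : Fin 3 → Poly2 := fun a =>
  w 0 * MvPolynomial.C (F.tangent 0 a) + w 1 * MvPolynomial.C (F.tangent 1 a)

/-- The extension of a vector field from a face. -/
def liftV (w : Fin 3 → Poly2) : Fin 3 → Poly3 := fun a => F.lift (w a)

/-- The rotated tangential difference `(u - w) × n` of a field on space and a tangential field on
the face. -/
def tangentialJump (u : Fin 3 → Poly3) (w : Fin 2 → Poly2) (n : E3) : Fin 3 → Poly2 :=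
  crossP2 (F.traceP u - F.tanP w) n

theorem evv2_traceP (u : Fin 3 → Poly3) (y : E2) : evv2 (F.traceP u) y = vev u (F.point y) := by
  ext a; simp [evv2, traceP, F.ev2_restr, vev]

theorem evv2_tanP (w : Fin 2 → Poly2) (y : E2) : evv2 (F.tanP w) y = F.tanField w y := by
  ext a; simp [evv2, tanP, tanField, ev2]

theorem vev_liftV (w : Fin 3 → Poly2) (y : E2) : vev (F.liftV w) (F.point y) = evv2 w y := by
  ext a; simp [evv2, liftV, F.ev3_lift_point, vev]

theorem evv2_tangentialJump (u : Fin 3 → Poly3) (w : Fin 2 → Poly2) (n : E3) (y : E2) :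
    evv2 (F.tangentialJump u w n) y = cross (vev u (F.point y)) n - cross (F.tanField w y) n := by
  rw [tangentialJump, evv2_crossP2, evv2_sub, cross_sub_left, evv2_traceP, evv2_tanP]

theorem totalDegree_tangentialJump_le {u : Fin 3 → Poly3} {w : Fin 2 → Poly2} {r : ℕ}
    (hu : ∀ a, (u a).totalDegree ≤ r) (hw : ∀ a, (w a).totalDegree ≤ r) (n : E3) (a : Fin 3) :
    (F.tangentialJump u w n a).totalDegree ≤ r := by
  refine totalDegree_crossP2_le (fun b => ?_) n a
  refine (MvPolynomial.totalDegree_sub _ _).trans (max_le ?_ ?_)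
  · exact (F.totalDegree_restr_le _).trans (hu b)
  · exact (MvPolynomial.totalDegree_add _ _).trans
      (max_le ((totalDegree_mul_C_le _ _).trans (hw 0)) ((totalDegree_mul_C_le _ _).trans (hw 1)))

theorem integral_sub {f g : E2 → ℝ} (hf : Continuous f) (hg : Continuous g) :
    (F.integral fun y => f y - g y) = F.integral f - F.integral g :=
  MeasureTheory.integral_sub (integrableOn_region _ hf) (integrableOn_region _ hg)

theorem integral_add {f g : E2 → ℝ} (hf : Continuous f) (hg : Continuous g) :
    (F.integral fun y => f y + g y) = F.integral f + F.integral g :=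
  MeasureTheory.integral_add (integrableOn_region _ hf) (integrableOn_region _ hg)

theorem integral_const_mul (c : ℝ) (f : E2 → ℝ) :
    (F.integral fun y => c * f y) = c * F.integral f :=
  MeasureTheory.integral_const_mul _ _

theorem integral_neg (f : E2 → ℝ) : (F.integral fun y => -f y) = -F.integral f :=
  MeasureTheory.integral_neg _

end Face

theorem innerV_zero_left (T : Set E3) (q : Fin 3 → Poly3) : innerV T 0 q = 0 := by
  simp [innerV, vev_zero]

theorem PolyVec.toField_zero {r : ℕ} : (0 : PolyVec r).toField = 0 := rfl

namespace Mesh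

variable {Ω : Set E3} {ι κ : Type*} (M : Mesh Ω ι κ)

/-! ### Integration by parts on an element -/

theorem innerV_eq (i : ι) (p q : Fin 3 → Poly3) :
    innerV (M.body i) p q = ∫ x in M.body i, ev3 (∑ a, p a * q a) x := by
  simp only [innerV, inner_vev]

theorem integrableOn_ev3 (i : ι) (p : Poly3) : IntegrableOn (ev3 p) (M.body i) :=
  integrableOn_bounded (M.isBounded_body i) (continuous_ev3 p)

theorem innerV_gradP_add (i : ι) (p : Poly3) (q : Fin 3 → Poly3) :
    innerV (M.body i) (gradP p) q + innerS (M.body i) p (divP q) =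
      ∑ F ∈ M.faces i, (M.face F).integral fun y =>
        ev3 p ((M.face F).point y) * ⟪vev q ((M.face F).point y), M.normal i F⟫ := by
  have h := M.setIntegral_body_divP i fun a => p * q a
  rw [divP_mul] at h
  simp only [ev3_add, vev_mul, real_inner_smul_left] at h
  rw [integral_add (M.integrableOn_ev3 i _) (M.integrableOn_ev3 i _)] at h
  rw [innerV_eq, ← h]
  simp only [innerS, ev3_mul]

theorem innerV_curlP_sub (i : ι) (p q : Fin 3 → Poly3) :
    innerV (M.body i) (curlP p) q - innerV (M.body i) p (curlP q) =
      -∑ F ∈ M.faces i, (M.face F).integral fun y =>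
        ⟪cross (vev p ((M.face F).point y)) (M.normal i F), vev q ((M.face F).point y)⟫ := by
  have h := M.setIntegral_body_divP i (crossProduct p q)
  rw [divP_crossProduct] at h
  simp only [ev3_sub, vev_crossProduct] at h
  rw [integral_sub (M.integrableOn_ev3 i _) (M.integrableOn_ev3 i _)] at h
  rw [innerV_eq, innerV_eq, h, ← Finset.sum_neg_distrib]
  refine Finset.sum_congr rfl fun F _ => ?_
  rw [← Face.integral_neg]
  exact (M.face F).integral_congr fun y _ => inner_cross_left _ _ _

theorem innerV_curlP_curlP (i : ι) (p q : Fin 3 → Poly3) :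
    innerV (M.body i) p (curlP (curlP q)) = innerV (M.body i) (curlP (curlP p)) q +
      (∑ F ∈ M.faces i, (M.face F).integral fun y =>
        ⟪cross (vev p ((M.face F).point y)) (M.normal i F),
          vev (curlP q) ((M.face F).point y)⟫) +
      ∑ F ∈ M.faces i, (M.face F).integral fun y =>
        ⟪cross (vev (curlP p) ((M.face F).point y)) (M.normal i F),
          vev q ((M.face F).point y)⟫ := by
  have h1 := M.innerV_curlP_sub i p (curlP q)
  have h2 := M.innerV_curlP_sub i (curlP p) q
  linarith

/-- Undoing the integration by parts separates the classical gradient from the jumps on single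
faces, which is the form in which bubbles can isolate each term. -/
theorem weakGrad_spec_jump (i : ι) (r : ℕ) (σ : ScalarWeak ι κ) (ψ : PolyVec r) :
    innerV (M.body i) (M.weakGrad i r σ).toField ψ.toField =
      innerV (M.body i) (gradP (σ.1 i)) ψ.toField +
        ∑ F ∈ M.faces i, (M.face F).integral fun y =>
          ev2 (σ.2 F - (M.face F).restr (σ.1 i)) y *
            ⟪vev ψ.toField ((M.face F).point y), M.normal i F⟫ := by
  have h := M.innerV_gradP_add i (σ.1 i) ψ.toField
  have hc : ∀ F, Continuous fun y => ⟪vev ψ.toField ((M.face F).point y), M.normal i F⟫ :=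
    fun F => ((continuous_vev _).comp (continuous_point _)).inner continuous_const
  have hs : ∀ F, ((M.face F).integral fun y => ev2 (σ.2 F - (M.face F).restr (σ.1 i)) y *
      ⟪vev ψ.toField ((M.face F).point y), M.normal i F⟫) =
      ((M.face F).integral fun y => ev2 (σ.2 F) y *
        ⟪vev ψ.toField ((M.face F).point y), M.normal i F⟫) -
      (M.face F).integral fun y => ev3 (σ.1 i) ((M.face F).point y) *
        ⟪vev ψ.toField ((M.face F).point y), M.normal i F⟫ := by
    intro F
    refine Eq.trans ?_ (Face.integral_sub _ ((continuous_ev2 _).mul (hc F))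
      (((continuous_ev3 _).comp (continuous_point _)).mul (hc F)))
    refine Face.integral_congr _ fun y _ => ?_
    simp only [ev2_sub, Face.ev2_restr, sub_mul]
  rw [M.weakGrad_spec, Finset.sum_congr rfl fun F _ => hs F, Finset.sum_sub_distrib, ← h]
  ring

theorem weakCurlCurl_spec_jump (i : ι) (r : ℕ) (v : VectorWeak ι κ) (q : PolyVec r) :
    innerV (M.body i) (M.weakCurlCurl i r v).toField q.toField =
      innerV (M.body i) (curlP (curlP (v.1 i))) q.toField +
        ((∑ F ∈ M.faces i, (M.face F).integral fun y =>
          ⟪evv2 ((M.face F).tangentialJump (v.1 i) (v.2.1 F) (M.normal i F)) y,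
            vev (curlP q.toField) ((M.face F).point y)⟫) +
        ∑ F ∈ M.faces i, (M.face F).integral fun y =>
          ⟪evv2 ((M.face F).tangentialJump (curlP (v.1 i)) (v.2.2 F) (M.normal i F)) y,
            vev q.toField ((M.face F).point y)⟫) := by
  have hs : ∀ (u : Fin 3 → Poly3) (w : Fin 2 → Poly2) (f : Fin 3 → Poly3) (F : κ),
      ((M.face F).integral fun y => ⟪evv2 ((M.face F).tangentialJump u w (M.normal i F)) y,
        vev f ((M.face F).point y)⟫) =
      ((M.face F).integral fun y => ⟪cross (vev u ((M.face F).point y)) (M.normal i F),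
        vev f ((M.face F).point y)⟫) -
      (M.face F).integral fun y => ⟪cross ((M.face F).tanField w y) (M.normal i F),
        vev f ((M.face F).point y)⟫ := by
    intro u w f F
    have hf : Continuous fun y => vev f ((M.face F).point y) :=
      (continuous_vev _).comp (continuous_point _)
    refine Eq.trans ?_ (Face.integral_sub _
      ((continuous_cross ((continuous_vev _).comp (continuous_point _)) continuous_const).inner hf)
      ((continuous_cross (continuous_tanField _ _) continuous_const).inner hf))
    refine Face.integral_congr _ fun y _ => ?_
    simp only [Face.evv2_tangentialJump, inner_sub_left]
  simp only [hs, Finset.sum_sub_distrib]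
  rw [M.weakCurlCurl_spec, M.innerV_curlP_curlP]
  ring

/-! ### Bubble functions -/

/-- The linear polynomial that vanishes on the plane of a face and has the outward normal as its
gradient. -/
def faceP (i : ι) (F : κ) : Poly3 := linP (M.face F).base (M.normal i F)

/-- The product of the squares of the linear polynomials of some faces. -/
def bubble (i : ι) (S : Finset κ) : Poly3 := ∏ F ∈ S, M.faceP i F ^ 2

variable {M} {i : ι} {F G : κ} {S : Finset κ}

theorem ev3_faceP_point (hF : F ∈ M.faces i) (y : E2) :
    ev3 (M.faceP i F) ((M.face F).point y) = 0 := by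
  rw [faceP, ev3_linP]
  exact (M.isUnitNormal hF).inner_point_sub_base y

theorem ev3_bubble_nonneg (x : E3) : 0 ≤ ev3 (M.bubble i S) x := by
  rw [bubble, ev3_prod]
  refine Finset.prod_nonneg fun F _ => ?_
  rw [ev3_pow]
  exact sq_nonneg _

theorem totalDegree_bubble_le : (M.bubble i S).totalDegree ≤ 2 * S.card := by
  refine (MvPolynomial.totalDegree_finsetProd _ _).trans ?_
  rw [mul_comm, ← smul_eq_mul]
  refine Finset.sum_le_card_nsmul _ _ _ fun F _ => ?_
  refine (MvPolynomial.totalDegree_pow _ _).trans ?_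
  have := totalDegree_linP_le (M.face F).base (M.normal i F)
  rw [faceP]
  omega

theorem sq_dvd_bubble (hF : F ∈ S) : M.faceP i F ^ 2 ∣ M.bubble i S :=
  Finset.dvd_prod_of_mem _ hF

theorem faceP_ne_zero (hF : F ∈ M.faces i) : M.faceP i F ≠ 0 := by
  intro h
  have h1 := vev_gradP_linP (M.face F).base (M.normal i F) 0
  rw [← faceP, h] at h1
  refine (M.isUnitNormal hF).ne_zero (h1.symm.trans ?_)
  ext a
  simp [vev, gradP, ev3]

theorem bubble_ne_zero (hS : S ⊆ M.faces i) : M.bubble i S ≠ 0 :=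
  Finset.prod_ne_zero_iff.2 fun _ hF => pow_ne_zero _ (faceP_ne_zero (hS hF))

theorem restr_faceP_ne_zero (hF : F ∈ M.faces i) (hG : G ∈ M.faces i) (hFG : F ≠ G) :
    (M.face F).restr (M.faceP i G) ≠ 0 :=
  Face.restr_linP_ne_zero (M.isUnitNormal hF) (M.isUnitNormal hG) (M.plane_ne i F hF G hG hFG)

theorem restr_bubble_ne_zero (hF : F ∈ M.faces i) (hS : S ⊆ M.faces i) (hFS : F ∉ S) :
    (M.face F).restr (M.bubble i S) ≠ 0 := by
  rw [bubble, map_prod]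
  refine Finset.prod_ne_zero_iff.2 fun G hG => ?_
  rw [map_pow]
  refine pow_ne_zero _ (restr_faceP_ne_zero hF (hS hG) ?_)
  rintro rfl
  exact hFS hG

/-- The bubble is non-negative on all of space, so the integrand is zero on an open set, hence zero
as a polynomial, and the non-zero bubble can be cancelled. -/
theorem eq_zero_of_innerV_bubble_mul {p : Fin 3 → Poly3}
    (h : innerV (M.body i) p (fun a => M.bubble i (M.faces i) * p a) = 0) : p = 0 := by
  rw [innerV_eq] at h
  have he : ∑ a, p a * (M.bubble i (M.faces i) * p a) =
      M.bubble i (M.faces i) * ∑ a, p a ^ 2 := by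
    rw [Finset.mul_sum]
    exact Finset.sum_congr rfl fun a _ => by ring
  rw [he] at h
  have h0 := eq_zero_of_setIntegral_eq_zero (M.isOpen_body i) (M.nonempty_body i) Subset.rfl
    (M.isOpen_body i).measurableSet (M.isBounded_body i) (fun x _ => ?_) h
  · exact eq_zero_of_sum_sq_eq_zero ((mul_eq_zero.1 h0).resolve_left (bubble_ne_zero Subset.rfl))
  · change 0 ≤ ev3 _ x
    rw [ev3_mul, ev3_sum]
    refine mul_nonneg (ev3_bubble_nonneg x) (Finset.sum_nonneg fun a _ => ?_)
    rw [ev3_pow]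
    exact sq_nonneg _

/-! ### The kernel of the weak gradient on an element -/

/-- The test field is the full bubble times the gradient. It vanishes on all faces, and its degree
`2N + (k - 1)` is exactly what the assumption allows. -/
theorem gradP_eq_zero_of_weakGrad_eq_zero {k r : ℕ} (hk : 1 ≤ k)
    (hr : 2 * (M.faces i).card + k - 1 ≤ r) {σ : ScalarWeak ι κ} (hσ : (σ.1 i).totalDegree ≤ k)
    (h : M.weakGrad i r σ = 0) : gradP (σ.1 i) = 0 := by
  have hdeg : ∀ a, (M.bubble i (M.faces i) * gradP (σ.1 i) a).totalDegree ≤ r := by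
    intro a
    have h1 := MvPolynomial.totalDegree_mul (M.bubble i (M.faces i)) (gradP (σ.1 i) a)
    have h2 := totalDegree_bubble_le (M := M) (i := i) (S := M.faces i)
    have h3 := totalDegree_pderiv_le a (σ.1 i)
    rw [gradP] at h1 ⊢
    omega
  have hs := M.weakGrad_spec_jump i r σ (PolyVec.ofField _ hdeg)
  rw [h, PolyVec.toField_zero, innerV_zero_left, PolyVec.toField_ofField,
    Finset.sum_eq_zero, add_zero] at hs
  · exact eq_zero_of_innerV_bubble_mul hs.symm
  · intro F hF
    refine Face.integral_eq_zero _ fun y _ => ?_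
    rw [vev_mul, ev3_eq_zero_of_sq_dvd (sq_dvd_bubble hF) (ev3_faceP_point hF y)]
    simp

/-- With the gradient gone only jumps remain. The bubble of the other faces times the normal field
with the jump `δ`, extended constantly along the normal, sees `F` alone and produces a weighted
integral of `δ²`. -/
theorem eq_restr_of_weakGrad_eq_zero {k r : ℕ} (hk : 1 ≤ k)
    (hr : 2 * (M.faces i).card + k - 1 ≤ r) {σ : ScalarWeak ι κ} (hσ : (σ.1 i).totalDegree ≤ k)
    (hσb : ∀ F, (σ.2 F).totalDegree ≤ k) (h : M.weakGrad i r σ = 0) (hF : F ∈ M.faces i) :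
    σ.2 F = (M.face F).restr (σ.1 i) := by
  classical
  set δ := σ.2 F - (M.face F).restr (σ.1 i) with hδ
  have hδdeg : δ.totalDegree ≤ k := (MvPolynomial.totalDegree_sub _ _).trans
    (max_le (hσb F) (((M.face F).totalDegree_restr_le _).trans hσ))
  let B := M.bubble i ((M.faces i).erase F)
  have hcard := Finset.card_erase_add_one hF
  have hdeg : ∀ a, (B * ((M.face F).lift δ * MvPolynomial.C (M.normal i F a))).totalDegree ≤ r := by
    intro a
    have h1 := MvPolynomial.totalDegree_mul B ((M.face F).lift δ * MvPolynomial.C (M.normal i F a))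
    have h2 := totalDegree_bubble_le (M := M) (i := i) (S := (M.faces i).erase F)
    have h3 := totalDegree_mul_C_le ((M.face F).lift δ) (M.normal i F a)
    have h4 := (M.face F).totalDegree_lift_le δ
    simp only [B] at h1 ⊢
    omega
  have hs := M.weakGrad_spec_jump i r σ (PolyVec.ofField _ hdeg)
  rw [h, PolyVec.toField_zero, innerV_zero_left, PolyVec.toField_ofField,
    gradP_eq_zero_of_weakGrad_eq_zero hk hr hσ h, innerV_zero_left, zero_add,
    Finset.sum_eq_single F] at hs
  · have hz : (fun _ => δ : Fin 1 → Poly2) = 0 := by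
      refine (M.face F).eq_zero_of_integral_weight
        (restr_bubble_ne_zero hF ((M.faces i).erase_subset F) (Finset.notMem_erase _ _))
        (fun y _ => ?_) (Eq.trans ?_ hs.symm)
      · rw [Face.ev2_restr]
        exact ev3_bubble_nonneg _
      · refine Face.integral_congr _ fun y _ => ?_
        have hv : vev (fun a => (M.face F).lift δ * MvPolynomial.C (M.normal i F a))
            ((M.face F).point y) = ev2 δ y • M.normal i F := by
          ext a
          simp [vev, ev3_mul, Face.ev3_lift_point, ev3_C]
        have := (M.isUnitNormal hF).inner_self
        rw [vev_mul, hv, real_inner_smul_left, real_inner_smul_left, this, Face.ev2_restr,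
          Fin.sum_univ_one, ← hδ]
        simp only [B]
        ring
    exact sub_eq_zero.1 (congrFun hz 0)
  · intro G hG hGF
    refine Face.integral_eq_zero _ fun y _ => ?_
    rw [vev_mul, ev3_eq_zero_of_sq_dvd (sq_dvd_bubble (Finset.mem_erase.2 ⟨hGF, hG⟩))
      (ev3_faceP_point hG y)]
    simp
  · exact fun hn => absurd hF hn

/-! ### The kernel of the weak curl-curl on an element -/

/-- The test field is the full bubble times the curl-curl, of degree `2N + (k - 2)`; neither it nor
its curl has a trace on a face. -/
theorem curlCurl_eq_zero_of_weakCurlCurl_eq_zero {k r : ℕ} (hk : 2 ≤ k)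
    (hr : 2 * (M.faces i).card + k - 2 ≤ r) {v : VectorWeak ι κ}
    (hv : ∀ a, (v.1 i a).totalDegree ≤ k) (h : M.weakCurlCurl i r v = 0) :
    curlP (curlP (v.1 i)) = 0 := by
  have hdeg : ∀ a, (M.bubble i (M.faces i) * curlP (curlP (v.1 i)) a).totalDegree ≤ r := by
    intro a
    have h1 := MvPolynomial.totalDegree_mul (M.bubble i (M.faces i)) (curlP (curlP (v.1 i)) a)
    have h2 := totalDegree_bubble_le (M := M) (i := i) (S := M.faces i)
    have h3 := totalDegree_curlP_le (totalDegree_curlP_le hv) a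
    omega
  have hs := M.weakCurlCurl_spec_jump i r v (PolyVec.ofField _ hdeg)
  rw [h, PolyVec.toField_zero, innerV_zero_left, PolyVec.toField_ofField,
    Finset.sum_eq_zero, Finset.sum_eq_zero, add_zero, add_zero] at hs
  · exact eq_zero_of_innerV_bubble_mul hs.symm
  · intro F hF
    refine Face.integral_eq_zero _ fun y _ => ?_
    rw [vev_mul, ev3_eq_zero_of_sq_dvd (sq_dvd_bubble hF) (ev3_faceP_point hF y)]
    simp
  · intro F hF
    refine Face.integral_eq_zero _ fun y _ => ?_
    rw [vev_curlP_mul, ev3_eq_zero_of_sq_dvd (sq_dvd_bubble hF) (ev3_faceP_point hF y),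
      vev_gradP_eq_zero_of_sq_dvd (sq_dvd_bubble hF) (ev3_faceP_point hF y), cross_zero_left]
    simp

variable (M) in
/-- The face fields `α`, `β` annihilate the pairs of traces of `∇ × q` and `q` for all polynomial
fields `q` of degree at most `r`. -/
def Annihilates (i : ι) (r : ℕ) (α β : κ → Fin 3 → Poly2) : Prop :=
  ∀ q : Fin 3 → Poly3, (∀ a, (q a).totalDegree ≤ r) →
    (∑ F ∈ M.faces i, (M.face F).integral fun y =>
      ⟪evv2 (α F) y, vev (curlP q) ((M.face F).point y)⟫) +
    (∑ F ∈ M.faces i, (M.face F).integral fun y =>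
      ⟪evv2 (β F) y, vev q ((M.face F).point y)⟫) = 0

theorem annihilates_of_weakCurlCurl_eq_zero {k r : ℕ} (hk : 2 ≤ k)
    (hr : 2 * (M.faces i).card + k - 2 ≤ r) {v : VectorWeak ι κ}
    (hv : ∀ a, (v.1 i a).totalDegree ≤ k) (h : M.weakCurlCurl i r v = 0) :
    M.Annihilates i r (fun F => (M.face F).tangentialJump (v.1 i) (v.2.1 F) (M.normal i F))
      fun F => (M.face F).tangentialJump (curlP (v.1 i)) (v.2.2 F) (M.normal i F) := by
  intro q hq
  have hs := M.weakCurlCurl_spec_jump i r v (PolyVec.ofField q hq)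
  rw [h, PolyVec.toField_zero, innerV_zero_left, PolyVec.toField_ofField,
    curlCurl_eq_zero_of_weakCurlCurl_eq_zero hk hr hv h, innerV_zero_left, zero_add] at hs
  exact hs.symm

variable {r k : ℕ} {α β : κ → Fin 3 → Poly2}

theorem Annihilates.integral_add_eq_zero (h : M.Annihilates i r α β) (hF : F ∈ M.faces i)
    {q : Fin 3 → Poly3} (hq : ∀ a, (q a).totalDegree ≤ r)
    (h0 : ∀ G ∈ M.faces i, G ≠ F → ∀ y,
      ⟪evv2 (α G) y, vev (curlP q) ((M.face G).point y)⟫ = 0 ∧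
      ⟪evv2 (β G) y, vev q ((M.face G).point y)⟫ = 0) :
    ((M.face F).integral fun y => ⟪evv2 (α F) y, vev (curlP q) ((M.face F).point y)⟫) +
      ((M.face F).integral fun y => ⟪evv2 (β F) y, vev q ((M.face F).point y)⟫) = 0 := by
  have := h q hq
  rw [Finset.sum_eq_single F, Finset.sum_eq_single F] at this
  · exact this
  · exact fun G hG hGF => Face.integral_eq_zero _ fun y _ => (h0 G hG hGF y).2
  · exact fun hn => absurd hF hn
  · exact fun G hG hGF => Face.integral_eq_zero _ fun y _ => (h0 G hG hGF y).1
  · exact fun hn => absurd hF hn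

theorem Annihilates.integral_left_eq_zero (h : M.Annihilates i r α β) (hF : F ∈ M.faces i)
    {q : Fin 3 → Poly3} (hq : ∀ a, (q a).totalDegree ≤ r)
    (h0 : ∀ G ∈ M.faces i, G ≠ F → ∀ y,
      ⟪evv2 (α G) y, vev (curlP q) ((M.face G).point y)⟫ = 0 ∧
      ⟪evv2 (β G) y, vev q ((M.face G).point y)⟫ = 0)
    (h1 : ∀ y, ⟪evv2 (β F) y, vev q ((M.face F).point y)⟫ = 0) :
    ((M.face F).integral fun y => ⟪evv2 (α F) y, vev (curlP q) ((M.face F).point y)⟫) = 0 := by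
  have := h.integral_add_eq_zero hF hq h0
  rwa [Face.integral_eq_zero _ fun y _ => h1 y, add_zero] at this

theorem Annihilates.integral_right_eq_zero (h : M.Annihilates i r α β) (hF : F ∈ M.faces i)
    {q : Fin 3 → Poly3} (hq : ∀ a, (q a).totalDegree ≤ r)
    (h0 : ∀ G ∈ M.faces i, G ≠ F → ∀ y,
      ⟪evv2 (α G) y, vev (curlP q) ((M.face G).point y)⟫ = 0 ∧
      ⟪evv2 (β G) y, vev q ((M.face G).point y)⟫ = 0)
    (h1 : ∀ y, ⟪evv2 (α F) y, vev (curlP q) ((M.face F).point y)⟫ = 0) :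
    ((M.face F).integral fun y => ⟪evv2 (β F) y, vev q ((M.face F).point y)⟫) = 0 := by
  have := h.integral_add_eq_zero hF hq h0
  rwa [Face.integral_eq_zero _ fun y _ => h1 y, zero_add] at this

/-- On the plane of `F` only the derivative of the linear factor survives, and its gradient is the
normal. Such fields have zero trace but a prescribable tangential curl. -/
theorem vev_curlP_faceP_mul (hF : F ∈ M.faces i) (p : Poly3) (w : Fin 3 → Poly3) (y : E2) :
    vev (curlP fun a => M.faceP i F * p * w a) ((M.face F).point y) =
      ev3 p ((M.face F).point y) •
        cross (M.normal i F) (vev w ((M.face F).point y)) := by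
  rw [vev_curlP_mul, vev_gradP_mul, ev3_mul, ev3_faceP_point hF]
  simp [faceP, vev_gradP_linP, cross_smul_left]

open Classical in
-- The test field is `λ_F` times a bubble times the extension of `α × n`. On `F` it vanishes, and
-- its curl is the bubble times `n × (α × n) = α`, as `α` is tangential. The set `S` collects faces
-- that are already settled and therefore need no factor in the bubble.
theorem Annihilates.left_eq_zero (h : M.Annihilates i r α β) (hF : F ∈ M.faces i)
    (hS : ∀ G ∈ S, α G = 0 ∧ β G = 0) (hα : ∀ a, (α F a).totalDegree ≤ k)
    (hαn : ∀ y, ⟪evv2 (α F) y, M.normal i F⟫ = 0)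
    (hr : 1 + 2 * ((M.faces i \ S).erase F).card + k ≤ r) : α F = 0 := by
  set n := M.normal i F with hn
  set D := (M.faces i \ S).erase F with hD
  have hdeg : ∀ a, (M.faceP i F * M.bubble i D *
      (M.face F).liftV (crossP2 (α F) n) a).totalDegree ≤ r := by
    intro a
    have h1 := MvPolynomial.totalDegree_mul (M.faceP i F * M.bubble i D)
      ((M.face F).liftV (crossP2 (α F) n) a)
    have h2 := MvPolynomial.totalDegree_mul (M.faceP i F) (M.bubble i D)
    have h3 := totalDegree_bubble_le (M := M) (i := i) (S := D)
    have h4 : (M.faceP i F).totalDegree ≤ 1 := totalDegree_linP_le _ _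
    have h5 := (M.face F).totalDegree_lift_le (crossP2 (α F) n a)
    have h6 := totalDegree_crossP2_le hα n a
    rw [Face.liftV] at h1 ⊢
    omega
  have key := h.integral_left_eq_zero hF hdeg (fun G hG hGF y => ?_) fun y => ?_
  · refine (M.face F).eq_zero_of_integral_weight (w := (M.face F).restr (M.bubble i D))
      (restr_bubble_ne_zero hF ((Finset.erase_subset _ _).trans Finset.sdiff_subset)
        (Finset.notMem_erase _ _)) (fun y _ => ?_) (Eq.trans ?_ key)
    · rw [Face.ev2_restr]
      exact ev3_bubble_nonneg _
    · refine Face.integral_congr _ fun y _ => ?_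
      have hnn := (M.isUnitNormal hF).inner_self
      rw [vev_curlP_faceP_mul hF, Face.vev_liftV, evv2_crossP2, ← hn, cross_cross_normal, hαn,
        hnn, one_smul, zero_smul, sub_zero, real_inner_smul_right, inner_evv2_self,
        Face.ev2_restr]
  · by_cases hGS : G ∈ S
    · rw [(hS G hGS).1, (hS G hGS).2, evv2_zero, inner_zero_left, inner_zero_left]
      exact ⟨rfl, rfl⟩
    · have hdvd : M.faceP i G ^ 2 ∣ M.faceP i F * M.bubble i D :=
        (sq_dvd_bubble (Finset.mem_erase.2 ⟨hGF, Finset.mem_sdiff.2 ⟨hG, hGS⟩⟩)).mul_left _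
      rw [vev_curlP_mul, vev_mul, ev3_eq_zero_of_sq_dvd hdvd (ev3_faceP_point hG y),
        vev_gradP_eq_zero_of_sq_dvd hdvd (ev3_faceP_point hG y), cross_zero_left]
      simp
  · rw [vev_mul, ev3_mul, ev3_faceP_point hF]
    simp

open Classical in
-- Once `α` is zero on `F`, the curl of the test field is free there, so the bubble times the
-- extension of `β` suffices, without the factor `λ_F`.
theorem Annihilates.right_eq_zero (h : M.Annihilates i r α β) (hF : F ∈ M.faces i)
    (hS : ∀ G ∈ S, α G = 0 ∧ β G = 0) (hβ : ∀ a, (β F a).totalDegree ≤ k)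
    (hα : α F = 0) (hr : 2 * ((M.faces i \ S).erase F).card + k ≤ r) : β F = 0 := by
  set D := (M.faces i \ S).erase F with hD
  have hdeg : ∀ a, (M.bubble i D * (M.face F).liftV (β F) a).totalDegree ≤ r := by
    intro a
    have h1 := MvPolynomial.totalDegree_mul (M.bubble i D) ((M.face F).liftV (β F) a)
    have h3 := totalDegree_bubble_le (M := M) (i := i) (S := D)
    have h5 := (M.face F).totalDegree_lift_le (β F a)
    have h6 := hβ a
    rw [Face.liftV] at h1 ⊢
    omega
  have key := h.integral_right_eq_zero hF hdeg (fun G hG hGF y => ?_) fun y => ?_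
  · refine (M.face F).eq_zero_of_integral_weight (w := (M.face F).restr (M.bubble i D))
      (restr_bubble_ne_zero hF ((Finset.erase_subset _ _).trans Finset.sdiff_subset)
        (Finset.notMem_erase _ _)) (fun y _ => ?_) (Eq.trans ?_ key)
    · rw [Face.ev2_restr]
      exact ev3_bubble_nonneg _
    · refine Face.integral_congr _ fun y _ => ?_
      rw [vev_mul, Face.vev_liftV, real_inner_smul_right, inner_evv2_self, Face.ev2_restr]
  · by_cases hGS : G ∈ S
    · rw [(hS G hGS).1, (hS G hGS).2, evv2_zero, inner_zero_left, inner_zero_left]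
      exact ⟨rfl, rfl⟩
    · have hdvd : M.faceP i G ^ 2 ∣ M.bubble i D :=
        sq_dvd_bubble (Finset.mem_erase.2 ⟨hGF, Finset.mem_sdiff.2 ⟨hG, hGS⟩⟩)
      rw [vev_curlP_mul, vev_mul, ev3_eq_zero_of_sq_dvd hdvd (ev3_faceP_point hG y),
        vev_gradP_eq_zero_of_sq_dvd hdvd (ev3_faceP_point hG y), cross_zero_left]
      simp
  · rw [hα, evv2_zero, inner_zero_left]

open Classical in
-- The square for `G` is replaced by the single factor `λ_G`, which saves the missing degree: `1 + 1
-- + 2(N-2) + k = 2N + k - 2`. Directing the test field along the normal `m` of `G` keeps the face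
-- `G` silent. On `F` the pairing is `λ_G` times the bubble times the square of `⟪α, n × m⟫`, and
-- `λ_G` has one sign on `F` by assumption.
theorem Annihilates.inner_cross_eq_zero (h : M.Annihilates i r α β) (hF : F ∈ M.faces i)
    (hG : G ∈ M.faces i) (hFG : F ≠ G) (hside : M.OneSided i F G)
    (hα : ∀ a, (α F a).totalDegree ≤ k) (hr : 2 * (M.faces i).card + k - 2 ≤ r) (y : E2) :
    ⟪evv2 (α F) y, cross (M.normal i F) (M.normal i G)⟫ = 0 := by
  set n := M.normal i F with hn
  set m := M.normal i G with hm
  set D := ((M.faces i).erase F).erase G with hD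
  set γ := ∑ a, α F a * MvPolynomial.C (cross n m a) with hγ
  have hγdeg : γ.totalDegree ≤ k := MvPolynomial.totalDegree_finsetSum_le fun a _ =>
    (totalDegree_mul_C_le _ _).trans (hα a)
  have hγev : ∀ y, ⟪evv2 (α F) y, cross n m⟫ = ev2 γ y := fun y => inner_evv2_left _ _ _
  suffices hγ0 : γ = 0 by
    rw [hγev, hγ0]
    simp [ev2]
  have hGF : G ∈ (M.faces i).erase F := Finset.mem_erase.2 ⟨Ne.symm hFG, hG⟩
  have hcard1 := Finset.card_erase_add_one hF
  have hcard2 := Finset.card_erase_add_one hGF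
  rw [← hD] at hcard2
  let w : Fin 3 → Poly3 := fun a => (M.face F).lift γ * MvPolynomial.C (m a)
  have hw : ∀ x, vev w x = ev3 ((M.face F).lift γ) x • m := by
    intro x
    ext a
    simp [vev, w, ev3_mul, ev3_C]
  have hwdeg : ∀ a, (w a).totalDegree ≤ k := fun a => (totalDegree_mul_C_le _ _).trans
    (((M.face F).totalDegree_lift_le γ).trans hγdeg)
  clear_value w
  have hdeg : ∀ a, (M.faceP i F * (M.faceP i G * M.bubble i D) * w a).totalDegree ≤ r := by
    intro a
    have h1 := MvPolynomial.totalDegree_mul (M.faceP i F * (M.faceP i G * M.bubble i D)) (w a)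
    have h2 := MvPolynomial.totalDegree_mul (M.faceP i F) (M.faceP i G * M.bubble i D)
    have h3 := MvPolynomial.totalDegree_mul (M.faceP i G) (M.bubble i D)
    have h4 := totalDegree_bubble_le (M := M) (i := i) (S := D)
    have h5 : (M.faceP i F).totalDegree ≤ 1 := totalDegree_linP_le _ _
    have h6 : (M.faceP i G).totalDegree ≤ 1 := totalDegree_linP_le _ _
    have h7 := hwdeg a
    omega
  have key := h.integral_left_eq_zero hF hdeg (fun H hH hHF y => ?_) fun y => ?_
  · have hval : ∀ y, ⟪evv2 (α F) y, vev (curlP fun a =>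
        M.faceP i F * (M.faceP i G * M.bubble i D) * w a) ((M.face F).point y)⟫ =
        ev2 ((M.face F).restr (M.faceP i G * M.bubble i D)) y * ev2 γ y ^ 2 := by
      intro y
      rw [vev_curlP_faceP_mul hF, hw, Face.ev3_lift_point, cross_smul_right, ← hn,
        real_inner_smul_right, real_inner_smul_right, hγev, Face.ev2_restr]
      ring
    have hne : (M.face F).restr (M.faceP i G * M.bubble i D) ≠ 0 := by
      rw [map_mul]
      exact mul_ne_zero (restr_faceP_ne_zero hF hG hFG)
        (restr_bubble_ne_zero hF ((Finset.erase_subset _ _).trans (Finset.erase_subset _ _))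
          fun hFD => Finset.notMem_erase _ _ (Finset.mem_of_mem_erase hFD))
    simp only [hval] at key
    have hsign : ∀ y, ev2 ((M.face F).restr (M.faceP i G * M.bubble i D)) y =
        ⟪(M.face F).point y - (M.face G).base, m⟫ * ev3 (M.bubble i D) ((M.face F).point y) := by
      intro y
      rw [Face.ev2_restr, ev3_mul, faceP, ev3_linP]
    have hz : (fun _ => γ : Fin 1 → Poly2) = 0 := by
      rcases hside with hs | hs
      · refine (M.face F).eq_zero_of_integral_weight (neg_ne_zero.2 hne) (fun y hy => ?_) ?_
        · have h1 : ev2 (-(M.face F).restr (M.faceP i G * M.bubble i D)) y =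
              -ev2 ((M.face F).restr (M.faceP i G * M.bubble i D)) y := by simp [ev2]
          rw [h1, hsign, ← neg_mul]
          exact mul_nonneg (neg_nonneg.2 (hs _ ⟨y, hy, rfl⟩)) (ev3_bubble_nonneg _)
        · rw [← neg_eq_zero, ← Face.integral_neg]
          refine Eq.trans (Face.integral_congr _ fun y _ => ?_) key
          simp [ev2]
      · refine (M.face F).eq_zero_of_integral_weight hne (fun y hy => ?_) ?_
        · rw [hsign]
          exact mul_nonneg (hs _ ⟨y, hy, rfl⟩) (ev3_bubble_nonneg _)
        · refine Eq.trans (Face.integral_congr _ fun y _ => ?_) key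
          rw [Fin.sum_univ_one]
    exact congrFun hz 0
  · by_cases hHG : H = G
    · subst hHG
      -- On `G` the simple zero removes only the field itself; its curl is a multiple of `m × m`.
      constructor
      · rw [mul_left_comm, vev_curlP_faceP_mul hH, hw, cross_smul_right, ← hm, cross_self_eq_zero]
        simp
      · rw [vev_mul, ev3_mul, ev3_mul, ev3_faceP_point hH]
        simp
    · have hdvd : M.faceP i H ^ 2 ∣ M.faceP i F * (M.faceP i G * M.bubble i D) :=
        ((sq_dvd_bubble (Finset.mem_erase.2 ⟨hHG, Finset.mem_erase.2 ⟨hHF, hH⟩⟩)).mul_left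
          _).mul_left _
      rw [vev_curlP_mul, vev_mul, ev3_eq_zero_of_sq_dvd hdvd (ev3_faceP_point hH y),
        vev_gradP_eq_zero_of_sq_dvd hdvd (ev3_faceP_point hH y), cross_zero_left]
      simp
  · rw [vev_mul, ev3_mul, ev3_faceP_point hF]
    simp

theorem eq_zero_of_inner_linearIndependent {a b c x : E3} (h : LinearIndependent ℝ ![a, b, c])
    (ha : ⟪x, a⟫ = 0) (hb : ⟪x, b⟫ = 0) (hc : ⟪x, c⟫ = 0) : x = 0 := by
  have hspan := h.span_eq_top_of_card_eq_finrank' (by simp)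
  have hle : Submodule.span ℝ (range ![a, b, c]) ≤ (ℝ ∙ x)ᗮ := by
    rw [Submodule.span_le]
    rintro _ ⟨j, rfl⟩
    change _ ∈ (ℝ ∙ x)ᗮ
    rw [Submodule.mem_orthogonal_singleton_iff_inner_right]
    fin_cases j
    exacts [ha, hb, hc]
  rw [hspan] at hle
  exact inner_self_eq_zero.1
    (Submodule.mem_orthogonal_singleton_iff_inner_right.1 (hle (Submodule.mem_top (x := x))))

theorem eq_zero_of_cross_normal {n x : E3} (hn : ⟪n, n⟫ = 1) (h0 : ⟪x, n⟫ = 0)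
    (h : cross x n = 0) : x = 0 := by
  have := cross_cross_normal x n
  rw [h, hn, h0, one_smul, zero_smul, sub_zero] at this
  rw [← this]
  apply ext_three <;> simp [cross_apply_zero, cross_apply_one, cross_apply_two]

open Classical in
/-- Face fields that annihilate the traces of all polynomials of sufficiently high degree vanish. -/
theorem Annihilates.eq_zero (h : M.Annihilates i r α β) (hk : 1 ≤ k)
    (hα : ∀ F ∈ M.faces i, ∀ a, (α F a).totalDegree ≤ k)
    (hβ : ∀ F ∈ M.faces i, ∀ a, (β F a).totalDegree ≤ k - 1)
    (hαn : ∀ F ∈ M.faces i, ∀ y, ⟪evv2 (α F) y, M.normal i F⟫ = 0)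
    (hr : 2 * (M.faces i).card + k - 2 ≤ r)
    (hr' : M.HasUncutFace i ∨ 2 * (M.faces i).card + k - 1 ≤ r) :
    ∀ F ∈ M.faces i, α F = 0 ∧ β F = 0 := by
  rcases hr' with ⟨F, hF, G, hG, G', hG', hli, hs, hs'⟩ | hr'
  · have hinj := hli.injective
    have hFG : F ≠ G := by
      rintro rfl
      exact absurd (@hinj 0 1 rfl) (by decide)
    have hFG' : F ≠ G' := by
      rintro rfl
      exact absurd (@hinj 0 2 rfl) (by decide)
    -- The vector `α × n` is orthogonal to the normals of `G` and `G'` and, trivially, to `n`. These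
    -- are independent, so it vanishes, and `α` is tangential.
    have hαF : α F = 0 := by
      refine evv2_injective fun y => ?_
      rw [evv2_zero]
      have h1 := h.inner_cross_eq_zero hF hG hFG hs (hα F hF) hr y
      have h2 := h.inner_cross_eq_zero hF hG' hFG' hs' (hα F hF) hr y
      rw [← inner_cross_swap] at h1 h2
      exact eq_zero_of_cross_normal (M.isUnitNormal hF).inner_self (hαn F hF y)
        (eq_zero_of_inner_linearIndependent hli (inner_cross_self _ _) h1 h2)
    have hcard := Finset.card_erase_add_one hF
    have hβF : β F = 0 := by
      refine h.right_eq_zero (S := ∅) hF (by simp) (hβ F hF) hαF ?_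
      rw [Finset.sdiff_empty]
      omega
    intro H hH
    by_cases hHF : H = F
    · subst hHF
      exact ⟨hαF, hβF⟩
    · have hS : ∀ G ∈ ({F} : Finset κ), α G = 0 ∧ β G = 0 := by
        intro G hG
        rw [Finset.mem_singleton.1 hG]
        exact ⟨hαF, hβF⟩
      have hcard2 := Finset.card_erase_add_one (Finset.mem_erase.2 ⟨hHF, hH⟩)
      -- Leaving the settled face `F` out of the bubble saves two degrees: `1 + 2(N-2) + k = 2N + k
      -- - 3`.
      have hαH : α H = 0 := by
        refine h.left_eq_zero hH hS (hα H hH) (hαn H hH) ?_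
        rw [Finset.sdiff_singleton_eq_erase]
        omega
      refine ⟨hαH, h.right_eq_zero hH hS (hβ H hH) hαH ?_⟩
      rw [Finset.sdiff_singleton_eq_erase]
      omega
  · intro F hF
    have hcard := Finset.card_erase_add_one hF
    have hαF : α F = 0 := by
      refine h.left_eq_zero (S := ∅) hF (by simp) (hα F hF) (hαn F hF) ?_
      rw [Finset.sdiff_empty]
      omega
    refine ⟨hαF, h.right_eq_zero (S := ∅) hF (by simp) (hβ F hF) hαF ?_⟩
    rw [Finset.sdiff_empty]
    omega

theorem tangentialJump_eq_zero_of_weakCurlCurl_eq_zero (hk : 2 ≤ k)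
    (hr : 2 * (M.faces i).card + k - 2 ≤ r)
    (hr' : M.HasUncutFace i ∨ 2 * (M.faces i).card + k - 1 ≤ r)
    {v : VectorWeak ι κ} (hv : v ∈ M.Vh k) (h : M.weakCurlCurl i r v = 0) (hF : F ∈ M.faces i) :
    (M.face F).tangentialJump (v.1 i) (v.2.1 F) (M.normal i F) = 0 ∧
      (M.face F).tangentialJump (curlP (v.1 i)) (v.2.2 F) (M.normal i F) = 0 := by
  refine (annihilates_of_weakCurlCurl_eq_zero hk hr (hv.1 i) h).eq_zero (k := k) (by omega)
    (fun F _ => ?_) (fun F _ => ?_) (fun F _ y => ?_) hr hr' F hF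
  · exact Face.totalDegree_tangentialJump_le _ (hv.1 i) (hv.2.1 F) _
  · exact Face.totalDegree_tangentialJump_le _ (totalDegree_curlP_le (hv.1 i)) (hv.2.2 F) _
  · rw [Face.tangentialJump, evv2_crossP2]
    exact inner_cross_self _ _

end Mesh

/-! ### Potentials of curl-free polynomial fields -/

section Potential

open MvPolynomial

theorem pderiv_pderiv_comm {σ : Type*} (a b : σ) (p : MvPolynomial σ ℝ) :
    pderiv a (pderiv b p) = pderiv b (pderiv a p) := by
  classical
  induction p using MvPolynomial.induction_on with
  | C c => simp
  | add p q hp hq => simp [hp, hq]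
  | mul_X p c hp =>
    simp only [pderiv_mul, map_add, hp, pderiv_X, Pi.single_apply]
    split_ifs <;> simp <;> ring

/-- The operator that divides every monomial by its degree plus `c`. -/
def divDegree (c : ℝ) : Poly3 →ₗ[ℝ] Poly3 :=
  (basisMonomials (Fin 3) ℝ).constr ℝ fun m => monomial m ((m.degree + c)⁻¹)

theorem divDegree_monomial (c : ℝ) (m : Fin 3 →₀ ℕ) (r : ℝ) :
    divDegree c (monomial m r) = monomial m ((m.degree + c)⁻¹ * r) := by
  have h : (monomial m r : Poly3) = r • basisMonomials (Fin 3) ℝ m := by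
    simp [coe_basisMonomials, smul_monomial]
  rw [h, map_smul, divDegree, Module.Basis.constr_basis, smul_monomial, smul_eq_mul, mul_comm]

/-- The operator `divDegree c` is `p ↦ ∫₀¹ t^(c-1) p(tx) dt` in algebraic form. Differentiation
brings out a factor `t`, hence the shift from 1 to 2. -/
theorem pderiv_divDegree (b : Fin 3) (p : Poly3) :
    pderiv b (divDegree 1 p) = divDegree 2 (pderiv b p) := by
  induction p using MvPolynomial.induction_on' with
  | add p q hp hq => simp only [map_add, hp, hq]
  | monomial m r =>
    rw [divDegree_monomial, pderiv_monomial, pderiv_monomial, divDegree_monomial]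
    by_cases hm : m b = 0
    · simp [hm]
    · have h1 : m - Finsupp.single b 1 + Finsupp.single b 1 = m :=
        Finsupp.sub_add_single_one_cancel hm
      have h2 : (m - Finsupp.single b 1).degree + 1 = m.degree := by
        conv_rhs => rw [← h1]
        simp
      rw [← h2]
      push_cast
      rw [add_assoc, one_add_one_eq_two, mul_assoc]

theorem X_mul_divDegree (a : Fin 3) (p : Poly3) :
    X a * divDegree 2 p = divDegree 1 (X a * p) := by
  induction p using MvPolynomial.induction_on' with
  | add p q hp hq => simp only [map_add, mul_add, hp, hq]
  | monomial m r =>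
    rw [divDegree_monomial, X, monomial_mul, monomial_mul, divDegree_monomial]
    simp only [map_add, Finsupp.degree_single, one_mul]
    push_cast
    congr 3
    ring

theorem divDegree_add_euler (p : Poly3) :
    divDegree 1 p + ∑ a, divDegree 1 (X a * pderiv a p) = p := by
  induction p using MvPolynomial.induction_on' with
  | add p q hp hq =>
    simp only [map_add, mul_add, Finset.sum_add_distrib]
    rw [add_add_add_comm, hp, hq]
  | monomial m r =>
    simp only [X_mul_pderiv_monomial, map_nsmul, divDegree_monomial]
    rw [← Finset.sum_smul, ← Finsupp.degree_eq_sum, ← succ_nsmul', smul_monomial]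
    congr 1
    rw [nsmul_eq_mul, ← mul_assoc]
    push_cast
    rw [mul_inv_cancel₀ (by positivity), one_mul]

theorem pderiv_symm_of_curlP_eq_zero {u : Fin 3 → Poly3} (h : curlP u = 0) (a b : Fin 3) :
    pderiv b (u a) = pderiv a (u b) := by
  have h0 : pderiv 1 (u 2) - pderiv 2 (u 1) = 0 := congrFun h 0
  have h1 : pderiv 2 (u 0) - pderiv 0 (u 2) = 0 := congrFun h 1
  have h2 : pderiv 0 (u 1) - pderiv 1 (u 0) = 0 := congrFun h 2
  rw [sub_eq_zero] at h0 h1 h2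
  fin_cases a <;> fin_cases b
  exacts [rfl, h2.symm, h1, h2, rfl, h0.symm, h1.symm, h0, rfl]

/-- This is the Poincaré potential `∑ x_a ∫₀¹ u_a(tx) dt`. The symmetry of the derivatives turns its
gradient into the expression of the Euler identity `divDegree_add_euler`. -/
theorem exists_gradP_eq {u : Fin 3 → Poly3} (h : curlP u = 0) : ∃ φ, gradP φ = u := by
  classical
  refine ⟨∑ a, X a * divDegree 1 (u a), ?_⟩
  funext b
  have h1 : ∀ a, pderiv b (X a * divDegree 1 (u a)) =
      (if a = b then divDegree 1 (u a) else 0) + divDegree 1 (X a * pderiv a (u b)) := by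
    intro a
    rw [pderiv_mul, pderiv_divDegree, pderiv_symm_of_curlP_eq_zero h a b, X_mul_divDegree,
      pderiv_X, Pi.single_apply]
    split_ifs <;> simp
  rw [gradP, map_sum]
  simp only [h1, Finset.sum_add_distrib, Finset.sum_ite_eq', Finset.mem_univ, if_true]
  exact divDegree_add_euler (u b)

end Potential

/-! ### Unique continuation across a face -/

namespace Face

variable (F : Face)

theorem pderiv_restr (c : Fin 2) (p : Poly3) :
    MvPolynomial.pderiv c (F.restr p) =
      ∑ a, MvPolynomial.C (F.tangent c a) * F.restr (MvPolynomial.pderiv a p) := by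
  induction p using MvPolynomial.induction_on with
  | C r => simp [restr]
  | add p q hp hq => simp only [map_add, hp, hq, mul_add, Finset.sum_add_distrib]
  | mul_X p b hp =>
    have hX : MvPolynomial.pderiv c (F.restr (MvPolynomial.X b)) =
        MvPolynomial.C (F.tangent c b) := by
      simp only [restr, MvPolynomial.aeval_X, map_add, MvPolynomial.pderiv_C_mul,
        MvPolynomial.pderiv_C, MvPolynomial.pderiv_X]
      fin_cases c <;> simp
    have h1 : ∀ a, F.restr (MvPolynomial.pderiv a (p * MvPolynomial.X b)) =
        F.restr (MvPolynomial.pderiv a p) * F.restr (MvPolynomial.X b) +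
          if a = b then F.restr p else 0 := by
      intro a
      rw [MvPolynomial.pderiv_mul, map_add, map_mul]
      by_cases hab : a = b
      · subst hab
        simp
      · rw [MvPolynomial.pderiv_X_of_ne (Ne.symm hab)]
        simp [hab]
    rw [map_mul, MvPolynomial.pderiv_mul, hp, hX]
    simp only [h1, mul_add, Finset.sum_add_distrib, mul_ite, mul_zero, Finset.sum_ite_eq',
      Finset.mem_univ, if_true, Finset.sum_mul, mul_assoc]
    rw [mul_comm (F.restr p)]

variable {F} {n : E3}

/-- On the plane the tangential derivatives of `w` vanish, so the Jacobian has the form `g ⊗ n`. It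
is symmetric because `w` is curl-free, so `g` is a multiple of `n`, and its trace is zero because
`w` is divergence-free, so `g = 0`. -/
theorem IsUnitNormal.restr_pderiv_eq_zero (hn : F.IsUnitNormal n) {w : Fin 3 → Poly3}
    (hc : curlP w = 0) (hd : divP w = 0) (ht : F.traceP w = 0) (a b : Fin 3) :
    F.restr (MvPolynomial.pderiv b (w a)) = 0 := by
  refine MvPolynomial.funext fun z => ?_
  set y : E2 := WithLp.toLp 2 z with hy
  let A : Fin 3 → E3 := fun a => vev (gradP (w a)) (F.point y)
  have hA : ∀ a b, A a b = ev3 (MvPolynomial.pderiv b (w a)) (F.point y) := fun _ _ => rfl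
  have hsymm : ∀ a b, A a b = A b a := by
    intro a b
    rw [hA, hA, pderiv_symm_of_curlP_eq_zero hc]
  have htr : A 0 0 + A 1 1 + A 2 2 = 0 := by
    have := congrArg (fun p => ev3 p (F.point y)) hd
    simpa [divP, Fin.sum_univ_three, ev3, hA] using this
  have htan : ∀ a c, ⟪A a, F.tangent c⟫ = 0 := by
    intro a c
    have h1 := F.pderiv_restr c (w a)
    have h2 : F.restr (w a) = 0 := congrFun ht a
    rw [h2, map_zero, Fin.sum_univ_three] at h1
    have h3 := congrArg (fun p => ev2 p y) h1.symm
    simp only [ev2_add, ev2_mul, ev2_C, F.ev2_restr] at h3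
    rw [inner_eq_sum, hA, hA, hA]
    have h4 : ev2 (0 : Poly2) y = 0 := by simp [ev2]
    linarith
  have hexp : ∀ a b, A a b = ⟪A a, n⟫ * n b := by
    intro a b
    have := congrArg (fun v : E3 => v b) (hn.expand (A a))
    simpa [htan] using this
  have hnn := hn.inner_self
  rw [inner_eq_sum] at hnn
  have hzero : ∀ a, ⟪A a, n⟫ = 0 := by
    intro a
    have e : ∀ b, ⟪A a, n⟫ * n b = ⟪A b, n⟫ * n a := fun b => by
      rw [← hexp, ← hexp, hsymm]
    rw [hexp 0 0, hexp 1 1, hexp 2 2] at htr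
    linear_combination (-⟪A a, n⟫) * hnn + n 0 * e 0 + n 1 * e 1 + n 2 * e 2 + n a * htr
  have hfin : ev2 (F.restr (MvPolynomial.pderiv b (w a))) y = 0 := by
    rw [F.ev2_restr, ← hA, hexp, hzero, zero_mul]
  simpa [ev2] using hfin

/-- A curl-free and divergence-free polynomial field that vanishes on a plane is zero. -/
theorem IsUnitNormal.eq_zero_of_traceP_eq_zero (hn : F.IsUnitNormal n) {w : Fin 3 → Poly3}
    (hc : curlP w = 0) (hd : divP w = 0) (ht : F.traceP w = 0) : w = 0 := by
  have hconst : ∀ w : Fin 3 → Poly3, F.traceP w = 0 → (∀ a, ∃ c, w a = MvPolynomial.C c) →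
      w = 0 := by
    intro w ht hw
    funext a
    obtain ⟨c, hc⟩ := hw a
    have h1 : F.restr (w a) = 0 := congrFun ht a
    rw [hc] at h1 ⊢
    have h2 : (MvPolynomial.C c : Poly2) = 0 := by simpa [restr] using h1
    have h3 : c = 0 := by simpa using h2
    simp [h3]
  -- Induction on the degree: the partial derivatives of `w` satisfy the same three conditions and
  -- have smaller degree, so they vanish, and `w` is a constant that is zero on the plane.
  suffices ∀ d : ℕ, ∀ w : Fin 3 → Poly3, (∀ a, (w a).totalDegree ≤ d) → curlP w = 0 →
      divP w = 0 → F.traceP w = 0 → w = 0 from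
    this (∑ a, (w a).totalDegree) w
      (fun a => Finset.single_le_sum (f := fun a => (w a).totalDegree)
        (fun _ _ => Nat.zero_le _) (Finset.mem_univ a)) hc hd ht
  intro d
  induction d with
  | zero =>
    intro w hw _ _ ht
    exact hconst w ht fun a =>
      ⟨_, MvPolynomial.totalDegree_eq_zero_iff_eq_C.1 (Nat.le_zero.1 (hw a))⟩
  | succ d ih =>
    intro w hw hc hd ht
    refine hconst w ht fun a => exists_eq_C_of_pderiv_eq_zero fun b => ?_
    refine congrFun (ih (fun a => MvPolynomial.pderiv b (w a)) (fun a => ?_) ?_ ?_ ?_) a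
    · have := totalDegree_pderiv_le b (w a)
      have := hw a
      omega
    · have h1 : curlP (fun a => MvPolynomial.pderiv b (w a)) =
          fun a => MvPolynomial.pderiv b (curlP w a) := by
        funext a
        fin_cases a <;> simp [curlP, pderiv_pderiv_comm b]
      rw [h1, hc]
      funext a
      simp
    · have h1 : divP (fun a => MvPolynomial.pderiv b (w a)) = MvPolynomial.pderiv b (divP w) := by
        simp [divP, pderiv_pderiv_comm b]
      rw [h1, hd, map_zero]
    · funext a
      exact hn.restr_pderiv_eq_zero hc hd ht a b

end Face

/-! ### Cancellation across the faces of a mesh -/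

theorem eq_smul_of_inner_sq_eq_one {n m : E3} (hn : ⟪n, n⟫ = 1) (hm : ⟪m, m⟫ = 1)
    (h : ⟪n, m⟫ ^ 2 = 1) : n = ⟪n, m⟫ • m := by
  rw [← sub_eq_zero, ← inner_self_eq_zero (𝕜 := ℝ)]
  simp only [inner_sub_left, inner_sub_right, real_inner_smul_left, real_inner_smul_right, hn, hm,
    real_inner_comm n m]
  linear_combination -h

namespace Mesh

variable {Ω : Set E3} {ι κ : Type*} (M : Mesh Ω ι κ) {i j : ι} {F : κ}

/-- The product of the linear polynomials of all other faces of both elements is not zero on `F`, so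
some interior point of `F` lies off all their planes. There the outward condition applies to both
elements. -/
theorem exists_generic_point (hi : F ∈ M.faces i) (hj : F ∈ M.faces j) :
    ∃ x ∈ (M.face F).relInterior, (∀ G ∈ M.faces i, G ≠ F → x ∉ (M.face G).carrier) ∧
      ∀ G ∈ M.faces j, G ≠ F → x ∉ (M.face G).carrier := by
  classical
  have hne : ∀ {l}, F ∈ M.faces l →
      (M.face F).restr (∏ G ∈ (M.faces l).erase F, M.faceP l G) ≠ 0 := by
    intro l hl
    rw [map_prod]
    exact Finset.prod_ne_zero_iff.2 fun G hG =>
      restr_faceP_ne_zero hl (Finset.mem_of_mem_erase hG) (Ne.symm (Finset.ne_of_mem_erase hG))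
  obtain ⟨y, hy, hy0⟩ : ∃ y ∈ interior (M.face F).region,
      ev2 ((M.face F).restr (∏ G ∈ (M.faces i).erase F, M.faceP i G) *
        (M.face F).restr (∏ G ∈ (M.faces j).erase F, M.faceP j G)) y ≠ 0 := by
    by_contra! hcon
    exact mul_ne_zero (hne hi) (hne hj) (eq_zero_of_eval_eq_zero_on_open isOpen_interior
      (M.face F).interior_region_nonempty hcon)
  rw [ev2_mul, Face.ev2_restr, Face.ev2_restr, ev3_prod, ev3_prod] at hy0
  have hout : ∀ {l}, (∏ G ∈ (M.faces l).erase F, ev3 (M.faceP l G) ((M.face F).point y)) ≠ 0 →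
      ∀ G ∈ M.faces l, G ≠ F → (M.face F).point y ∉ (M.face G).carrier := by
    rintro l hl G hG hGF ⟨z, _, hz⟩
    refine Finset.prod_ne_zero_iff.1 hl G (Finset.mem_erase.2 ⟨hGF, hG⟩) ?_
    rw [← hz, ev3_faceP_point hG]
  exact ⟨_, ⟨y, hy, rfl⟩, hout (left_ne_zero_of_mul hy0), hout (right_ne_zero_of_mul hy0)⟩

/-- Two elements that share a face lie on different sides of it. -/
theorem normal_eq_neg (hij : i ≠ j) (hi : F ∈ M.faces i) (hj : F ∈ M.faces j) :
    M.normal j F = -M.normal i F := by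
  have hni := M.isUnitNormal hi
  have hnj := M.isUnitNormal hj
  have hexp := hni.expand (M.normal j F)
  rw [hnj.inner_tangent, hnj.inner_tangent, zero_smul, zero_smul, add_zero, add_zero] at hexp
  have hsq : ⟪M.normal j F, M.normal i F⟫ ^ 2 = 1 := by
    have := hnj.inner_self
    rw [hexp, real_inner_smul_left, real_inner_smul_right, hni.inner_self] at this
    rw [sq]
    linarith
  rcases sq_eq_sq_iff_eq_or_eq_neg.1 (hsq.trans (one_pow 2).symm) with h | h
  -- With equal normals, the points slightly below a generic point of the face would belong to both
  -- elements.
  · exfalso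
    rw [h, one_smul] at hexp
    obtain ⟨x, hx, hxi, hxj⟩ := M.exists_generic_point hi hj
    have h1 := M.normal_outward i F hi x hx hxi
    have h2 := M.normal_outward j F hj x hx hxj
    rw [hexp] at h2
    obtain ⟨s, hs1, hs2⟩ := (h1.and h2).exists
    exact Set.disjoint_left.1 (M.disjoint_body i j hij) hs1.1 hs2.1
  · rw [h, neg_one_smul] at hexp
    exact hexp

/-- Three elements at one face would have pairwise opposite normals. -/
theorem eq_or_eq_of_mem_faces {l : ι} (hij : i ≠ j) (hi : F ∈ M.faces i) (hj : F ∈ M.faces j)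
    (hl : F ∈ M.faces l) : l = i ∨ l = j := by
  by_contra! hcon
  have h1 := M.normal_eq_neg hij hi hj
  have h2 := M.normal_eq_neg hcon.1.symm hi hl
  have h3 := M.normal_eq_neg hcon.2.symm hj hl
  rw [h1, neg_neg, h2] at h3
  have h4 := congrArg (fun x => ⟪x, M.normal i F⟫) h3
  simp only [inner_neg_left, (M.isUnitNormal hi).inner_self] at h4
  norm_num at h4

theorem exists_pair_of_not_boundary (hF : ¬ (M.face F).carrier ⊆ frontier Ω) :
    ∃ i j, i ≠ j ∧ F ∈ M.faces i ∧ F ∈ M.faces j :=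
  ((M.boundary_or_interior F).resolve_left hF).2

variable [Fintype ι] [Fintype κ]

theorem sum_sum_faces_eq_zero {ψ : ι → κ → ℝ}
    (hint : ∀ F i j, i ≠ j → F ∈ M.faces i → F ∈ M.faces j → ¬ (M.face F).carrier ⊆ frontier Ω →
      ψ i F + ψ j F = 0)
    (hbd : ∀ F i, F ∈ M.faces i → (M.face F).carrier ⊆ frontier Ω → ψ i F = 0) :
    ∑ i, ∑ F ∈ M.faces i, ψ i F = 0 := by
  classical
  rw [Finset.sum_comm' (t' := Finset.univ) (s' := fun F => {i | F ∈ M.faces i}) (by simp)]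
  refine Finset.sum_eq_zero fun F _ => ?_
  by_cases hF : (M.face F).carrier ⊆ frontier Ω
  · exact Finset.sum_eq_zero fun i hi => hbd F i (Finset.mem_filter.1 hi).2 hF
  · obtain ⟨i, j, hij, hi, hj⟩ := M.exists_pair_of_not_boundary hF
    have : ({l | F ∈ M.faces l} : Finset ι) = {i, j} := by
      ext l
      simp only [Finset.mem_filter, Finset.mem_univ, true_and, Finset.mem_insert,
        Finset.mem_singleton]
      constructor
      · exact fun hl => M.eq_or_eq_of_mem_faces hij hi hj hl
      · rintro (rfl | rfl) <;> assumption
    rw [this, Finset.sum_pair hij]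
    exact hint F i j hij hi hj hF

/-- If the normal components of piecewise polynomial fields match across the interior faces and
vanish on the boundary, and if their divergences are non-negative, then these vanish. -/
theorem divP_eq_zero_of_normal_continuous {q : ι → Fin 3 → Poly3}
    (hint : ∀ F i j, i ≠ j → F ∈ M.faces i → F ∈ M.faces j → ¬ (M.face F).carrier ⊆ frontier Ω →
      ∀ y, ⟪vev (q i) ((M.face F).point y), M.normal i F⟫ =
        ⟪vev (q j) ((M.face F).point y), M.normal i F⟫)
    (hbd : ∀ F i, F ∈ M.faces i → (M.face F).carrier ⊆ frontier Ω →
      ∀ y, ⟪vev (q i) ((M.face F).point y), M.normal i F⟫ = 0)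
    (hpos : ∀ i x, 0 ≤ ev3 (divP (q i)) x) (i : ι) : divP (q i) = 0 := by
  have hsum : ∑ i, ∫ x in M.body i, ev3 (divP (q i)) x = 0 := by
    simp only [M.setIntegral_body_divP]
    refine M.sum_sum_faces_eq_zero (fun F i j hij hi hj hF => ?_) fun F i hi hF => ?_
    · have h1 : ((M.face F).integral fun y => ⟪vev (q j) ((M.face F).point y), M.normal j F⟫) =
          -(M.face F).integral fun y => ⟪vev (q i) ((M.face F).point y), M.normal i F⟫ := by
        rw [← Face.integral_neg]
        refine Face.integral_congr _ fun y _ => ?_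
        rw [hint F i j hij hi hj hF y, M.normal_eq_neg hij hi hj, inner_neg_right]
      rw [h1, add_neg_cancel]
    · exact Face.integral_eq_zero _ fun y _ => hbd F i hi hF y
  rw [Finset.sum_eq_zero_iff_of_nonneg fun i _ =>
    setIntegral_nonneg (M.isOpen_body i).measurableSet fun x _ => hpos i x] at hsum
  exact eq_zero_of_setIntegral_eq_zero (M.isOpen_body i) (M.nonempty_body i) Subset.rfl
    (M.isOpen_body i).measurableSet (M.isBounded_body i) (fun x _ => hpos i x)
    (hsum i (Finset.mem_univ i))

/-! ### Global uniqueness -/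

omit [Fintype ι] [Fintype κ] in
theorem eq_zero_of_ev2_zero_of_boundary {k : ℕ} {σ : ScalarWeak ι κ} (hσ : σ ∈ M.Wh0 k)
    (hF : (M.face F).carrier ⊆ frontier Ω) : σ.2 F = 0 :=
  (M.face F).eq_zero_of_ev2_eq_zero (hσ.2 F hF)

/-- The function is piecewise constant, equal across faces and zero at the boundary. The field `c²
x` has divergence `3c²`, and the divergence principle replaces an argument by chains of neighbouring
elements. -/
theorem scalar_eq_zero {k : ℕ} {σ : ScalarWeak ι κ} (hσ : σ ∈ M.Wh0 k)
    (hgrad : ∀ i, gradP (σ.1 i) = 0)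
    (hface : ∀ i, ∀ F ∈ M.faces i, σ.2 F = (M.face F).restr (σ.1 i)) : σ = 0 := by
  have hconst : ∀ i, ∃ c, σ.1 i = MvPolynomial.C c := fun i =>
    exists_eq_C_of_pderiv_eq_zero fun a => congrFun (hgrad i) a
  choose c hc using hconst
  have hface' : ∀ i, ∀ F ∈ M.faces i, σ.2 F = MvPolynomial.C (c i) := by
    intro i F hF
    rw [hface i F hF, hc]
    simp [Face.restr]
  have hdiv : ∀ i, divP (fun a => MvPolynomial.C (c i ^ 2) * MvPolynomial.X a) =
      MvPolynomial.C (3 * c i ^ 2) := by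
    intro i
    simp only [divP, MvPolynomial.pderiv_C_mul, MvPolynomial.pderiv_X_self, mul_one,
      Finset.sum_const, Finset.card_univ, Fintype.card_fin, ← map_nsmul]
    simp
  have h0 : ∀ i, c i = 0 := by
    intro i
    have := M.divP_eq_zero_of_normal_continuous
      (q := fun i a => MvPolynomial.C (c i ^ 2) * MvPolynomial.X a)
      (fun F i j _ hi hj _ y => ?_) (fun F i hi hF y => ?_) (fun i x => ?_) i
    · rw [hdiv, MvPolynomial.C_eq_zero] at this
      simpa using this
    · have : c i = c j := by
        have := (hface' i F hi).symm.trans (hface' j F hj)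
        exact MvPolynomial.C_injective _ _ this
      rw [this]
    · have : c i = 0 := by
        have := (hface' i F hi).symm.trans (M.eq_zero_of_ev2_zero_of_boundary hσ hF)
        simpa using this
      rw [vev_mul, this, ev3_C]
      simp
    · rw [hdiv, ev3_C]
      positivity
  refine Prod.ext (funext fun i => ?_) (funext fun F => ?_)
  · rw [hc, h0]
    simp
  · obtain ⟨i, hi⟩ := M.exists_mem_faces F
    rw [hface' i F hi, h0]
    simp

theorem ev3_sum_sq_nonneg (p : Fin 3 → Poly3) (x : E3) : 0 ≤ ev3 (∑ a, p a * p a) x := by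
  rw [← inner_vev]
  exact real_inner_self_nonneg

theorem eq_zero_of_sum_mul_self_eq_zero {p : Fin 3 → Poly3} (h : ∑ a, p a * p a = 0) : p = 0 :=
  eq_zero_of_sum_sq_eq_zero (by simpa only [sq] using h)

/-- The normal component of `v₀ × (∇ × v₀)` depends only on the tangential traces of both factors.
These are the single-valued `v_b` and `v_n`, and `v_b` vanishes on the boundary. The divergence is
`|∇ × v₀|²`, as the curl-curl is zero. -/
theorem curlP_eq_zero {v : VectorWeak ι κ}
    (hcc : ∀ i, curlP (curlP (v.1 i)) = 0)
    (hb : ∀ i, ∀ F ∈ M.faces i, ∀ y, cross (vev (v.1 i) ((M.face F).point y)) (M.normal i F) =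
      cross ((M.face F).tanField (v.2.1 F) y) (M.normal i F))
    (hn : ∀ i, ∀ F ∈ M.faces i, ∀ y,
      cross (vev (curlP (v.1 i)) ((M.face F).point y)) (M.normal i F) =
        cross ((M.face F).tanField (v.2.2 F) y) (M.normal i F))
    (hbd : ∀ F i, F ∈ M.faces i → (M.face F).carrier ⊆ frontier Ω →
      ∀ y, cross ((M.face F).tanField (v.2.1 F) y) (M.normal i F) = 0) (i : ι) :
    curlP (v.1 i) = 0 := by
  have hdiv : ∀ i, divP (crossProduct (v.1 i) (curlP (v.1 i))) =
      ∑ a, curlP (v.1 i) a * curlP (v.1 i) a := by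
    intro i
    rw [divP_crossProduct, hcc i]
    simp
  have hval : ∀ i, ∀ F ∈ M.faces i, ∀ y,
      ⟪vev (crossProduct (v.1 i) (curlP (v.1 i))) ((M.face F).point y), M.normal i F⟫ =
        ⟪(M.face F).tanField (v.2.1 F) y,
          cross ((M.face F).tanField (v.2.2 F) y) (M.normal i F)⟫ := by
    intro i F hF y
    rw [vev_crossProduct, inner_cross_left, hb i F hF, ← inner_cross_left, inner_cross_swap,
      hn i F hF]
  have := M.divP_eq_zero_of_normal_continuous
    (q := fun i => crossProduct (v.1 i) (curlP (v.1 i)))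
    (fun F i j hij hi hj _ y => ?_) (fun F i hi hF y => ?_) (fun i x => ?_) i
  · rw [hdiv] at this
    exact eq_zero_of_sum_mul_self_eq_zero this
  · have h1 := hval j F hj y
    rw [M.normal_eq_neg hij hi hj, cross_neg_right, inner_neg_right, inner_neg_right, neg_inj]
      at h1
    rw [hval i F hi y, h1]
  · rw [hval i F hi y, ← inner_cross_swap, inner_cross_left, hbd F i hi hF, inner_zero_left,
      neg_zero]
  · rw [hdiv]
    exact ev3_sum_sq_nonneg _ _

end Mesh

/-! ### Harmonic polynomial fields with vanishing tangential trace -/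

theorem exists_inner_eq {n m : E3} (hn : ⟪n, n⟫ = 1) (hm : ⟪m, m⟫ = 1) (h : ⟪n, m⟫ ^ 2 ≠ 1)
    (a b : ℝ) : ∃ z : E3, ⟪z, n⟫ = a ∧ ⟪z, m⟫ = b := by
  set s := ⟪n, m⟫ with hs
  have hs' : ⟪m, n⟫ = s := real_inner_comm _ _
  have hne : 1 - s ^ 2 ≠ 0 := sub_ne_zero.2 (Ne.symm h)
  refine ⟨((a - b * s) / (1 - s ^ 2)) • n + ((b - a * s) / (1 - s ^ 2)) • m, ?_, ?_⟩
  · rw [inner_add_left, real_inner_smul_left, real_inner_smul_left, hn, hs']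
    field_simp
    ring
  · rw [inner_add_left, real_inner_smul_left, real_inner_smul_left, hm, ← hs]
    field_simp
    ring

namespace Face

/-- The planes of two faces meet if their normals are not parallel. -/
theorem IsUnitNormal.exists_point_eq_point {F G : Face} {n m : E3} (hn : F.IsUnitNormal n)
    (hm : G.IsUnitNormal m) (h : ⟪n, m⟫ ^ 2 ≠ 1) : ∃ y z, F.point y = G.point z := by
  obtain ⟨x, hx, hx'⟩ := exists_inner_eq hn.inner_self hm.inner_self h ⟪F.base, n⟫ ⟪G.base, m⟫
  obtain ⟨y, hy⟩ := hn.mem_plane_iff.2 (show ⟪x - F.base, n⟫ = 0 by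
    rw [inner_sub_left, hx, sub_self])
  obtain ⟨z, hz⟩ := hm.mem_plane_iff.2 (show ⟪x - G.base, m⟫ = 0 by
    rw [inner_sub_left, hx', sub_self])
  exact ⟨y, z, hy.trans hz.symm⟩

theorem IsUnitNormal.eq_smul_of_cross_eq_zero {F : Face} {n x : E3} (hn : F.IsUnitNormal n)
    (h : cross x n = 0) : x = ⟪x, n⟫ • n := by
  have h1 := cross_cross_normal x n
  have h2 : cross n (0 : E3) = 0 := by
    apply ext_three <;> simp [cross_apply_zero, cross_apply_one, cross_apply_two]
  rw [h, hn.inner_self, one_smul, h2] at h1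
  exact (sub_eq_zero.1 h1.symm)

/-- A potential of a field with vanishing tangential trace on a plane is constant there. -/
theorem IsUnitNormal.exists_const {F : Face} {n : E3} (hn : F.IsUnitNormal n) {φ : Poly3}
    (h : ∀ y, cross (vev (gradP φ) (F.point y)) n = 0) : ∃ c, ∀ y, ev3 φ (F.point y) = c := by
  have hconst : ∃ c, F.restr φ = MvPolynomial.C c := by
    refine exists_eq_C_of_pderiv_eq_zero fun b => MvPolynomial.funext fun z => ?_
    have h1 := hn.eq_smul_of_cross_eq_zero (h (WithLp.toLp 2 z))
    have h2 : ev2 (MvPolynomial.pderiv b (F.restr φ)) (WithLp.toLp 2 z) = 0 := by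
      have h3 : ⟪vev (gradP φ) (F.point (WithLp.toLp 2 z)), F.tangent b⟫ = 0 := by
        rw [h1, real_inner_smul_left, hn.inner_tangent, mul_zero]
      rw [← h3, F.pderiv_restr, ev2_sum, Fin.sum_univ_three, inner_eq_sum]
      simp only [ev2_mul, ev2_C, F.ev2_restr, vev_apply, gradP]
      ring
    simpa [ev2] using h2
  obtain ⟨c, hc⟩ := hconst
  refine ⟨c, fun y => ?_⟩
  rw [← F.ev2_restr, hc, ev2_C]

end Face

namespace Mesh

variable {Ω : Set E3} {ι κ : Type*} (M : Mesh Ω ι κ) [Fintype ι] [Fintype κ]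

/-- A non-empty class of elements that contains all neighbours of its members has boundary faces
that are not parallel to each other. -/
theorem exists_not_parallel {P : ι → Prop} {i₀ : ι} (hi₀ : P i₀)
    (hP : ∀ F i j, i ≠ j → F ∈ M.faces i → F ∈ M.faces j → ¬ (M.face F).carrier ⊆ frontier Ω →
      (P i ↔ P j)) :
    ∃ i, P i ∧ ∃ j, P j ∧ ∃ F ∈ M.faces i, ∃ G ∈ M.faces j, (M.face F).carrier ⊆ frontier Ω ∧
      (M.face G).carrier ⊆ frontier Ω ∧ ⟪M.normal i F, M.normal j G⟫ ^ 2 ≠ 1 := by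
  classical
  by_contra! hcon
  obtain ⟨d, hd, hdn⟩ : ∃ d : E3, d ≠ 0 ∧ ∀ i, P i → ∀ F ∈ M.faces i,
      (M.face F).carrier ⊆ frontier Ω → ⟪d, M.normal i F⟫ = 0 := by
    by_cases hex : ∃ j, P j ∧ ∃ G ∈ M.faces j, (M.face G).carrier ⊆ frontier Ω
    · obtain ⟨j, hj, G, hG, hGb⟩ := hex
      -- If all boundary faces of the class are parallel to `G`, a tangent vector of `G` is tangent
      -- to all of them.
      refine ⟨(M.face G).tangent 0, (M.face G).orthonormal.ne_zero 0, fun i hi F hF hFb => ?_⟩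
      rw [eq_smul_of_inner_sq_eq_one (M.isUnitNormal hF).inner_self (M.isUnitNormal hG).inner_self
        (hcon i hi j hj F hF G hG hFb hGb), real_inner_smul_right,
        (M.isUnitNormal hG).inner_tangent', mul_zero]
    · refine ⟨EuclideanSpace.single 0 1, by simp, fun i hi F hF hFb => ?_⟩
      exact absurd ⟨i, hi, F, hF, hFb⟩ hex
  -- The field `⟪x, d⟫ d` on the class, extended by zero, has no normal component on the boundary
  -- but divergence `|d|² > 0`, contrary to the divergence principle.
  let q : ι → Fin 3 → Poly3 := fun i a => if P i then linP 0 d * MvPolynomial.C (d a) else 0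
  have hq : ∀ i, P i → ∀ x, vev (q i) x = ⟪x, d⟫ • d := by
    intro i hi x
    ext a
    simp [vev, q, hi, ev3_mul, ev3_linP, ev3_C]
  have hq' : ∀ i, ¬ P i → q i = 0 := by
    intro i hi
    funext a
    simp [q, hi]
  have hdiv : ∀ i, P i → divP (q i) = MvPolynomial.C ⟪d, d⟫ := by
    intro i hi
    simp only [q, if_pos hi, divP, MvPolynomial.pderiv_mul, pderiv_linP, MvPolynomial.pderiv_C,
      mul_zero, add_zero, Fin.sum_univ_three, ← map_mul, ← map_add]
    rw [inner_eq_sum]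
  have h0 := M.divP_eq_zero_of_normal_continuous (q := q) (fun F i j hij hi hj hF y => ?_)
    (fun F i hi hF y => ?_) (fun i x => ?_) i₀
  · rw [hdiv i₀ hi₀, MvPolynomial.C_eq_zero] at h0
    exact hd (inner_self_eq_zero.1 h0)
  · by_cases hPi : P i
    · rw [hq i hPi, hq j ((hP F i j hij hi hj hF).1 hPi)]
    · rw [hq' i hPi, hq' j fun h => hPi ((hP F i j hij hi hj hF).2 h)]
  · by_cases hPi : P i
    · rw [hq i hPi, real_inner_smul_left, hdn i hPi F hi hF, mul_zero]
    · rw [hq' i hPi, vev_zero, inner_zero_left]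
  · by_cases hPi : P i
    · rw [hdiv i hPi, ev3_C]
      exact real_inner_self_nonneg
    · rw [hq' i hPi]
      simp [divP, ev3]

/-- Piecewise polynomial fields that are curl-free and divergence-free, continuous, and normal to
the boundary vanish. -/
theorem field_eq_zero {u : ι → Fin 3 → Poly3} (hcurl : ∀ i, curlP (u i) = 0)
    (hdiv : ∀ i, divP (u i) = 0)
    (hint : ∀ F i j, i ≠ j → F ∈ M.faces i → F ∈ M.faces j → ¬ (M.face F).carrier ⊆ frontier Ω →
      u i = u j)
    (hbd : ∀ F i, F ∈ M.faces i → (M.face F).carrier ⊆ frontier Ω →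
      ∀ y, cross (vev (u i) ((M.face F).point y)) (M.normal i F) = 0) (i₀ : ι) : u i₀ = 0 := by
  classical
  obtain ⟨φ, hφ⟩ := exists_gradP_eq (hcurl i₀)
  have hconst : ∀ i, u i = u i₀ → ∀ F ∈ M.faces i, (M.face F).carrier ⊆ frontier Ω →
      ∃ c, ∀ y, ev3 φ ((M.face F).point y) = c := by
    intro i hi F hF hFb
    refine (M.isUnitNormal hF).exists_const fun y => ?_
    rw [hφ, ← hi]
    exact hbd F i hF hFb y
  -- The polynomial `φ` is constant on the whole plane of each boundary face of the class, so two
  -- constants agree as soon as the planes intersect; the faces themselves need not touch.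
  have hmeet : ∀ i, u i = u i₀ → ∀ j, u j = u i₀ → ∀ F ∈ M.faces i, ∀ G ∈ M.faces j,
      (M.face F).carrier ⊆ frontier Ω → (M.face G).carrier ⊆ frontier Ω →
      ⟪M.normal i F, M.normal j G⟫ ^ 2 ≠ 1 →
      ∀ y z, ev3 φ ((M.face F).point y) = ev3 φ ((M.face G).point z) := by
    intro i hi j hj F hF G hG hFb hGb hs y z
    obtain ⟨c, hc⟩ := hconst i hi F hF hFb
    obtain ⟨c', hc'⟩ := hconst j hj G hG hGb
    obtain ⟨y', z', h⟩ := (M.isUnitNormal hF).exists_point_eq_point (M.isUnitNormal hG) hs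
    rw [hc, hc', ← hc y', h, hc']
  obtain ⟨i, hi, j, hj, F, hF, G, hG, hFb, hGb, hs⟩ :=
    M.exists_not_parallel (P := fun i => u i = u i₀) rfl fun F i j hij hi hj hF => by
      rw [hint F i j hij hi hj hF]
  -- A face parallel to `F` is not parallel to `G`, so it is compared with `F` by way of `G`.
  have hall : ∀ l, u l = u i₀ → ∀ H ∈ M.faces l, (M.face H).carrier ⊆ frontier Ω →
      ∀ y, ev3 φ ((M.face H).point y) = ev3 φ ((M.face F).point 0) := by
    intro l hl H hH hHb y
    by_cases h1 : ⟪M.normal l H, M.normal i F⟫ ^ 2 = 1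
    · have h2 : ⟪M.normal l H, M.normal j G⟫ ^ 2 ≠ 1 := by
        rw [eq_smul_of_inner_sq_eq_one (M.isUnitNormal hH).inner_self
          (M.isUnitNormal hF).inner_self h1, real_inner_smul_left, mul_pow, h1, one_mul]
        exact hs
      rw [hmeet l hl j hj H hH G hG hHb hGb h2 y 0, hmeet i hi j hj F hF G hG hFb hGb hs 0 0]
    · exact hmeet l hl i hi H hH F hF hHb hFb h1 y 0
  set c := ev3 φ ((M.face F).point 0) with hc
  -- The field `(φ - c) ∇φ` vanishes on the boundary planes of the class, and its divergence is
  -- `|∇φ|²` because `∇φ` is divergence-free.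
  let q : ι → Fin 3 → Poly3 := fun i a =>
    if u i = u i₀ then (φ - MvPolynomial.C c) * u i₀ a else 0
  have hq : ∀ i, u i = u i₀ → q i = fun a => (φ - MvPolynomial.C c) * u i₀ a := by
    intro i hi
    funext a
    simp [q, hi]
  have hq' : ∀ i, u i ≠ u i₀ → q i = 0 := by
    intro i hi
    funext a
    simp [q, hi]
  have hqdiv : ∀ i, u i = u i₀ → divP (q i) = ∑ a, u i₀ a * u i₀ a := by
    intro i hi
    have : gradP (φ - MvPolynomial.C c) = u i₀ := by
      rw [← hφ]
      funext a
      simp [gradP]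
    rw [hq i hi, divP_mul, hdiv i₀, mul_zero, add_zero, this]
  have h0 := M.divP_eq_zero_of_normal_continuous (q := q) (fun F i j hij hi hj hF y => ?_)
    (fun F i hi hF y => ?_) (fun i x => ?_) i₀
  · rw [hqdiv i₀ rfl] at h0
    exact eq_zero_of_sum_mul_self_eq_zero h0
  · have := hint F i j hij hi hj hF
    simp only [q, this]
  · by_cases hPi : u i = u i₀
    · rw [hq i hPi, vev_mul, ev3_sub, ev3_C, hall i hPi F hi hF, sub_self, zero_smul,
        inner_zero_left]
    · rw [hq' i hPi, vev_zero, inner_zero_left]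
  · by_cases hPi : u i = u i₀
    · rw [hqdiv i hPi]
      exact ev3_sum_sq_nonneg _ _
    · rw [hq' i hPi]
      simp [divP, ev3]

/-! ### The constraint `b(u, q) = 0` -/

variable {k : ℕ} {r₂ : ι → ℕ} {v : VectorWeak ι κ}

omit [Fintype κ] in
-- The degree of the weak gradient is at least `k`, so `v₀` itself is an admissible test field in
-- its definition.
theorem formB_eq (hr : ∀ i, k ≤ r₂ i) (hv : ∀ i a, (v.1 i a).totalDegree ≤ k)
    (q : ScalarWeak ι κ) :
    M.formB r₂ v q = ∑ i, (-innerS (M.body i) (q.1 i) (divP (v.1 i)) +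
      ∑ F ∈ M.faces i, (M.face F).integral fun y =>
        ev2 (q.2 F) y * ⟪vev (v.1 i) ((M.face F).point y), M.normal i F⟫) := by
  refine Finset.sum_congr rfl fun i _ => ?_
  rw [innerV_comm]
  exact M.weakGrad_spec i (r₂ i) q (PolyVec.ofField (v.1 i) fun a => (hv i a).trans (hr i))

omit [Fintype κ] in
-- The divergence, with zero face part, is itself an admissible multiplier.
theorem divP_eq_zero_of_formB_eq_zero (hr : ∀ i, k ≤ r₂ i)
    (hv : ∀ i a, (v.1 i a).totalDegree ≤ k) (h : ∀ q ∈ M.Wh0 k, M.formB r₂ v q = 0) (i : ι) :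
    divP (v.1 i) = 0 := by
  let q : ScalarWeak ι κ := (fun i => divP (v.1 i), 0)
  have hev : ∀ y, ev2 0 y = 0 := fun y => by simp [ev2]
  have hq : q ∈ M.Wh0 k := by
    refine ⟨⟨fun i => ?_, fun F => ?_⟩, fun F _ y _ => hev y⟩
    · refine MvPolynomial.totalDegree_finsetSum_le fun a _ => ?_
      exact (totalDegree_pderiv_le a _).trans ((Nat.sub_le _ _).trans (hv i a))
    · simp [q]
  have h1 := h q hq
  rw [M.formB_eq hr hv] at h1
  have h2 : ∀ i, (∑ F ∈ M.faces i, (M.face F).integral fun y =>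
      ev2 (q.2 F) y * ⟪vev (v.1 i) ((M.face F).point y), M.normal i F⟫) = 0 := fun i =>
    Finset.sum_eq_zero fun F _ => Face.integral_eq_zero _ fun y _ => by
      simp only [q, Pi.zero_apply, hev, zero_mul]
  simp only [h2, add_zero, Finset.sum_neg_distrib, neg_eq_zero] at h1
  have hnn : ∀ i, 0 ≤ innerS (M.body i) (q.1 i) (divP (v.1 i)) := fun i =>
    setIntegral_nonneg (M.isOpen_body i).measurableSet fun x _ => mul_self_nonneg _
  rw [Finset.sum_eq_zero_iff_of_nonneg fun i _ => hnn i] at h1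
  have h3 := h1 i (Finset.mem_univ i)
  simp only [innerS, q, ← ev3_mul] at h3
  have h4 := eq_zero_of_setIntegral_eq_zero (M.isOpen_body i) (M.nonempty_body i) Subset.rfl
    (M.isOpen_body i).measurableSet (M.isBounded_body i) (fun x _ => ?_) h3
  · exact mul_self_eq_zero.1 h4
  · change 0 ≤ ev3 _ x
    rw [ev3_mul]
    exact mul_self_nonneg _

omit [Fintype κ] in
-- The multiplier lives on the single interior face `F` and equals the sum `J` of the outward normal
-- components from both sides, so the constraint reads `∫ J² = 0`. Since `J` is a polynomial, it
-- vanishes on the whole plane.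
theorem normal_jump_eq_zero (hr : ∀ i, k ≤ r₂ i) (hv : ∀ i a, (v.1 i a).totalDegree ≤ k)
    (h : ∀ q ∈ M.Wh0 k, M.formB r₂ v q = 0) {F : κ}
    (hF : ¬ (M.face F).carrier ⊆ frontier Ω) {i j : ι} (hij : i ≠ j) (hi : F ∈ M.faces i)
    (hj : F ∈ M.faces j) (y : E2) :
    ⟪vev (v.1 i) ((M.face F).point y), M.normal i F⟫ =
      ⟪vev (v.1 j) ((M.face F).point y), M.normal i F⟫ := by
  classical
  let d : ι → Poly2 := fun l =>
    ∑ a, (M.face F).traceP (v.1 l) a * MvPolynomial.C (M.normal l F a)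
  have hd : ∀ l y, ev2 (d l) y = ⟪vev (v.1 l) ((M.face F).point y), M.normal l F⟫ := by
    intro l y
    rw [← (M.face F).evv2_traceP, inner_evv2_left]
  let J : Poly2 := ∑ l with F ∈ M.faces l, d l
  let q : ScalarWeak ι κ := (0, Pi.single F J)
  have hJdeg : J.totalDegree ≤ k :=
    MvPolynomial.totalDegree_finsetSum_le fun l _ =>
      MvPolynomial.totalDegree_finsetSum_le fun a _ => (totalDegree_mul_C_le _ _).trans
        (((M.face F).totalDegree_restr_le _).trans (hv l a))
  have hq : q ∈ M.Wh0 k := by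
    refine ⟨⟨fun i => by simp [q], fun G => ?_⟩, fun G hG y _ => ?_⟩
    · by_cases hGF : G = F
      · subst hGF
        simpa [q] using hJdeg
      · simp [q, Pi.single_eq_of_ne hGF]
    · have hGF : G ≠ F := by
        rintro rfl
        exact hF hG
      simp [q, Pi.single_eq_of_ne hGF, ev2]
  have h1 := h q hq
  rw [M.formB_eq hr hv] at h1
  have h2 : ∀ i, innerS (M.body i) (q.1 i) (divP (v.1 i)) = 0 := by
    intro i
    simp [innerS, q, ev3]
  have h3 : ∀ l, (∑ G ∈ M.faces l, (M.face G).integral fun y =>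
      ev2 (q.2 G) y * ⟪vev (v.1 l) ((M.face G).point y), M.normal l G⟫) =
      if F ∈ M.faces l then (M.face F).integral (ev2 (J * d l)) else 0 := by
    intro l
    have h4 : ∀ G ∈ M.faces l, ((M.face G).integral fun y =>
        ev2 (q.2 G) y * ⟪vev (v.1 l) ((M.face G).point y), M.normal l G⟫) =
        if G = F then (M.face F).integral (ev2 (J * d l)) else 0 := by
      intro G _
      split_ifs with hGF
      · subst hGF
        refine Face.integral_congr _ fun y _ => ?_
        rw [ev2_mul, hd]
        simp [q]
      · refine Face.integral_eq_zero _ fun y _ => ?_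
        simp [q, Pi.single_eq_of_ne hGF, ev2]
    rw [Finset.sum_congr rfl h4, Finset.sum_ite_eq']
  simp only [h2, h3, neg_zero, zero_add] at h1
  rw [← Finset.sum_filter] at h1
  have h5 : (∑ l with F ∈ M.faces l, (M.face F).integral (ev2 (J * d l))) =
      (M.face F).integral (ev2 (J * J)) := by
    have : ev2 (J * J) = fun y => ∑ l with F ∈ M.faces l, ev2 (J * d l) y := by
      funext y
      rw [← ev2_sum, ← Finset.mul_sum]
    rw [this]
    exact (integral_finsetSum _ fun l _ => integrableOn_region _ (continuous_ev2 _)).symm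
  rw [h5] at h1
  have hJ0 : J = 0 := mul_self_eq_zero.1 ((M.face F).eq_zero_of_integral_eq_zero
    (fun y _ => by rw [ev2_mul]; exact mul_self_nonneg _) h1)
  have hfilter : ({l | F ∈ M.faces l} : Finset ι) = {i, j} := by
    ext l
    simp only [Finset.mem_filter, Finset.mem_univ, true_and, Finset.mem_insert,
      Finset.mem_singleton]
    constructor
    · exact fun hl => M.eq_or_eq_of_mem_faces hij hi hj hl
    · rintro (rfl | rfl) <;> assumption
  have h6 : d i + d j = 0 := by
    rw [← hJ0]
    simp only [J]
    rw [hfilter, Finset.sum_pair hij]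
  have h7 := congrArg (fun p => ev2 p y) h6
  simp only [ev2_add, hd] at h7
  rw [M.normal_eq_neg hij hi hj, inner_neg_right] at h7
  have h8 : ev2 0 y = 0 := by simp [ev2]
  linarith

/-! ### Uniqueness -/

omit [Fintype ι] [Fintype κ] in
theorem tanField_eq_zero_of_cross_eq_zero {F : Face} {n : E3} (hn : F.IsUnitNormal n)
    {w : Fin 2 → Poly2} (h : ∀ y ∈ F.region, cross (F.tanField w y) n = 0) : w = 0 := by
  funext a
  refine F.eq_zero_of_ev2_eq_zero fun y hy => ?_
  have hzero : F.tanField w y = 0 := by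
    refine eq_zero_of_cross_normal hn.inner_self ?_ (h y hy)
    rw [Face.tanField, inner_add_left, real_inner_smul_left, real_inner_smul_left,
      hn.inner_tangent', hn.inner_tangent', mul_zero, mul_zero, add_zero]
  have h1 : ⟪F.tanField w y, F.tangent a⟫ = ev2 (w a) y := by
    rw [Face.tanField, inner_add_left, real_inner_smul_left, real_inner_smul_left,
      F.inner_tangent_tangent, F.inner_tangent_tangent]
    fin_cases a <;> simp
  rw [← h1, hzero, inner_zero_left]

theorem vector_eq_zero (hv : v ∈ M.Vh0 k) (hr : ∀ i, k ≤ r₂ i)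
    (hcc : ∀ i, curlP (curlP (v.1 i)) = 0)
    (hjump : ∀ i, ∀ F ∈ M.faces i,
      (M.face F).tangentialJump (v.1 i) (v.2.1 F) (M.normal i F) = 0 ∧
        (M.face F).tangentialJump (curlP (v.1 i)) (v.2.2 F) (M.normal i F) = 0)
    (hB : ∀ q ∈ M.Wh0 k, M.formB r₂ v q = 0) : v = 0 := by
  have hb : ∀ i, ∀ F ∈ M.faces i, ∀ y,
      cross (vev (v.1 i) ((M.face F).point y)) (M.normal i F) =
        cross ((M.face F).tanField (v.2.1 F) y) (M.normal i F) := by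
    intro i F hF y
    rw [← sub_eq_zero, ← Face.evv2_tangentialJump, (hjump i F hF).1, evv2_zero]
  have hn : ∀ i, ∀ F ∈ M.faces i, ∀ y,
      cross (vev (curlP (v.1 i)) ((M.face F).point y)) (M.normal i F) =
        cross ((M.face F).tanField (v.2.2 F) y) (M.normal i F) := by
    intro i F hF y
    rw [← sub_eq_zero, ← Face.evv2_tangentialJump, (hjump i F hF).2, evv2_zero]
  have hbd : ∀ F i, F ∈ M.faces i → (M.face F).carrier ⊆ frontier Ω →
      ∀ y, cross ((M.face F).tanField (v.2.1 F) y) (M.normal i F) = 0 := by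
    intro F i hF hFb y
    have h0 := tanField_eq_zero_of_cross_eq_zero (M.isUnitNormal hF)
      fun y hy => (hv.2 F hFb i hF y hy).1
    rw [h0]
    simp [Face.tanField, ev2, cross_zero_left]
  have hcurl := M.curlP_eq_zero hcc hb hn hbd
  have hdiv := M.divP_eq_zero_of_formB_eq_zero hr hv.1.1 hB
  have h0 : ∀ i, v.1 i = 0 := by
    refine M.field_eq_zero hcurl hdiv (fun F i j hij hi hj hF => ?_) fun F i hi hF y => ?_
    -- The full trace of the difference vanishes: its tangential part because both sides agree with
    -- `v_b`, its normal part by the constraint.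
    · have hni := M.isUnitNormal hi
      rw [← sub_eq_zero]
      refine hni.eq_zero_of_traceP_eq_zero ?_ ?_ ?_
      · have h1 := curlP_add (v.1 i - v.1 j) (v.1 j)
        rw [sub_add_cancel, hcurl i, hcurl j, add_zero] at h1
        exact h1.symm
      · have h1 := divP_add (v.1 i - v.1 j) (v.1 j)
        rw [sub_add_cancel, hdiv i, hdiv j, add_zero] at h1
        exact h1.symm
      · refine evv2_injective fun y => ?_
        rw [Face.evv2_traceP, evv2_zero]
        refine eq_zero_of_cross_normal hni.inner_self ?_ ?_
        · rw [vev_sub, inner_sub_left,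
            M.normal_jump_eq_zero hr hv.1.1 hB hF hij hi hj y, sub_self]
        · have h1 := hb j F hj y
          rw [M.normal_eq_neg hij hi hj, cross_neg_right, cross_neg_right, neg_inj] at h1
          rw [vev_sub, cross_sub_left, hb i F hi, h1, sub_self]
    · rw [hb i F hi, hbd F i hi hF]
  refine Prod.ext (funext h0) (Prod.ext (funext fun F => ?_) (funext fun F => ?_))
  · obtain ⟨i, hi⟩ := M.exists_mem_faces F
    refine tanField_eq_zero_of_cross_eq_zero (M.isUnitNormal hi) fun y _ => ?_
    rw [← hb i F hi, h0, vev_zero, cross_zero_left]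
  · obtain ⟨i, hi⟩ := M.exists_mem_faces F
    refine tanField_eq_zero_of_cross_eq_zero (M.isUnitNormal hi) fun y _ => ?_
    have hc : curlP (0 : Fin 3 → Poly3) = 0 := by
      funext a
      fin_cases a <;> simp [curlP]
    rw [← hn i F hi, h0, hc, vev_zero, cross_zero_left]

end Mesh

/-! ### The linear system -/

theorem innerV_add_left {T : Set E3} (hT : Bornology.IsBounded T) (p q r : Fin 3 → Poly3) :
    innerV T (p + q) r = innerV T p r + innerV T q r := by
  simp only [innerV_comm T _ r, innerV_add_right hT]

theorem innerV_smul_left (T : Set E3) (c : ℝ) (p q : Fin 3 → Poly3) :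
    innerV T (c • p) q = c * innerV T p q := by
  simp only [innerV_comm T _ q, innerV_smul_right]

theorem innerV_self_nonneg (T : Set E3) (p : Fin 3 → Poly3) : 0 ≤ innerV T p p :=
  integral_nonneg fun _ => real_inner_self_nonneg

theorem innerS_add_left {T : Set E3} (hT : Bornology.IsBounded T) (p q r : Poly3) :
    innerS T (p + q) r = innerS T p r + innerS T q r := by
  have hc : ∀ s t : Poly3, innerS T s t = innerS T t s := fun s t => by
    simp only [innerS, mul_comm]
  rw [hc, innerS_add_right hT, hc r, hc r]

theorem innerS_smul_left (T : Set E3) (c : ℝ) (p q : Poly3) :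
    innerS T (c • p) q = c * innerS T p q := by
  have hc : ∀ s t : Poly3, innerS T s t = innerS T t s := fun s t => by
    simp only [innerS, mul_comm]
  rw [hc, innerS_smul_right, hc q]

theorem ev2_smul (c : ℝ) (p : Poly2) (x : E2) : ev2 (c • p) x = c * ev2 p x := by
  simp [ev2, MvPolynomial.smul_eval]

theorem cross_add_left (a b c : E3) : cross (a + b) c = cross a c + cross b c := by
  ext i; simp [cross]

theorem Face.tanField_add (F : Face) (w z : Fin 2 → Poly2) (x : E2) :
    F.tanField (w + z) x = F.tanField w x + F.tanField z x := by
  simp only [Face.tanField, Pi.add_apply, ev2_add, add_smul]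
  abel

theorem Face.tanField_smul (F : Face) (c : ℝ) (w : Fin 2 → Poly2) (x : E2) :
    F.tanField (c • w) x = c • F.tanField w x := by
  simp only [Face.tanField, Pi.smul_apply, ev2_smul, mul_smul, smul_add]

theorem ext_innerV {T : Set E3} (hT : IsOpen T) (hne : T.Nonempty) (hb : Bornology.IsBounded T)
    {r : ℕ} {g g' : PolyVec r}
    (h : ∀ q : PolyVec r, innerV T g.toField q.toField = innerV T g'.toField q.toField) :
    g = g' := by
  let L : PolyVec r →ₗ[ℝ] ℝ :=
    { toFun := fun q => innerV T g'.toField q.toField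
      map_add' := fun q q' => innerV_add_right hb _ _ _
      map_smul' := fun c q => innerV_smul_right T c _ _ }
  exact (existsUnique_represent hT hne hb L).unique h fun _ => rfl

namespace Mesh

variable {Ω : Set E3} {ι κ : Type*} (M : Mesh Ω ι κ)

/-- The discrete weak gradient as a linear map. -/
def weakGradLin (i : ι) (r : ℕ) : ScalarWeak ι κ →ₗ[ℝ] PolyVec r where
  toFun := M.weakGrad i r
  map_add' σ τ := by
    refine ext_innerV (M.isOpen_body i) (M.nonempty_body i) (M.isBounded_body i) fun ψ => ?_
    have hf : (M.weakGrad i r σ + M.weakGrad i r τ).toField =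
      (M.weakGrad i r σ).toField + (M.weakGrad i r τ).toField := rfl
    have hs : ∀ F, ((M.face F).integral fun x =>
        ev2 ((σ + τ).2 F) x * ⟪vev ψ.toField ((M.face F).point x), M.normal i F⟫) =
        ((M.face F).integral fun x =>
          ev2 (σ.2 F) x * ⟪vev ψ.toField ((M.face F).point x), M.normal i F⟫) +
        (M.face F).integral fun x =>
          ev2 (τ.2 F) x * ⟪vev ψ.toField ((M.face F).point x), M.normal i F⟫ := fun F => by
      have hc : ∀ p : Poly2, Continuous fun x =>
          ev2 p x * ⟪vev ψ.toField ((M.face F).point x), M.normal i F⟫ := fun p =>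
        (continuous_ev2 p).mul
          (((continuous_vev _).comp (continuous_point _)).inner continuous_const)
      rw [← Face.integral_add _ (hc _) (hc _)]
      simp only [Prod.snd_add, Pi.add_apply, ev2_add, add_mul]
    rw [hf, innerV_add_left (M.isBounded_body i)]
    simp only [weakGrad_spec, hs, Finset.sum_add_distrib, Prod.fst_add, Pi.add_apply,
      innerS_add_left (M.isBounded_body i)]
    ring
  map_smul' c σ := by
    refine ext_innerV (M.isOpen_body i) (M.nonempty_body i) (M.isBounded_body i) fun ψ => ?_
    have hf : (c • M.weakGrad i r σ).toField = c • (M.weakGrad i r σ).toField := rfl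
    have hs : ∀ F, ((M.face F).integral fun x =>
        ev2 ((c • σ).2 F) x * ⟪vev ψ.toField ((M.face F).point x), M.normal i F⟫) =
        c * (M.face F).integral fun x =>
          ev2 (σ.2 F) x * ⟪vev ψ.toField ((M.face F).point x), M.normal i F⟫ := fun F => by
      rw [← Face.integral_const_mul]
      simp only [Prod.smul_snd, Pi.smul_apply, ev2_smul, mul_assoc]
    rw [RingHom.id_apply, hf, innerV_smul_left]
    simp only [weakGrad_spec, hs, ← Finset.mul_sum, Prod.smul_fst, Pi.smul_apply,
      innerS_smul_left]
    ring

/-- The discrete weak curl-curl as a linear map. -/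
def weakCurlCurlLin (i : ι) (r : ℕ) : VectorWeak ι κ →ₗ[ℝ] PolyVec r where
  toFun := M.weakCurlCurl i r
  map_add' u v := by
    refine ext_innerV (M.isOpen_body i) (M.nonempty_body i) (M.isBounded_body i) fun q => ?_
    have hf : (M.weakCurlCurl i r u + M.weakCurlCurl i r v).toField =
      (M.weakCurlCurl i r u).toField + (M.weakCurlCurl i r v).toField := rfl
    have hs : ∀ (w z : Fin 2 → Poly2) (f : Fin 3 → Poly3) (F : κ),
        ((M.face F).integral fun x => ⟪cross ((M.face F).tanField (w + z) x) (M.normal i F),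
          vev f ((M.face F).point x)⟫) =
        ((M.face F).integral fun x => ⟪cross ((M.face F).tanField w x) (M.normal i F),
          vev f ((M.face F).point x)⟫) +
        (M.face F).integral fun x => ⟪cross ((M.face F).tanField z x) (M.normal i F),
          vev f ((M.face F).point x)⟫ := fun w z f F => by
      have hc : ∀ w : Fin 2 → Poly2, Continuous fun x =>
          ⟪cross ((M.face F).tanField w x) (M.normal i F), vev f ((M.face F).point x)⟫ := fun w =>
        (continuous_cross (continuous_tanField _ _) continuous_const).inner
          ((continuous_vev _).comp (continuous_point _))
      rw [← Face.integral_add _ (hc w) (hc z)]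
      simp only [Face.tanField_add, cross_add_left, inner_add_left]
    rw [hf, innerV_add_left (M.isBounded_body i)]
    simp only [weakCurlCurl_spec, hs, Finset.sum_add_distrib, Prod.fst_add, Prod.snd_add,
      Pi.add_apply, innerV_add_left (M.isBounded_body i)]
    ring
  map_smul' c v := by
    refine ext_innerV (M.isOpen_body i) (M.nonempty_body i) (M.isBounded_body i) fun q => ?_
    have hf : (c • M.weakCurlCurl i r v).toField = c • (M.weakCurlCurl i r v).toField := rfl
    have hs : ∀ (w : Fin 2 → Poly2) (f : Fin 3 → Poly3) (F : κ),
        ((M.face F).integral fun x => ⟪cross ((M.face F).tanField (c • w) x) (M.normal i F),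
          vev f ((M.face F).point x)⟫) =
        c * (M.face F).integral fun x => ⟪cross ((M.face F).tanField w x) (M.normal i F),
          vev f ((M.face F).point x)⟫ := fun w f F => by
      rw [← Face.integral_const_mul]
      simp only [Face.tanField_smul, cross_smul_left, real_inner_smul_left]
    rw [RingHom.id_apply, hf, innerV_smul_left]
    simp only [weakCurlCurl_spec, hs, ← Finset.mul_sum, Prod.smul_fst, Prod.smul_snd,
      Pi.smul_apply, innerV_smul_left]
    ring

/-! ### The discrete spaces as finite-dimensional vector spaces -/

/-- The space `W_h^0` as a submodule. -/
def Wh0Sub (k : ℕ) : Submodule ℝ (ScalarWeak ι κ) where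
  carrier := M.Wh0 k
  add_mem' {σ τ} hσ hτ :=
    ⟨⟨fun i => (MvPolynomial.totalDegree_add _ _).trans (max_le (hσ.1.1 i) (hτ.1.1 i)),
      fun F => (MvPolynomial.totalDegree_add _ _).trans (max_le (hσ.1.2 F) (hτ.1.2 F))⟩,
      fun F hF x hx => by
        rw [Prod.snd_add, Pi.add_apply, ev2_add, hσ.2 F hF x hx, hτ.2 F hF x hx, add_zero]⟩
  zero_mem' := ⟨⟨fun i => by simp, fun F => by simp⟩, fun F _ x _ => by simp [ev2]⟩
  smul_mem' c σ hσ :=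
    ⟨⟨fun i => (MvPolynomial.totalDegree_smul_le _ _).trans (hσ.1.1 i),
      fun F => (MvPolynomial.totalDegree_smul_le _ _).trans (hσ.1.2 F)⟩,
      fun F hF x hx => by
        rw [Prod.smul_snd, Pi.smul_apply, ev2_smul, hσ.2 F hF x hx, mul_zero]⟩

/-- The space `V_h^0` as a submodule. -/
def Vh0Sub (k : ℕ) : Submodule ℝ (VectorWeak ι κ) where
  carrier := M.Vh0 k
  add_mem' {u v} hu hv :=
    ⟨⟨fun i a => (MvPolynomial.totalDegree_add _ _).trans (max_le (hu.1.1 i a) (hv.1.1 i a)),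
      fun F a => (MvPolynomial.totalDegree_add _ _).trans (max_le (hu.1.2.1 F a) (hv.1.2.1 F a)),
      fun F a => (MvPolynomial.totalDegree_add _ _).trans (max_le (hu.1.2.2 F a) (hv.1.2.2 F a))⟩,
      fun F hF i hi x hx => by
        have h1 := hu.2 F hF i hi x hx
        have h2 := hv.2 F hF i hi x hx
        simp only [Prod.snd_add, Prod.fst_add, Pi.add_apply, Face.tanField_add, cross_add_left,
          h1.1, h1.2, h2.1, h2.2, add_zero, and_self]⟩
  zero_mem' := ⟨⟨fun i a => by simp, fun F a => by simp, fun F a => by simp⟩,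
    fun F _ i _ x _ => by
      simp [Face.tanField, ev2, cross_zero_left]⟩
  smul_mem' c v hv :=
    ⟨⟨fun i a => (MvPolynomial.totalDegree_smul_le _ _).trans (hv.1.1 i a),
      fun F a => (MvPolynomial.totalDegree_smul_le _ _).trans (hv.1.2.1 F a),
      fun F a => (MvPolynomial.totalDegree_smul_le _ _).trans (hv.1.2.2 F a)⟩,
      fun F hF i hi x hx => by
        have h1 := hv.2 F hF i hi x hx
        simp only [Prod.smul_snd, Prod.smul_fst, Pi.smul_apply, Face.tanField_smul,
          cross_smul_left, h1.1, h1.2, smul_zero, and_self]⟩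

instance finite_Wh0Sub [Finite ι] [Finite κ] (k : ℕ) : Module.Finite ℝ (M.Wh0Sub k) := by
  let f : M.Wh0Sub k →ₗ[ℝ] (ι → MvPolynomial.restrictTotalDegree (Fin 3) ℝ k) ×
      (κ → MvPolynomial.restrictTotalDegree (Fin 2) ℝ k) :=
    { toFun := fun σ =>
        (fun i => ⟨σ.1.1 i, (MvPolynomial.mem_restrictTotalDegree _ _ _).2 (σ.2.1.1 i)⟩,
          fun F => ⟨σ.1.2 F, (MvPolynomial.mem_restrictTotalDegree _ _ _).2 (σ.2.1.2 F)⟩)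
      map_add' := fun _ _ => rfl
      map_smul' := fun _ _ => rfl }
  refine Module.Finite.of_injective f fun σ τ h => Subtype.ext (Prod.ext ?_ ?_)
  · exact funext fun i => congrArg Subtype.val (congrFun (congrArg Prod.fst h) i)
  · exact funext fun F => congrArg Subtype.val (congrFun (congrArg Prod.snd h) F)

instance finite_Vh0Sub [Finite ι] [Finite κ] (k : ℕ) : Module.Finite ℝ (M.Vh0Sub k) := by
  let f : M.Vh0Sub k →ₗ[ℝ] (ι → Fin 3 → MvPolynomial.restrictTotalDegree (Fin 3) ℝ k) ×
      (κ → Fin 2 → MvPolynomial.restrictTotalDegree (Fin 2) ℝ k) ×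
      (κ → Fin 2 → MvPolynomial.restrictTotalDegree (Fin 2) ℝ (k - 1)) :=
    { toFun := fun v =>
        (fun i a => ⟨v.1.1 i a, (MvPolynomial.mem_restrictTotalDegree _ _ _).2 (v.2.1.1 i a)⟩,
          fun F a => ⟨v.1.2.1 F a, (MvPolynomial.mem_restrictTotalDegree _ _ _).2 (v.2.1.2.1 F a)⟩,
          fun F a => ⟨v.1.2.2 F a, (MvPolynomial.mem_restrictTotalDegree _ _ _).2 (v.2.1.2.2 F a)⟩)
      map_add' := fun _ _ => rfl
      map_smul' := fun _ _ => rfl }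
  refine Module.Finite.of_injective f fun u v h => Subtype.ext (Prod.ext ?_ (Prod.ext ?_ ?_))
  · exact funext fun i => funext fun a =>
      congrArg Subtype.val (congrFun (congrFun (congrArg Prod.fst h) i) a)
  · exact funext fun F => funext fun a =>
      congrArg Subtype.val (congrFun (congrFun (congrArg (fun z => z.2.1) h) F) a)
  · exact funext fun F => funext fun a =>
      congrArg Subtype.val (congrFun (congrFun (congrArg (fun z => z.2.2) h) F) a)

theorem meshSize_pos (i : ι) : 0 < M.meshSize i := by
  refine Metric.diam_pos ?_ (M.isBounded_body i)
  by_contra h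
  rw [Set.not_nontrivial_iff] at h
  obtain ⟨x, hx⟩ := M.nonempty_body i
  have h1 : M.body i = {x} := h.eq_singleton_of_mem hx
  exact not_isOpen_singleton x (h1 ▸ M.isOpen_body i)

/-- Without faces the frontier would be empty and the bounded element would be all of space. The
bound is what turns `2N + k - 1 ≤ r₂` into `k ≤ r₂`. -/
theorem card_faces_pos (i : ι) : 0 < (M.faces i).card := by
  by_contra h
  have h0 : M.faces i = ∅ := Finset.card_eq_zero.1 (by omega)
  have h1 := M.frontier_body i
  simp only [h0, Finset.notMem_empty, iUnion_of_empty, iUnion_empty] at h1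
  have h2 : M.body i = univ :=
    (isClopen_iff_frontier_eq_empty.2 h1).eq_univ (M.nonempty_body i)
  have h3 := M.isBounded_body i
  rw [h2] at h3
  exact NormedSpace.unbounded_univ ℝ E3 h3

/-! ### The forms and the load as linear maps -/

section Forms

variable [Fintype ι]

/-- The form `a` as a bilinear map. -/
def formALin (r₁ : ι → ℕ) : VectorWeak ι κ →ₗ[ℝ] VectorWeak ι κ →ₗ[ℝ] ℝ :=
  LinearMap.mk₂ ℝ (M.formA r₁)
    (fun u u' v => by
      have h : ∀ i, (M.weakCurlCurl i (r₁ i) (u + u')).toField =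
          (M.weakCurlCurl i (r₁ i) u).toField + (M.weakCurlCurl i (r₁ i) u').toField := fun i =>
        congrArg PolyVec.toField ((M.weakCurlCurlLin i (r₁ i)).map_add u u')
      simp only [formA, h, innerV_add_left (M.isBounded_body _), Finset.sum_add_distrib])
    (fun c u v => by
      have h : ∀ i, (M.weakCurlCurl i (r₁ i) (c • u)).toField =
          c • (M.weakCurlCurl i (r₁ i) u).toField := fun i =>
        congrArg PolyVec.toField ((M.weakCurlCurlLin i (r₁ i)).map_smul c u)
      simp only [formA, h, innerV_smul_left, Finset.mul_sum, smul_eq_mul])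
    (fun u v v' => by
      have h : ∀ i, (M.weakCurlCurl i (r₁ i) (v + v')).toField =
          (M.weakCurlCurl i (r₁ i) v).toField + (M.weakCurlCurl i (r₁ i) v').toField := fun i =>
        congrArg PolyVec.toField ((M.weakCurlCurlLin i (r₁ i)).map_add v v')
      simp only [formA, h, innerV_add_right (M.isBounded_body _), Finset.sum_add_distrib])
    (fun c u v => by
      have h : ∀ i, (M.weakCurlCurl i (r₁ i) (c • v)).toField =
          c • (M.weakCurlCurl i (r₁ i) v).toField := fun i =>
        congrArg PolyVec.toField ((M.weakCurlCurlLin i (r₁ i)).map_smul c v)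
      simp only [formA, h, innerV_smul_right, Finset.mul_sum, smul_eq_mul])

/-- The form `b` as a bilinear map. -/
def formBLin (r₂ : ι → ℕ) : VectorWeak ι κ →ₗ[ℝ] ScalarWeak ι κ →ₗ[ℝ] ℝ :=
  LinearMap.mk₂ ℝ (M.formB r₂)
    (fun u u' q => by
      simp only [formB, Prod.fst_add, Pi.add_apply, innerV_add_left (M.isBounded_body _),
        Finset.sum_add_distrib])
    (fun c u q => by
      simp only [formB, Prod.smul_fst, Pi.smul_apply, innerV_smul_left, Finset.mul_sum,
        smul_eq_mul])
    (fun u q q' => by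
      have h : ∀ i, (M.weakGrad i (r₂ i) (q + q')).toField =
          (M.weakGrad i (r₂ i) q).toField + (M.weakGrad i (r₂ i) q').toField := fun i =>
        congrArg PolyVec.toField ((M.weakGradLin i (r₂ i)).map_add q q')
      simp only [formB, h, innerV_add_right (M.isBounded_body _), Finset.sum_add_distrib])
    (fun c u q => by
      have h : ∀ i, (M.weakGrad i (r₂ i) (c • q)).toField =
          c • (M.weakGrad i (r₂ i) q).toField := fun i =>
        congrArg PolyVec.toField ((M.weakGradLin i (r₂ i)).map_smul c q)
      simp only [formB, h, innerV_smul_right, Finset.mul_sum, smul_eq_mul])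

/-- The form `c` as a bilinear map. -/
def formCLin (r₂ : ι → ℕ) : ScalarWeak ι κ →ₗ[ℝ] ScalarWeak ι κ →ₗ[ℝ] ℝ :=
  have hadd : ∀ (p q : ScalarWeak ι κ) i, (M.weakGrad i (r₂ i) (p + q)).toField =
      (M.weakGrad i (r₂ i) p).toField + (M.weakGrad i (r₂ i) q).toField := fun p q i =>
    congrArg PolyVec.toField ((M.weakGradLin i (r₂ i)).map_add p q)
  have hsmul : ∀ (c : ℝ) (p : ScalarWeak ι κ) i, (M.weakGrad i (r₂ i) (c • p)).toField =
      c • (M.weakGrad i (r₂ i) p).toField := fun c p i =>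
    congrArg PolyVec.toField ((M.weakGradLin i (r₂ i)).map_smul c p)
  LinearMap.mk₂ ℝ (M.formC r₂)
    (fun p p' q => by
      simp only [formC, hadd, innerV_add_left (M.isBounded_body _), mul_add,
        Finset.sum_add_distrib])
    (fun c p q => by
      simp only [formC, hsmul, innerV_smul_left, Finset.mul_sum, smul_eq_mul, mul_left_comm])
    (fun p q q' => by
      simp only [formC, hadd, innerV_add_right (M.isBounded_body _), mul_add,
        Finset.sum_add_distrib])
    (fun c p q => by
      simp only [formC, hsmul, innerV_smul_right, Finset.mul_sum, smul_eq_mul, mul_left_comm])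

@[simp] theorem formALin_apply (r₁ : ι → ℕ) (u v : VectorWeak ι κ) :
    M.formALin r₁ u v = M.formA r₁ u v := rfl

@[simp] theorem formBLin_apply (r₂ : ι → ℕ) (u : VectorWeak ι κ) (q : ScalarWeak ι κ) :
    M.formBLin r₂ u q = M.formB r₂ u q := rfl

@[simp] theorem formCLin_apply (r₂ : ι → ℕ) (p q : ScalarWeak ι κ) :
    M.formCLin r₂ p q = M.formC r₂ p q := rfl

omit [Fintype ι] in
theorem integrableOn_inner_vev {f : E3 → E3} (hf : MemLp f 2 (volume.restrict Ω)) (i : ι)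
    (q : Fin 3 → Poly3) : IntegrableOn (fun x => ⟪f x, vev q x⟫) (M.body i) := by
  have hf' : MemLp f 2 (volume.restrict (M.body i)) :=
    hf.mono_measure (Measure.restrict_mono (M.body_subset i) le_rfl)
  have hq : MemLp (vev q) 2 (volume.restrict (M.body i)) := by
    rw [memLp_two_iff_integrable_sq_norm (continuous_vev q).aestronglyMeasurable]
    exact integrableOn_bounded (M.isBounded_body i) ((continuous_vev q).norm.pow 2)
  refine (hf'.norm.integrable_mul hq.norm).mono
    (hf'.aestronglyMeasurable.inner hq.aestronglyMeasurable) (Eventually.of_forall fun x => ?_)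
  simpa using norm_inner_le_norm (𝕜 := ℝ) (f x) (vev q x)

/-- The load as a linear functional. -/
def loadLin {f : E3 → E3} (hf : MemLp f 2 (volume.restrict Ω)) : VectorWeak ι κ →ₗ[ℝ] ℝ where
  toFun := M.load f
  map_add' u v := by
    simp only [load, ← Finset.sum_add_distrib]
    refine Finset.sum_congr rfl fun i _ => ?_
    rw [← integral_add (M.integrableOn_inner_vev hf i _) (M.integrableOn_inner_vev hf i _)]
    simp only [Prod.fst_add, Pi.add_apply, vev_add, inner_add_right]
  map_smul' c v := by
    simp only [load, RingHom.id_apply, smul_eq_mul, Finset.mul_sum]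
    refine Finset.sum_congr rfl fun i _ => ?_
    rw [← integral_const_mul]
    simp only [Prod.smul_fst, Pi.smul_apply, vev_smul, inner_smul_right]

/-! ### Definiteness, uniqueness and solvability -/

variable {M} {k : ℕ} {r₁ r₂ : ι → ℕ}

theorem weakCurlCurl_eq_zero_of_formA_eq_zero {v : VectorWeak ι κ} (h : M.formA r₁ v v = 0)
    (i : ι) : M.weakCurlCurl i (r₁ i) v = 0 := by
  rw [formA, Finset.sum_eq_zero_iff_of_nonneg fun i _ => innerV_self_nonneg _ _] at h
  have h1 := innerV_self_eq_zero (M.isOpen_body i) (M.nonempty_body i) (M.isBounded_body i)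
    (h i (Finset.mem_univ i))
  exact funext fun a => Subtype.ext (congrFun h1 a)

theorem weakGrad_eq_zero_of_formC_eq_zero {q : ScalarWeak ι κ} (h : M.formC r₂ q q = 0)
    (i : ι) : M.weakGrad i (r₂ i) q = 0 := by
  rw [formC, Finset.sum_eq_zero_iff_of_nonneg fun i _ =>
    mul_nonneg (pow_nonneg (M.meshSize_pos i).le 4) (innerV_self_nonneg _ _)] at h
  have h1 := innerV_self_eq_zero (M.isOpen_body i) (M.nonempty_body i) (M.isBounded_body i)
    ((mul_eq_zero.1 (h i (Finset.mem_univ i))).resolve_left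
      (pow_pos (M.meshSize_pos i) 4).ne')
  exact funext fun a => Subtype.ext (congrFun h1 a)

theorem formA_self_nonneg (v : VectorWeak ι κ) : 0 ≤ M.formA r₁ v v :=
  Finset.sum_nonneg fun _ _ => innerV_self_nonneg _ _

theorem formC_self_nonneg (q : ScalarWeak ι κ) : 0 ≤ M.formC r₂ q q :=
  Finset.sum_nonneg fun i _ =>
    mul_nonneg (pow_nonneg (M.meshSize_pos i).le 4) (innerV_self_nonneg _ _)

/-- The scheme with zero load has only the zero solution. -/
theorem eq_zero_of_homogeneous [Fintype κ] (hk : 2 ≤ k)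
    (hr₁ : ∀ i, 2 * (M.faces i).card + k - 2 ≤ r₁ i ∧
      (M.HasUncutFace i ∨ 2 * (M.faces i).card + k - 1 ≤ r₁ i))
    (hr₂ : ∀ i, 2 * (M.faces i).card + k - 1 ≤ r₂ i)
    {u : VectorWeak ι κ} {p : ScalarWeak ι κ} (hu : u ∈ M.Vh0 k) (hp : p ∈ M.Wh0 k)
    (h1 : ∀ v ∈ M.Vh0 k, M.formA r₁ u v + M.formB r₂ v p = 0)
    (h2 : ∀ q ∈ M.Wh0 k, M.formC r₂ p q - M.formB r₂ u q = 0) : u = 0 ∧ p = 0 := by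
  have e1 := h1 u hu
  have e2 := h2 p hp
  have hA := formA_self_nonneg (M := M) (r₁ := r₁) u
  have hC := formC_self_nonneg (M := M) (r₂ := r₂) p
  -- The two tested equations add up to `a(u,u) + c(p,p) = 0` with both terms non-negative.
  have hcc := weakCurlCurl_eq_zero_of_formA_eq_zero (by linarith : M.formA r₁ u u = 0)
  have hg := weakGrad_eq_zero_of_formC_eq_zero (by linarith : M.formC r₂ p p = 0)
  have hp0 : p = 0 := M.scalar_eq_zero hp
    (fun i => M.gradP_eq_zero_of_weakGrad_eq_zero (by omega) (hr₂ i) (hp.1.1 i) (hg i))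
    (fun i F hF => M.eq_restr_of_weakGrad_eq_zero (by omega) (hr₂ i) (hp.1.1 i) hp.1.2 (hg i) hF)
  refine ⟨M.vector_eq_zero (r₂ := r₂) hu (fun i => ?_)
    (fun i => M.curlCurl_eq_zero_of_weakCurlCurl_eq_zero hk (hr₁ i).1 (hu.1.1 i) (hcc i))
    (fun i F hF => M.tangentialJump_eq_zero_of_weakCurlCurl_eq_zero hk (hr₁ i).1 (hr₁ i).2 hu.1
      (hcc i) hF) fun q hq => ?_, hp0⟩
  · have := M.card_faces_pos i
    have := hr₂ i
    omega
  -- With `p = 0` the second equation is the constraint `b(u, q) = 0`.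
  · have h3 : M.formC r₂ 0 q = 0 := by
      rw [← M.formCLin r₂ |>.map_zero₂ q]
      rfl
    have h4 := h2 q hq
    rw [hp0, h3] at h4
    linarith

/-- The operator of the scheme. -/
def schemeOp (M : Mesh Ω ι κ) (k : ℕ) (r₁ r₂ : ι → ℕ) :
    (M.Vh0Sub k × M.Wh0Sub k) →ₗ[ℝ] Module.Dual ℝ (M.Vh0Sub k × M.Wh0Sub k) :=
  LinearMap.mk₂ ℝ
    (fun w z => (M.formALin r₁ w.1 z.1 + M.formBLin r₂ z.1 w.2) +
      (M.formCLin r₂ w.2 z.2 - M.formBLin r₂ w.1 z.2))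
    (fun w w' z => by
      simp only [Prod.fst_add, Prod.snd_add, Submodule.coe_add, map_add, LinearMap.add_apply]
      ring)
    (fun c w z => by
      simp only [Prod.smul_fst, Prod.smul_snd, Submodule.coe_smul, map_smul,
        LinearMap.smul_apply, smul_eq_mul]
      ring)
    (fun w z z' => by
      simp only [Prod.fst_add, Prod.snd_add, Submodule.coe_add, map_add, LinearMap.add_apply]
      ring)
    (fun c w z => by
      simp only [Prod.smul_fst, Prod.smul_snd, Submodule.coe_smul, map_smul,
        LinearMap.smul_apply, smul_eq_mul]
      ring)

theorem schemeOp_apply (u v : M.Vh0Sub k) (p q : M.Wh0Sub k) :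
    M.schemeOp k r₁ r₂ (u, p) (v, q) = (M.formA r₁ u v + M.formB r₂ v p) +
      (M.formC r₂ p q - M.formB r₂ u q) := rfl

theorem schemeOp_apply_left (u v : M.Vh0Sub k) (p : M.Wh0Sub k) :
    M.schemeOp k r₁ r₂ (u, p) (v, 0) = M.formA r₁ u v + M.formB r₂ v p := by
  simp [schemeOp_apply, ← formBLin_apply, ← formCLin_apply]

theorem schemeOp_apply_right (u : M.Vh0Sub k) (p q : M.Wh0Sub k) :
    M.schemeOp k r₁ r₂ (u, p) (0, q) = M.formC r₂ p q - M.formB r₂ u q := by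
  simp [schemeOp_apply, ← formALin_apply, ← formBLin_apply]

theorem schemeOp_injective [Fintype κ] (hk : 2 ≤ k)
    (hr₁ : ∀ i, 2 * (M.faces i).card + k - 2 ≤ r₁ i ∧
      (M.HasUncutFace i ∨ 2 * (M.faces i).card + k - 1 ≤ r₁ i))
    (hr₂ : ∀ i, 2 * (M.faces i).card + k - 1 ≤ r₂ i) :
    Function.Injective (M.schemeOp k r₁ r₂) := by
  rw [← LinearMap.ker_eq_bot, LinearMap.ker_eq_bot']
  rintro ⟨u, p⟩ h
  obtain ⟨hu, hp⟩ := eq_zero_of_homogeneous hk hr₁ hr₂ u.2 p.2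
    (fun v hv => (schemeOp_apply_left u ⟨v, hv⟩ p).symm.trans (LinearMap.congr_fun h _))
    (fun q hq => (schemeOp_apply_right u p ⟨q, hq⟩).symm.trans (LinearMap.congr_fun h _))
  exact Prod.ext (Subtype.ext hu) (Subtype.ext hp)

/-- Both equations together say that one operator from the product space to its dual takes a given
value. It is injective, and both spaces have the same finite dimension, so it is bijective; testing
with `(v, 0)` and `(0, q)` separates the equations again. -/
theorem existsUnique_isWGSolution [Fintype κ] (hk : 2 ≤ k)
    (hr₁ : ∀ i, 2 * (M.faces i).card + k - 2 ≤ r₁ i ∧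
      (M.HasUncutFace i ∨ 2 * (M.faces i).card + k - 1 ≤ r₁ i))
    (hr₂ : ∀ i, 2 * (M.faces i).card + k - 1 ≤ r₂ i)
    {f : E3 → E3} (hf : MemLp f 2 (volume.restrict Ω)) :
    ∃! w : VectorWeak ι κ × ScalarWeak ι κ, M.IsWGSolution k r₁ r₂ f w := by
  have hinj := schemeOp_injective (M := M) hk hr₁ hr₂
  have hsurj : Function.Surjective (M.schemeOp k r₁ r₂) :=
    (LinearMap.injective_iff_surjective_of_finrank_eq_finrank
      (Subspace.dual_finrank_eq (K := ℝ) (V := M.Vh0Sub k × M.Wh0Sub k)).symm).1 hinj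
  let L : Module.Dual ℝ (M.Vh0Sub k × M.Wh0Sub k) :=
    (M.loadLin hf ∘ₗ (M.Vh0Sub k).subtype) ∘ₗ LinearMap.fst ℝ _ _
  have key : ∀ u p, M.schemeOp k r₁ r₂ (u, p) = L ↔
      (∀ v ∈ M.Vh0 k, M.formA r₁ u v + M.formB r₂ v p = M.load f v) ∧
        ∀ q ∈ M.Wh0 k, M.formC r₂ p q - M.formB r₂ u q = 0 := by
    intro u p
    constructor
    · exact fun h =>
        ⟨fun v hv => (schemeOp_apply_left u ⟨v, hv⟩ p).symm.trans (LinearMap.congr_fun h _),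
          fun q hq => (schemeOp_apply_right u p ⟨q, hq⟩).symm.trans
            ((LinearMap.congr_fun h _).trans (M.loadLin hf).map_zero)⟩
    · rintro ⟨h1, h2⟩
      refine LinearMap.ext fun z => ?_
      rw [schemeOp_apply, h1 _ z.1.2, h2 _ z.2.2, add_zero]
      rfl
  obtain ⟨⟨u, p⟩, hw⟩ := hsurj L
  refine ⟨(u, p), ⟨⟨u.2, p.2⟩, (key u p).1 hw⟩, ?_⟩
  rintro ⟨u', p'⟩ ⟨⟨hu', hp'⟩, h'⟩
  have h3 : ((⟨u', hu'⟩, ⟨p', hp'⟩) : M.Vh0Sub k × M.Wh0Sub k) = (u, p) :=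
    hinj (((key ⟨u', hu'⟩ ⟨p', hp'⟩).2 h').trans hw.symm)
  rw [Prod.ext_iff, Subtype.ext_iff, Subtype.ext_iff] at h3
  exact Prod.ext h3.1 h3.2

end Forms

end Mesh

end

end QuadCurlWG

theorem mainTheorem1 {Ω : Set QuadCurlWG.E3} {ι κ : Type*} [Fintype ι] [Fintype κ]
    (M : QuadCurlWG.Mesh Ω ι κ) (k : ℕ) (hk : 2 ≤ k) (r₁ r₂ : ι → ℕ)
    (hr₁ : ∀ i, 2 * (M.faces i).card + k - 2 ≤ r₁ i ∧
      (M.HasUncutFace i ∨ 2 * (M.faces i).card + k - 1 ≤ r₁ i))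
    (hr₂ : ∀ i, 2 * (M.faces i).card + k - 1 ≤ r₂ i) :
    (∀ f ∈ QuadCurlWG.HDivZero Ω,
      ∃! w : QuadCurlWG.VectorWeak ι κ × QuadCurlWG.ScalarWeak ι κ,
        M.IsWGSolution k r₁ r₂ f w) ∧
      ∀ w : QuadCurlWG.VectorWeak ι κ × QuadCurlWG.ScalarWeak ι κ,
        M.IsWGSolution k r₁ r₂ 0 w → w = 0 := by
  refine ⟨fun f hf => QuadCurlWG.Mesh.existsUnique_isWGSolution hk hr₁ hr₂ hf.1, ?_⟩
  rintro ⟨u, p⟩ ⟨⟨hu, hp⟩, h1, h2⟩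
  obtain ⟨rfl, rfl⟩ := QuadCurlWG.Mesh.eq_zero_of_homogeneous hk hr₁ hr₂ hu hp
    (fun v hv => (h1 v hv).trans (by simp [QuadCurlWG.Mesh.load])) h2
  rfl
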